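/- Let $d\ge 0$, let $\Omega$ be either $\mathbb R^d$ or the torus $\mathbb T^d=\mathbb R^d/\mathbb Z^d$, let $T,\delta,\lambda>0$, and let $\Gamma=C([0,T];\Omega)$ with the topology of uniform convergence. Let $\Psi:\Omega\to\mathbb R$ be Lipschitz continuous. Let $\eta$ be a strictly positive, bounded and Lipschitz continuous function on $\mathbb R^d$ (a $\mathbb Z^d$-periodic function, i.e. a function on $\mathbb T^d$, if $\Omega=\mathbb T^d$), such that for some constant $C$ one has $|\nabla\eta(y)|\le C\,\eta(y)$ at every point $y$ where $\eta$ is differentiable. Let $m_0\in\mathcal P(\Omega)$ with $\int_\Omega \Psi^-\,dm_0<\infty$, where $\Psi^-=\max(-\Psi,0)$ (so that $\int_\Gamma F(\gamma,Q)\,dQ(\gamma)$ below is well defined in $(-\infty,+\infty]$). For $\gamma,\omega\in\Gamma$ let $$K(\gamma)=\tfrac12\int_0^T|\gamma'|^2dt\ \text{ if }\gamma\in H^1,\qquad K(\gamma)=+\infty\ \text{ otherwise},$$ $$V(\gamma,\omega)=\tfrac12\int_0^T|\gamma'-\omega'|^2\,\eta(\gamma-\omega)\,dt\ \text{ if }\gamma-\omega\in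 H^1,\qquad V(\gamma,\omega)=+\infty\ \text{ otherwise},$$ and for $Q\in\mathcal P(\Gamma)$ let $$F(\gamma,Q)=\delta K(\gamma)+\Psi(\gamma(T))+\lambda\int_\Gamma V(\gamma,\omega)\,dQ(\omega)\in(-\infty,+\infty].$$ A curve $\gamma$ is called optimal (for $F(\cdot,Q)$, for fixed initial point) if $F(\gamma,Q)=\inf\{F(\omega,Q):\omega\in\Gamma,\ \omega(0)=\gamma(0)\}$. The measure $Q$ is an equilibrium if the image of $Q$ under $\gamma\mapsto\gamma(0)$ is $m_0$, $\int_\Gamma F(\gamma,Q)\,dQ(\gamma)<\infty$, and every $\gamma\in\operatorname{spt}(Q)$ is optimal. Set $$a(t,x)=\int_\Gamma\eta(x-\omega(t))\,dQ(\omega),\qquad u(t,x)=\frac1{a(t,x)}\int_\Gamma\omega'(t)\,\eta(x-\omega(t))\,dQ(\omega),$$ $$z_\gamma(t)=\delta\gamma'(t)+\lambda a(t,\gamma(t))\big(\gamma'(t)-u(t,\gamma(t))\big)\quad\text{for a.e. }t\in[0,T],$$ and let $\|z\|_\infty$ be the supremum, over all optimal curves $\gamma$ (with arbitrary initial points), of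 $\|z_\gamma\|_{L^\infty(0,T)}$. Let $Q$ be an equilibrium. Then: 1. $\|z\|_\infty<\infty$. 2. Every optimal curve $\gamma$, whether or not it belongs to $\operatorname{spt}(Q)$, is of class $C^{1,1}$ on $[0,T]$ and satisfies $|\gamma'(t)|\le\|z\|_\infty/\delta$ for every $t\in[0,T]$. 3. (Monokineticity.) If $\gamma_1,\gamma_2\in\operatorname{spt}(Q)$ and $\gamma_1(t)=\gamma_2(t)$ for some $t\in(0,T)$, then $\gamma_1'(t)=\gamma_2'(t)$. The same holds for $t=T$ if $\Psi$ is differentiable at the point $\gamma_1(T)=\gamma_2(T)$. -/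

import Mathlib

open MeasureTheory Set
open scoped ENNReal NNReal

noncomputable section

namespace VelocityMFG

/-- The Euclidean space `ℝᵈ`. -/
abbrev E (d : ℕ) : Type := EuclideanSpace ℝ (Fin d)

/-- The lattice `ℤᵈ ⊆ ℝᵈ`. -/
def intLattice (d : ℕ) : AddSubgroup (E d) where
  carrier := {x | ∀ i, ∃ n : ℤ, x i = n}
  zero_mem' := fun _ => ⟨0, by simp⟩
  add_mem' := by
    intro x y hx hy i
    obtain ⟨m, hm⟩ := hx i
    obtain ⟨n, hn⟩ := hy i
    exact ⟨m + n, by simp [hm, hn]⟩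
  neg_mem' := by
    intro x hx i
    obtain ⟨m, hm⟩ := hx i
    exact ⟨-m, by simp [hm]⟩

/-- The space domain `Ω`, written as a quotient `ℝᵈ ⧸ Λ`; the canonical map `ℝᵈ → Ω` is the
coercion. It carries the quotient topology, the quotient (geodesic) distance
and the Borel `σ`-algebra. -/
abbrev Dom {d : ℕ} (Λ : AddSubgroup (E d)) : Type := E d ⧸ Λ

/-- `Ω` has no boundary: it is the whole space `ℝᵈ = ℝᵈ ⧸ {0}` or the torus `𝕋ᵈ = ℝᵈ ⧸ ℤᵈ`. -/
def IsSpaceOrTorus {d : ℕ} (Λ : AddSubgroup (E d)) : Prop :=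
  Λ = ⊥ ∨ Λ = intLattice d

/-- The space `Γ` of continuous curves `[0,T] → Ω`. Its topology is the topology of uniform
convergence (the compact-open topology). -/
abbrev Curve {d : ℕ} (Λ : AddSubgroup (E d)) (T : ℝ) : Type := C(Icc (0 : ℝ) T, Dom Λ)

instance instMeasurableSpaceCurve {d : ℕ} (Λ : AddSubgroup (E d)) (T : ℝ) :
    MeasurableSpace (Curve Λ T) := borel _

instance instBorelSpaceCurve {d : ℕ} (Λ : AddSubgroup (E d)) (T : ℝ) :
    BorelSpace (Curve Λ T) := ⟨rfl⟩

variable {d : ℕ} {Λ : AddSubgroup (E d)} {T : ℝ}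

/-- The value `γ(t)` at a real time; the value outside `[0,T]` is irrelevant. -/
def pos (γ : Curve Λ T) (t : ℝ) : Dom Λ :=
  open Classical in if h : t ∈ Icc (0 : ℝ) T then γ ⟨t, h⟩ else 0

/-- `c` is a continuous lift to `ℝᵈ` of the curve `γ` (on `ℝᵈ` itself: `c = γ` on `[0,T]`). -/
def IsLift (γ : Curve Λ T) (c : ℝ → E d) : Prop :=
  ContinuousOn c (Icc 0 T) ∧ ∀ t ∈ Icc 0 T, (c t : Dom Λ) = pos γ t

/-- A continuous lift of `γ` to `ℝᵈ`; two lifts differ on `[0,T]` by a constant of `Λ`. -/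
def lift (γ : Curve Λ T) : ℝ → E d := Classical.epsilon (IsLift γ)

theorem isDiscrete_of_isSpaceOrTorus (hΛ : IsSpaceOrTorus Λ) : IsDiscrete (Λ : Set (E d)) := by
  have key : ∀ x ∈ Λ, ‖x‖ < 1 → x = 0 := by
    intro x hx hn
    rcases hΛ with rfl | rfl
    · simpa using hx
    · ext i
      obtain ⟨n, h⟩ := hx i
      have h1 : ‖x i‖ < 1 := (PiLp.norm_apply_le x i).trans_lt hn
      rw [h, Real.norm_eq_abs, ← Int.cast_abs] at h1
      have : |n| < 1 := by exact_mod_cast h1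
      simp [h, Int.abs_lt_one_iff.mp this]
  refine ⟨DiscreteTopology.of_forall_le_dist (r := 1) one_pos ?_⟩
  rintro ⟨x, hx⟩ ⟨y, hy⟩ hne
  by_contra hlt
  push Not at hlt
  have := key (x - y) (Λ.sub_mem hx hy) (by rw [← dist_eq_norm]; exact hlt)
  exact hne (Subtype.ext (sub_eq_zero.mp this))

/-- Every continuous curve in `Ω` has a continuous lift. -/
theorem isLift_lift (hΛ : IsSpaceOrTorus Λ) (hT : 0 < T) (γ : Curve Λ T) : IsLift γ (lift γ) := by
  apply Classical.epsilon_spec (p := IsLift γ)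
  have cov := (AddSubgroup.isAddQuotientCoveringMap_of_comm Λ
    (isDiscrete_of_isSpaceOrTorus hΛ)).isCoveringMap
  let g : C(unitInterval, Dom Λ) :=
    ⟨fun s => γ ⟨T * s, by have := s.2.1; have := s.2.2; constructor <;> nlinarith⟩, by fun_prop⟩
  obtain ⟨e, he⟩ := QuotientAddGroup.mk_surjective (g 0)
  obtain ⟨G, hG, -⟩ := cov.exists_path_lifts g e he.symm
  refine ⟨fun t => G (projIcc 0 1 zero_le_one (t / T)), by fun_prop, fun t ht => ?_⟩
  have h1 : t / T ∈ Icc (0 : ℝ) 1 := ⟨by have := ht.1; positivity, (div_le_one hT).2 ht.2⟩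
  have := congrFun hG ⟨t / T, h1⟩
  simp only [projIcc_of_mem zero_le_one h1, pos, dif_pos ht]
  simp only [Function.comp] at this
  rw [this]
  change γ _ = γ _
  congr 2
  simp only
  field_simp

/-- The velocity `γ'(t)` for `t ∈ [0,T]` (one-sided at the end points), whenever the curve is
differentiable at `t`. -/
def velocity (γ : Curve Λ T) (t : ℝ) : E d := derivWithin (lift γ) (Icc 0 T) t

/-- The velocity does not depend on the lift. -/
theorem velocity_eq (hΛ : IsSpaceOrTorus Λ) (hT : 0 < T) (γ : Curve Λ T) {c : ℝ → E d}
    (hc : IsLift γ c) {t : ℝ} (ht : t ∈ Icc 0 T) : velocity γ t = derivWithin c (Icc 0 T) t := by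
  have hl := isLift_lift hΛ hT γ
  have hd := isDiscrete_of_isSpaceOrTorus hΛ
  have hmem : ∀ s ∈ Icc 0 T, lift γ s - c s ∈ Λ := fun s hs => by
    have := (hl.2 s hs).trans (hc.2 s hs).symm
    have h2 := QuotientAddGroup.eq.mp this.symm
    rwa [neg_add_eq_sub] at h2
  have hcon : ∀ s ∈ Icc 0 T, lift γ s - c s = lift γ t - c t := fun s hs =>
    isPreconnected_Icc.constant_of_mapsTo (T := (Λ : Set (E d))) hd (hl.1.sub hc.1)
      (fun s hs => hmem s hs) hs ht
  have heq : EqOn (lift γ) (fun s => (lift γ t - c t) + c s) (Icc 0 T) := fun s hs => by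
    simp only [← hcon s hs, sub_add_cancel]
  rw [velocity, derivWithin_congr heq (heq ht), derivWithin_const_add_fun]
/-- `γ ∈ H¹([0,T];Ω)`: the curve has a (weak) derivative `v ∈ L²`. Such a `v` is
almost everywhere equal to `velocity γ`. -/
def IsH1 (γ : Curve Λ T) : Prop :=
  ∃ v : ℝ → E d, MemLp v 2 (volume.restrict (Icc 0 T)) ∧
    ∀ t ∈ Icc 0 T, pos γ t = pos γ 0 + ((∫ s in (0 : ℝ)..t, v s : E d) : Dom Λ)

/-- The kinetic energy `K(γ) = ½ ∫₀ᵀ |γ'|² dt`, `+∞` outside `H¹`. -/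
def kinetic (γ : Curve Λ T) : ℝ≥0∞ :=
  open Classical in
  if IsH1 γ then 2⁻¹ * ∫⁻ t in Icc 0 T, ‖velocity γ t‖ₑ ^ 2 else ⊤

/-- `K_{δ,Ψ}(γ) = δ K(γ) + Ψ(γ(T))`. -/
def kineticCost (δ : ℝ) (Ψ : Dom Λ → ℝ) (γ : Curve Λ T) : EReal :=
  ((ENNReal.ofReal δ * kinetic γ : ℝ≥0∞) : EReal) + (Ψ (pos γ T) : EReal)

/-- The interaction cost `V(γ,ω) = ½ ∫₀ᵀ |γ' - ω'|² η(γ - ω) dt`, `+∞` if `γ - ω ∉ H¹`. -/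
def interaction (η : Dom Λ → ℝ) (γ ω : Curve Λ T) : ℝ≥0∞ :=
  open Classical in
  if IsH1 (γ - ω) then
    2⁻¹ * ∫⁻ t in Icc 0 T, ‖velocity (γ - ω) t‖ₑ ^ 2 * ENNReal.ofReal (η (pos γ t - pos ω t))
  else ⊤

/-- The individual cost `F(γ,Q) = K_{δ,Ψ}(γ) + λ ∫ V(γ,ω) dQ(ω) ∈ (-∞,+∞]`. -/
def cost (δ lam : ℝ) (Ψ η : Dom Λ → ℝ) (Q : Measure (Curve Λ T)) (γ : Curve Λ T) : EReal :=
  kineticCost δ Ψ γ + ((ENNReal.ofReal lam * ∫⁻ ω, interaction η γ ω ∂Q : ℝ≥0∞) : EReal)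

/-- `γ` is optimal for `F(·,Q)` among the curves with the same initial point. -/
def IsOptimal (δ lam : ℝ) (Ψ η : Dom Λ → ℝ) (Q : Measure (Curve Λ T)) (γ : Curve Λ T) : Prop :=
  cost δ lam Ψ η Q γ = ⨅ (ω : Curve Λ T) (_ : pos ω 0 = pos γ 0), cost δ lam Ψ η Q ω

/-- `Q` is an equilibrium of `MFG(Ω,Ψ,δ,η,λ,m₀)`. The condition `∫ F(γ,Q) dQ(γ) < ∞` says that
the positive part of `F(·,Q)` has a finite integral. -/
structure IsEquilibrium (δ lam : ℝ) (Ψ η : Dom Λ → ℝ) (m₀ : Measure (Dom Λ))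
    (Q : Measure (Curve Λ T)) : Prop where
  isProbabilityMeasure : IsProbabilityMeasure Q
  initial : Q.map (fun γ => pos γ 0) = m₀
  cost_lt_top : ∫⁻ γ, (cost δ lam Ψ η Q γ).toENNReal ∂Q < ⊤
  optimal : ∀ γ ∈ Q.support, IsOptimal δ lam Ψ η Q γ

/-- `a(t,x) = ∫ η(x - ω(t)) dQ(ω)`. -/
def aField (η : Dom Λ → ℝ) (Q : Measure (Curve Λ T)) (t : ℝ) (x : Dom Λ) : ℝ :=
  ∫ ω, η (x - pos ω t) ∂Q

/-- `u(t,x) = a(t,x)⁻¹ ∫ ω'(t) η(x - ω(t)) dQ(ω)`. -/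
def uField (η : Dom Λ → ℝ) (Q : Measure (Curve Λ T)) (t : ℝ) (x : Dom Λ) : E d :=
  (aField η Q t x)⁻¹ • ∫ ω, η (x - pos ω t) • velocity ω t ∂Q

/-- `z_γ(t) = δ γ'(t) + λ a(t,γ(t)) (γ'(t) - u(t,γ(t)))`, defined for almost every `t`. -/
def zField (δ lam : ℝ) (η : Dom Λ → ℝ) (Q : Measure (Curve Λ T)) (γ : Curve Λ T) (t : ℝ) : E d :=
  δ • velocity γ t +
    (lam * aField η Q t (pos γ t)) • (velocity γ t - uField η Q t (pos γ t))

/-- `‖z‖_∞`: the supremum, over all curves `γ` that are optimal for `F(·,Q)` for their initial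
point, of the `L^∞(0,T)` norm of `z_γ`. -/
def zSup (δ lam : ℝ) (Ψ η : Dom Λ → ℝ) (Q : Measure (Curve Λ T)) : ℝ≥0∞ :=
  ⨆ (γ : Curve Λ T) (_ : IsOptimal δ lam Ψ η Q γ),
    eLpNorm (zField δ lam η Q γ) ⊤ (volume.restrict (Icc 0 T))

/-- `γ ∈ C^{1,1}([0,T];Ω)`: `γ` is differentiable on `[0,T]` with Lipschitz derivative. -/
def IsC11 (γ : Curve Λ T) : Prop :=
  DifferentiableOn ℝ (lift γ) (Icc 0 T) ∧ ∃ L : ℝ≥0, LipschitzOnWith L (velocity γ) (Icc 0 T)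

end VelocityMFG

end

/-! A curve is encoded by a lift of its initial point and its velocity v; perturbing v by εk moves
the position by ε∫k. The weight η need not be differentiable along the curve, but |∇η| ≤ Cη
integrates to η(x + h) ≤ exp(C|h|) η(x) (`le_exp_mul_of_norm_fderiv_le`). An upper bound is all that
a one-sided first variation at a minimizer requires (`first_variation`, `weak_bound`): in a weak
sense the momentum z satisfies |z'| ≤ G and |z(T)| ≤ L, where G is λC/2 times the interaction
density and L is the Lipschitz constant of Ψ. Comparison with the constant curve bounds ∫G uniformly
in the initial point, hence also z (`exists_forall_norm_mom_le`).

The velocity is recovered from (δ + λa)γ' = z + λau, where au integrates the velocities of the other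
curves against a weight of total mass a. Since an average does not exceed the largest speed and δ >
0, a maximum principle over Q (`ae_le_of_forall_ae_le`) gives |γ'| ≤ ‖z‖_∞/δ for almost every curve.
Then G is bounded and z is Lipschitz. The increments γ'(t) - γ'(s) satisfy an averaging inequality
of the same type, so the same principle makes the velocities Lipschitz. Only Q-typical velocities
enter the right-hand sides, so both estimates pass to every minimizer, inside the support or not
(`exists_lipschitz_velocity`).

Two minimizers that meet at an interior time can be exchanged after it (`isMin_concat`). The glued
curve is again a minimizer, so its velocity has no jump, which is monokineticity. At time T,
differentiability of Ψ gives z(T) = -∇Ψ for both curves, in an averaged sense, and at a given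
position z is strictly monotone in the velocity (`eq_of_path_end_eq`). -/

open Filter Topology

namespace VelocityMFG

/-! ### Exponential growth, Lipschitz representatives, maximum principle -/

section General

variable {F : Type*} [NormedAddCommGroup F] [NormedSpace ℝ F]

/-- Along a segment that meets the non-differentiability set in a null set, a Lipschitz function
whose gradient is controlled by its value grows at most exponentially. -/
theorem le_exp_mul_of_ae_line {f : F → ℝ} {L : ℝ≥0} (hL : LipschitzWith L f) {C : ℝ}
    (hC : ∀ y, DifferentiableAt ℝ f y → ‖fderiv ℝ f y‖ ≤ C * f y) {z v : F}
    (h : ∀ᵐ s : ℝ, DifferentiableAt ℝ f (z + s • v)) :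
    f (z + v) ≤ Real.exp (C * ‖v‖) * f z := by
  set g : ℝ → ℝ := fun s => f (z + s • v) with hg
  -- Integrating factor: `g * p` has nonpositive derivative almost everywhere. Both factors are
  -- absolutely continuous, so the product rule integrates to a comparison of the end values.
  set p : ℝ → ℝ := fun s => Real.exp (-(C * ‖v‖) * s) with hp
  have hline : LipschitzWith ‖v‖₊ (fun s : ℝ => z + s • v) := by
    refine LipschitzWith.of_dist_le_mul fun s t => ?_
    rw [dist_eq_norm, add_sub_add_left_eq_sub, ← sub_smul, norm_smul, mul_comm, dist_eq_norm,
      coe_nnnorm]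
  have hgL : LipschitzWith (L * ‖v‖₊) g := hL.comp hline
  have hgac : AbsolutelyContinuousOnInterval g 0 1 :=
    (hgL.lipschitzOnWith (s := uIcc 0 1)).absolutelyContinuousOnInterval
  have hpd : ∀ s, HasDerivAt p (p s * (-(C * ‖v‖))) s := fun s => by
    have := ((hasDerivAt_id s).const_mul (-(C * ‖v‖))).exp
    simpa [hp] using this
  have hpac : AbsolutelyContinuousOnInterval p 0 1 := by
    have hc : ContDiff ℝ 1 p := by
      rw [hp]; fun_prop
    obtain ⟨K, hK⟩ := (hc.locallyLipschitz.locallyLipschitzOn (s := uIcc (0 : ℝ) 1)).exists_lipschitzOnWith_of_compact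
      isCompact_uIcc
    exact hK.absolutelyContinuousOnInterval
  have key := hgac.integral_deriv_mul_eq_sub hpac
  have hle : ∫ x in (0 : ℝ)..1, deriv g x * p x + g x * deriv p x ≤ 0 := by
    rw [intervalIntegral.integral_of_le zero_le_one]
    refine integral_nonpos_of_ae (ae_restrict_of_ae ?_)
    filter_upwards [h] with s hs
    have hd : HasDerivAt g (fderiv ℝ f (z + s • v) v) s := by
      have h1 : HasDerivAt (fun s : ℝ => z + s • v) v s := by
        simpa using ((hasDerivAt_id s).smul_const v).const_add z
      exact hs.hasFDerivAt.comp_hasDerivAt s h1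
    rw [hd.deriv, (hpd s).deriv]
    have hp0 : 0 < p s := Real.exp_pos _
    have h1 : fderiv ℝ f (z + s • v) v ≤ C * g s * ‖v‖ :=
      (le_abs_self _).trans (((fderiv ℝ f (z + s • v)).le_opNorm v).trans
        (mul_le_mul_of_nonneg_right (hC _ hs) (norm_nonneg _)))
    have := mul_le_mul_of_nonneg_right h1 hp0.le
    change _ ≤ (0 : ℝ)
    linarith [this]
  rw [key] at hle
  simp only [hg, hp, one_smul, zero_smul, add_zero, mul_one, mul_zero, Real.exp_zero] at hle
  have he : 0 < Real.exp (C * ‖v‖) := Real.exp_pos _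
  rw [Real.exp_neg] at hle
  rw [sub_nonpos, ← div_eq_mul_inv, div_le_iff₀ he] at hle
  linarith

/-- A Lipschitz function whose gradient is controlled by its value, at the points of
differentiability, grows at most exponentially. -/
theorem le_exp_mul_of_norm_fderiv_le [FiniteDimensional ℝ F] [MeasurableSpace F] [BorelSpace F]
    {f : F → ℝ} {L : ℝ≥0} (hL : LipschitzWith L f) {C : ℝ}
    (hC : ∀ y, DifferentiableAt ℝ f y → ‖fderiv ℝ f y‖ ≤ C * f y) (x y : F) :
    f x ≤ Real.exp (C * ‖x - y‖) * f y := by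
  set v := x - y with hv
  let ν : Measure F := Measure.addHaar
  have hmeas : MeasurableSet {x | DifferentiableAt ℝ f x} := measurableSet_of_differentiableAt ℝ f
  have hae : ∀ᵐ z ∂ν, DifferentiableAt ℝ f z := hL.ae_differentiableAt
  -- Rademacher's theorem says nothing about a prescribed line. By Fubini and translation invariance
  -- almost every line parallel to `v` is good; density and closedness of the resulting inequality
  -- then reach every base point.
  have h1 : ∀ᵐ z ∂ν, ∀ᵐ s : ℝ, DifferentiableAt ℝ f (z + s • v) := by
    have hm : MeasurableSet {p : F × ℝ | DifferentiableAt ℝ f (p.1 + p.2 • v)} :=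
      hmeas.preimage (f := fun p : F × ℝ => p.1 + p.2 • v) (by fun_prop)
    rw [Measure.ae_ae_comm hm]
    refine ae_of_all _ fun s => ?_
    have := (measurePreserving_add_right ν (s • v)).quasiMeasurePreserving.ae hae
    exact this
  have hd : Dense {z | f (z + v) ≤ Real.exp (C * ‖v‖) * f z} := by
    refine Measure.dense_of_ae (μ := ν) ?_
    filter_upwards [h1] with z hz using le_exp_mul_of_ae_line hL hC hz
  have hcl : IsClosed {z | f (z + v) ≤ Real.exp (C * ‖v‖) * f z} := by
    have := hL.continuous
    exact isClosed_le (by fun_prop) (by fun_prop)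
  have hall := hcl.closure_eq ▸ hd.closure_eq
  have : y ∈ {z | f (z + v) ≤ Real.exp (C * ‖v‖) * f z} := hall ▸ mem_univ y
  simpa [hv] using this

/-- A function that is Lipschitz at almost every pair of points of an interval coincides almost
everywhere with a Lipschitz function. -/
theorem exists_lipschitz_ae_eq [FiniteDimensional ℝ F] {T : ℝ} {v : ℝ → F} {K : ℝ≥0}
    (h : ∀ᵐ t ∂(volume.restrict (Icc 0 T)), ∀ᵐ s ∂(volume.restrict (Icc 0 T)),
      ‖v t - v s‖ ≤ K * |t - s|) :
    ∃ (L : ℝ≥0) (g : ℝ → F), LipschitzWith L g ∧ v =ᵐ[volume.restrict (Icc 0 T)] g := by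
  set D : Set ℝ := {t | t ∈ Ioo 0 T ∧ ∀ᵐ s ∂(volume.restrict (Icc 0 T)), ‖v t - v s‖ ≤ K * |t - s|}
  have hD : LipschitzOnWith K v D := by
    refine LipschitzOnWith.of_dist_le_mul fun t ht t' ht' => ?_
    rw [dist_eq_norm, Real.dist_eq]
    refine le_of_forall_pos_le_add fun ε hε => ?_
    obtain ⟨ρ, hρ, hρε⟩ : ∃ ρ > 0, 2 * K * ρ ≤ ε := by
      refine ⟨ε / (2 * K + 1), by positivity, ?_⟩
      rw [mul_div_assoc', div_le_iff₀ (by positivity)]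
      nlinarith [K.2]
    have hT : ∀ᵐ s, s ∈ Icc 0 T → ‖v t - v s‖ ≤ K * |t - s| ∧ ‖v t' - v s‖ ≤ K * |t' - s| := by
      filter_upwards [(ae_restrict_iff' measurableSet_Icc).1 ht.2,
        (ae_restrict_iff' measurableSet_Icc).1 ht'.2] with s h1 h2 hs using ⟨h1 hs, h2 hs⟩
    -- Two points of `D` are compared through a third one, close to `t`, that avoids the exceptional
    -- null sets of both. Membership of `t` in the open interval leaves room for it.
    obtain ⟨s, ⟨hsT, hsρ⟩, hs⟩ := (Measure.dense_of_ae hT).inter_open_nonempty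
      (Ioo 0 T ∩ Metric.ball t ρ) (isOpen_Ioo.inter Metric.isOpen_ball)
      ⟨t, ht.1, Metric.mem_ball_self hρ⟩
    obtain ⟨h1, h2⟩ := hs (Ioo_subset_Icc_self hsT)
    rw [Metric.mem_ball, dist_comm, Real.dist_eq] at hsρ
    have h3 : ‖v t - v t'‖ ≤ ‖v t - v s‖ + ‖v t' - v s‖ := by
      rw [norm_sub_rev (v t') (v s)]; exact norm_sub_le_norm_sub_add_norm_sub _ _ _
    have h4 : |t' - s| ≤ |t - t'| + |t - s| := by
      rw [abs_sub_comm t t']; exact abs_sub_le t' t s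
    have hK := K.2
    have h5 := mul_le_mul_of_nonneg_left h4 hK
    have h6 := mul_le_mul_of_nonneg_left hsρ.le hK
    simp only [NNReal.val_eq_coe] at h5 h6
    linarith
  -- The extension of a vector-valued map may enlarge the Lipschitz constant, hence an `L` distinct
  -- from `K`.
  obtain ⟨g, hg, hgD⟩ := hD.extend_finite_dimension
  refine ⟨_, g, hg, ?_⟩
  rw [Filter.EventuallyEq, ae_restrict_congr_set Ioo_ae_eq_Icc.symm]
  rw [ae_restrict_congr_set Ioo_ae_eq_Icc.symm] at h
  filter_upwards [h, ae_restrict_mem measurableSet_Ioo] with t ht htT using hgD ⟨htT, ht⟩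

/-- A maximum principle for averaging inequalities. -/
theorem ae_le_of_forall_ae_le {Ω : Type*} [MeasurableSpace Ω] {Q : Measure Ω} {f : Ω → ℝ}
    {δ A k M₀ : ℝ} (hδ : 0 < δ) (hA : 0 ≤ A) (h0 : ∀ᵐ ω ∂Q, f ω ≤ M₀)
    (hstep : ∀ M, k / δ ≤ M → (∀ᵐ ω ∂Q, f ω ≤ M) →
      ∀ᵐ ω ∂Q, ∃ a ∈ Icc 0 A, (δ + a) * f ω ≤ k + a * M) :
    ∀ᵐ ω ∂Q, f ω ≤ k / δ := by
  set κ := k / δ with hκ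
  have hk : k = δ * κ := by rw [hκ]; field_simp
  set θ := A / (δ + A)
  have hδA : 0 < δ + A := by positivity
  have hθ0 : 0 ≤ θ := by positivity
  have hθ1 : θ < 1 := (div_lt_one hδA).2 (by linarith)
  set M := max M₀ κ
  have hM : 0 ≤ M - κ := sub_nonneg.2 (le_max_right _ _)
  -- Each application of the hypothesis multiplies the excess over κ by a/(δ + a) ≤ θ < 1. The crude
  -- bound `M₀` is only the starting point and disappears in the limit.
  have hiter : ∀ n : ℕ, ∀ᵐ ω ∂Q, f ω ≤ κ + θ ^ n * (M - κ) := by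
    intro n
    induction n with
    | zero => filter_upwards [h0] with ω hω; simpa [M] using Or.inl hω
    | succ n ih =>
      have hn : 0 ≤ θ ^ n * (M - κ) := by positivity
      filter_upwards [hstep _ (by linarith) ih] with ω ⟨a, ha, hω⟩
      have ha' : 0 < δ + a := by linarith [ha.1]
      have h1 : f ω ≤ κ + a / (δ + a) * (θ ^ n * (M - κ)) := by
        rw [← mul_le_mul_iff_right₀ ha']
        refine hω.trans (le_of_eq ?_)
        rw [hk]; field_simp; ring
      refine h1.trans ?_
      rw [pow_succ', mul_assoc]
      have : a / (δ + a) ≤ θ := by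
        rw [div_le_div_iff₀ ha' hδA]; nlinarith [ha.2]
      gcongr
  filter_upwards [ae_all_iff.2 hiter] with ω hω
  have hlim : Tendsto (fun n : ℕ => κ + θ ^ n * (M - κ)) atTop (𝓝 (κ + 0 * (M - κ))) :=
    ((tendsto_pow_atTop_nhds_zero_of_lt_one hθ0 hθ1).mul_const _).const_add _
  simpa using ge_of_tendsto' hlim hω

end General

/-! ### Testing weak differential inequalities with window functions -/

section Window

/-- The normalized indicator function of `(s, s + ρ]`. -/
noncomputable def window (s ρ : ℝ) : ℝ → ℝ := indicator (Ioc s (s + ρ)) (fun _ => ρ⁻¹)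

theorem measurable_window (s ρ : ℝ) : Measurable (window s ρ) :=
  measurable_const.indicator measurableSet_Ioc

theorem window_nonneg {s ρ : ℝ} (hρ : 0 < ρ) (t : ℝ) : 0 ≤ window s ρ t :=
  indicator_nonneg (fun _ _ => by positivity) t

theorem window_le {s ρ : ℝ} (hρ : 0 < ρ) (t : ℝ) : window s ρ t ≤ ρ⁻¹ :=
  indicator_le' (fun _ _ => le_rfl) (fun _ _ => by positivity) t

theorem integrable_window (s ρ : ℝ) : Integrable (window s ρ) :=
  (integrableOn_const (by simp)).integrable_indicator measurableSet_Ioc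

theorem integral_window {s ρ : ℝ} (hρ : 0 < ρ) : ∫ t, window s ρ t = 1 := by
  simp [window, integral_indicator measurableSet_Ioc, hρ.le, hρ.ne']

theorem integral_window_nonneg {s ρ t : ℝ} (hρ : 0 < ρ) (ht : 0 ≤ t) :
    0 ≤ ∫ τ in (0 : ℝ)..t, window s ρ τ :=
  intervalIntegral.integral_nonneg ht fun τ _ => window_nonneg hρ τ

theorem integral_window_le_one {s ρ t : ℝ} (hρ : 0 < ρ) (ht : 0 ≤ t) :
    ∫ τ in (0 : ℝ)..t, window s ρ τ ≤ 1 := by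
  rw [intervalIntegral.integral_of_le ht, ← integral_window (s := s) hρ]
  exact setIntegral_le_integral (integrable_window s ρ) (ae_of_all _ fun τ => window_nonneg hρ τ)

theorem integral_window_eq_zero {s ρ t : ℝ} (hs : 0 ≤ s) (hts : t ≤ s) :
    ∫ τ in (0 : ℝ)..t, window s ρ τ = 0 := by
  refine intervalIntegral.integral_zero_ae (ae_of_all _ fun τ hτ => ?_)
  refine indicator_of_notMem (fun h => ?_) _
  have h1 : τ ≤ max 0 t := hτ.2
  have h2 := h.1
  rcases le_total 0 t with h0 | h0
  · rw [max_eq_right h0] at h1; linarith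
  · rw [max_eq_left h0] at h1; linarith

theorem integral_window_eq_one {s ρ t : ℝ} (hρ : 0 < ρ) (hs : 0 ≤ s) (hst : s + ρ ≤ t) :
    ∫ τ in (0 : ℝ)..t, window s ρ τ = 1 := by
  rw [intervalIntegral.integral_of_le (by linarith), ← integral_window (s := s) hρ]
  refine setIntegral_eq_integral_of_forall_compl_eq_zero fun τ hτ => ?_
  refine indicator_of_notMem (fun h => hτ ⟨by linarith [h.1], h.2.trans hst⟩) _

theorem norm_integral_window_smul_le {F : Type*} [NormedAddCommGroup F] [NormedSpace ℝ F]
    [CompleteSpace F]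
    {s ρ t : ℝ} (hρ : 0 < ρ) (ht : 0 ≤ t) (e : F) :
    ‖∫ τ in (0 : ℝ)..t, window s ρ τ • e‖ ≤ ‖e‖ := by
  rw [intervalIntegral.integral_smul_const, norm_smul, Real.norm_eq_abs,
    abs_of_nonneg (integral_window_nonneg hρ ht)]
  exact mul_le_of_le_one_left (norm_nonneg _) (integral_window_le_one hρ ht)

theorem exists_norm_window_smul_le {F : Type*} [NormedAddCommGroup F] [NormedSpace ℝ F]
    {s ρ : ℝ} (hρ : 0 < ρ) (e : F) :
    ∃ M, ∀ t, ‖window s ρ t • e‖ ≤ M :=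
  ⟨ρ⁻¹ * ‖e‖, fun t => by
    rw [norm_smul, Real.norm_eq_abs, abs_of_nonneg (window_nonneg hρ t)]
    exact mul_le_mul_of_nonneg_right (window_le hρ t) (norm_nonneg _)⟩

variable {F : Type*} [NormedAddCommGroup F] [InnerProductSpace ℝ F] [CompleteSpace F]

theorem integral_inner_window_smul {T s ρ : ℝ} (hρ : 0 < ρ) (hs : 0 ≤ s) (hsT : s + ρ ≤ T)
    {z : ℝ → F} (hz : IntegrableOn z (Icc 0 T)) (e : F) :
    ∫ t in Icc 0 T, inner ℝ (z t) (window s ρ t • e)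
      = inner ℝ (ρ⁻¹ • ∫ t in s..(s + ρ), z t) e := by
  have hsub : Ioc s (s + ρ) ⊆ Icc 0 T := fun t ht => ⟨hs.trans ht.1.le, ht.2.trans hsT⟩
  have h1 : ∀ t, inner ℝ (z t) (window s ρ t • e)
      = (Ioc s (s + ρ)).indicator (fun t => ρ⁻¹ * inner ℝ (z t) e) t := fun t => by
    rw [inner_smul_right, window]
    by_cases h : t ∈ Ioc s (s + ρ) <;> simp [h]
  simp_rw [h1]
  rw [setIntegral_indicator measurableSet_Ioc, inter_eq_right.2 hsub, integral_const_mul,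
    real_inner_smul_left, intervalIntegral.integral_of_le (by linarith)]
  congr 1
  simp_rw [real_inner_comm e]
  exact integral_inner (hz.mono_set hsub) e

/-- Lebesgue differentiation, from the right because the windows start at s. Interior times are
recorded so that small windows fit in [0,T]. -/
theorem tendsto_average_right {T : ℝ} (hT : 0 ≤ T) {z : ℝ → F} (hz : IntegrableOn z (Icc 0 T)) :
    ∀ᵐ s ∂(volume.restrict (Icc 0 T)), s ∈ Ioo 0 T ∧
      Tendsto (fun ρ => ρ⁻¹ • ∫ t in s..(s + ρ), z t) (𝓝[>] 0) (𝓝 (z s)) := by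
  have hi : IntervalIntegrable z volume 0 T := by
    rw [intervalIntegrable_iff_integrableOn_Icc_of_le hT]; exact hz
  rw [ae_restrict_congr_set Ioo_ae_eq_Icc.symm]
  filter_upwards [ae_restrict_of_ae hi.ae_hasDerivAt_integral, ae_restrict_mem measurableSet_Ioo]
    with s hs hsT
  refine ⟨hsT, ?_⟩
  have hs' : s ∈ uIcc 0 T := by rw [uIcc_of_le hT]; exact Ioo_subset_Icc_self hsT
  have h1 := (hasDerivAt_iff_tendsto_slope_zero.1 (hs hs' s hs')).mono_left
    (nhdsGT_le_nhdsNE (0 : ℝ))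
  simpa using h1

variable [MeasurableSpace F] [BorelSpace F] [SecondCountableTopology F] {T L g : ℝ} {z : ℝ → F} {G : ℝ → ℝ}

-- The hypothesis is the weak form of |z'| ≤ G and |z(T)| ≤ L. A window at s times e has a primitive
-- of norm at most |e| that ends at e, so as the window shrinks the hypothesis becomes a pointwise
-- bound on z(s).
omit [SecondCountableTopology F] in
theorem ae_norm_le_of_weak_bound (hT : 0 ≤ T) (hz : IntegrableOn z (Icc 0 T))
    (hG : IntegrableOn G (Icc 0 T)) (hG0 : ∀ t, 0 ≤ G t)  (hL : 0 ≤ L)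
    (H : ∀ k : ℝ → F, Measurable k → (∃ M, ∀ t, ‖k t‖ ≤ M) →
      0 ≤ (∫ t in Icc 0 T, inner ℝ (z t) (k t))
        + (∫ t in Icc 0 T, ‖∫ s in (0 : ℝ)..t, k s‖ * G t) + L * ‖∫ s in (0 : ℝ)..T, k s‖) :
    ∀ᵐ t ∂(volume.restrict (Icc 0 T)), ‖z t‖ ≤ L + ∫ s in Icc 0 T, G s := by
  filter_upwards [tendsto_average_right hT hz] with s ⟨hsT, hs⟩
  have key : ∀ e : F, 0 ≤ inner ℝ (z s) e + ‖e‖ * (L + ∫ s in Icc 0 T, G s) := by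
    intro e
    have hlim : Tendsto (fun ρ => inner ℝ (ρ⁻¹ • ∫ t in s..(s + ρ), z t) e
        + ‖e‖ * (L + ∫ s in Icc 0 T, G s)) (𝓝[>] 0)
        (𝓝 (inner ℝ (z s) e + ‖e‖ * (L + ∫ s in Icc 0 T, G s))) :=
      (hs.inner tendsto_const_nhds).add_const _
    refine ge_of_tendsto hlim ?_
    filter_upwards [Ioo_mem_nhdsGT (show (0 : ℝ) < T - s by linarith [hsT.2])] with ρ hρ
    have h1 := H (fun t => window s ρ t • e) ((measurable_window s ρ).smul_const e)
      (exists_norm_window_smul_le hρ.1 e)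
    rw [integral_inner_window_smul hρ.1 hsT.1.le (by linarith [hρ.2]) hz] at h1
    have h2 : ∫ t in Icc 0 T, ‖∫ τ in (0 : ℝ)..t, window s ρ τ • e‖ * G t
        ≤ ∫ t in Icc 0 T, ‖e‖ * G t := by
      refine integral_mono_of_nonneg (ae_of_all _ fun t => mul_nonneg (norm_nonneg _) (hG0 t))
        (hG.const_mul _) ?_
      filter_upwards [ae_restrict_mem measurableSet_Icc] with t ht
      exact mul_le_mul_of_nonneg_right (norm_integral_window_smul_le hρ.1 ht.1 e) (hG0 t)
    rw [integral_const_mul] at h2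
    have h3 := mul_le_mul_of_nonneg_left (norm_integral_window_smul_le (s := s) hρ.1 hT e) hL
    linarith
  -- This direction turns the inequality into |z(s)|² ≤ |z(s)| (L + ∫G).
  have h := key (-(z s))
  rw [inner_neg_right, real_inner_self_eq_norm_sq, norm_neg] at h
  rcases (norm_nonneg (z s)).eq_or_lt with h0 | h0
  · rw [← h0]
    have : 0 ≤ ∫ s in Icc 0 T, G s := integral_nonneg hG0
    linarith
  · nlinarith

/-- The test function is a window at s minus a window at r. Its primitive is supported in [s, r + ρ]
and vanishes at T, so the terminal term drops out and G is integrated over a length tending to r -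
s. The Lebesgue points form one set `D` serving all pairs at once. -/
theorem ae_norm_sub_le_of_weak_bound (hT : 0 ≤ T) (hz : IntegrableOn z (Icc 0 T))
    (hG0 : ∀ t, 0 ≤ G t) (hg : 0 ≤ g) (hGg : ∀ᵐ t ∂(volume.restrict (Icc 0 T)), G t ≤ g)
    (H : ∀ k : ℝ → F, Measurable k → (∃ M, ∀ t, ‖k t‖ ≤ M) →
      0 ≤ (∫ t in Icc 0 T, inner ℝ (z t) (k t))
        + (∫ t in Icc 0 T, ‖∫ s in (0 : ℝ)..t, k s‖ * G t) + L * ‖∫ s in (0 : ℝ)..T, k s‖) :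
    ∃ D : Set ℝ, (∀ᵐ t ∂(volume.restrict (Icc 0 T)), t ∈ D) ∧
      ∀ t ∈ D, ∀ s ∈ D, ‖z t - z s‖ ≤ g * |t - s| := by
  refine ⟨_, tendsto_average_right hT hz, ?_⟩
  suffices hlt : ∀ s r : ℝ, s < r → (s ∈ Ioo 0 T ∧
      Tendsto (fun ρ => ρ⁻¹ • ∫ t in s..(s + ρ), z t) (𝓝[>] 0) (𝓝 (z s))) → (r ∈ Ioo 0 T ∧
      Tendsto (fun ρ => ρ⁻¹ • ∫ t in r..(r + ρ), z t) (𝓝[>] 0) (𝓝 (z r))) →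
      ‖z s - z r‖ ≤ g * (r - s) by
    intro t ht s hs
    rcases lt_trichotomy t s with h | rfl | h
    · rw [abs_sub_comm, abs_of_pos (sub_pos.2 h)]; exact hlt t s h ht hs
    · simp
    · rw [norm_sub_rev, abs_of_pos (sub_pos.2 h)]; exact hlt s t h hs ht
  rintro s r hsr ⟨hsT, hs⟩ ⟨hrT, hr⟩
  have key : ∀ e : F, 0 ≤ inner ℝ (z s - z r) e + ‖e‖ * (g * (r - s)) := by
    intro e
    have hlim : Tendsto (fun ρ => inner ℝ ((ρ⁻¹ • ∫ t in s..(s + ρ), z t)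
        - ρ⁻¹ • ∫ t in r..(r + ρ), z t) e + ‖e‖ * (g * (r + ρ - s))) (𝓝[>] 0)
        (𝓝 (inner ℝ (z s - z r) e + ‖e‖ * (g * (r + 0 - s)))) := by
      refine ((hs.sub hr).inner tendsto_const_nhds).add ?_
      have : Continuous fun ρ : ℝ => ‖e‖ * (g * (r + ρ - s)) := by fun_prop
      exact (this.tendsto 0).mono_left nhdsWithin_le_nhds
    rw [add_zero] at hlim
    refine ge_of_tendsto hlim ?_
    filter_upwards [Ioo_mem_nhdsGT (show (0 : ℝ) < min (T - r) (r - s) from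
      lt_min (by linarith [hrT.2]) (by linarith))] with ρ hρ
    have hρ0 : 0 < ρ := hρ.1
    have hρ1 : ρ < T - r := hρ.2.trans_le (min_le_left _ _)
    have hρ2 : ρ < r - s := hρ.2.trans_le (min_le_right _ _)
    obtain ⟨M₁, hM₁⟩ := exists_norm_window_smul_le (s := s) hρ0 e
    obtain ⟨M₂, hM₂⟩ := exists_norm_window_smul_le (s := r) hρ0 e
    have h1 := H (fun t => window s ρ t • e - window r ρ t • e)
      (((measurable_window s ρ).smul_const e).sub ((measurable_window r ρ).smul_const e))
      ⟨M₁ + M₂, fun t => (norm_sub_le _ _).trans (add_le_add (hM₁ t) (hM₂ t))⟩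
    have hint : ∀ σ, IntegrableOn (fun t => inner ℝ (z t) (window σ ρ t • e)) (Icc 0 T) := by
      intro σ
      simp_rw [inner_smul_right]
      refine (hz.inner_const e).bdd_mul (c := ρ⁻¹) (measurable_window σ ρ).aestronglyMeasurable
        (ae_of_all _ fun t => ?_)
      rw [Real.norm_eq_abs, abs_of_nonneg (window_nonneg hρ0 t)]
      exact window_le hρ0 t
    have hprim : ∀ t, ∫ τ in (0 : ℝ)..t, (window s ρ τ • e - window r ρ τ • e)
        = ((∫ τ in (0 : ℝ)..t, window s ρ τ) - ∫ τ in (0 : ℝ)..t, window r ρ τ) • e := by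
      intro t
      have hi : ∀ σ, IntervalIntegrable (fun τ => window σ ρ τ • e) volume 0 t := fun σ =>
        ((integrable_window σ ρ).smul_const e).intervalIntegrable
      rw [intervalIntegral.integral_sub (hi s) (hi r), intervalIntegral.integral_smul_const,
        intervalIntegral.integral_smul_const, sub_smul]
    simp_rw [hprim, inner_sub_right] at h1
    rw [integral_sub (hint s) (hint r),
      integral_inner_window_smul hρ0 hsT.1.le (by linarith) hz,
      integral_inner_window_smul hρ0 hrT.1.le (by linarith) hz, ← inner_sub_left,
      integral_window_eq_one hρ0 hsT.1.le (by linarith),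
      integral_window_eq_one hρ0 hrT.1.le (by linarith), sub_self, zero_smul, norm_zero,
      mul_zero, add_zero] at h1
    have h2 : ∫ t in Icc 0 T, ‖((∫ τ in (0 : ℝ)..t, window s ρ τ)
        - ∫ τ in (0 : ℝ)..t, window r ρ τ) • e‖ * G t
        ≤ ∫ t in Icc 0 T, (Ioc s (r + ρ)).indicator (fun _ => ‖e‖ * g) t := by
      refine integral_mono_of_nonneg (ae_of_all _ fun t => mul_nonneg (norm_nonneg _) (hG0 t))
        ((integrableOn_const (by simp)).indicator measurableSet_Ioc) ?_
      filter_upwards [ae_restrict_mem measurableSet_Icc, hGg] with t ht hGt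
      rw [norm_smul, Real.norm_eq_abs]
      by_cases hts : t ≤ s
      · rw [integral_window_eq_zero hsT.1.le hts,
          integral_window_eq_zero hrT.1.le (hts.trans hsr.le)]
        simp only [sub_self, abs_zero, zero_mul]
        exact indicator_nonneg (fun _ _ => by positivity) t
      · by_cases hrt : r + ρ < t
        · rw [integral_window_eq_one hρ0 hsT.1.le (by linarith),
            integral_window_eq_one hρ0 hrT.1.le hrt.le]
          simp only [sub_self, abs_zero, zero_mul]
          exact indicator_nonneg (fun _ _ => by positivity) t
        · rw [indicator_of_mem (show t ∈ Ioc s (r + ρ) from ⟨not_le.1 hts, not_lt.1 hrt⟩)]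
          have a1 := integral_window_nonneg (s := s) hρ0 ht.1
          have a2 := integral_window_nonneg (s := r) hρ0 ht.1
          have a3 := integral_window_le_one (s := s) hρ0 ht.1
          have a4 := integral_window_le_one (s := r) hρ0 ht.1
          have a5 : |(∫ τ in (0 : ℝ)..t, window s ρ τ) - ∫ τ in (0 : ℝ)..t, window r ρ τ| ≤ 1 :=
            abs_le.2 ⟨by linarith, by linarith⟩
          exact mul_le_mul (mul_le_of_le_one_left (norm_nonneg _) a5) hGt (hG0 t) (norm_nonneg _)
    have hsub : Ioc s (r + ρ) ⊆ Icc 0 T := fun t ht =>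
      ⟨hsT.1.le.trans ht.1.le, ht.2.trans (by linarith)⟩
    rw [setIntegral_indicator measurableSet_Ioc, inter_eq_right.2 hsub, setIntegral_const,
      measureReal_def, Real.volume_Ioc, ENNReal.toReal_ofReal (by linarith), smul_eq_mul] at h2
    linarith
  have h := key (-(z s - z r))
  rw [inner_neg_right, real_inner_self_eq_norm_sq, norm_neg] at h
  rcases (norm_nonneg (z s - z r)).eq_or_lt with h0 | h0
  · rw [← h0]
    have : 0 < r - s := sub_pos.2 hsr
    positivity
  · nlinarith

end Window

end VelocityMFG

/-! ### Lifts, velocities and measurability on the space of curves -/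

noncomputable section

namespace VelocityMFG

theorem memLp_two_iff_lintegral {α F : Type*} [MeasurableSpace α] [NormedAddCommGroup F]
    {μ : Measure α} {f : α → F} (hf : AEStronglyMeasurable f μ) :
    MemLp f 2 μ ↔ ∫⁻ x, ‖f x‖ₑ ^ 2 ∂μ < ⊤ := by
  rw [MemLp, and_iff_right hf,
    eLpNorm_lt_top_iff_lintegral_rpow_enorm_lt_top two_ne_zero ENNReal.ofNat_ne_top]
  simp

theorem intervalIntegrable_of_memLp_two {T : ℝ} {F : Type*} [NormedAddCommGroup F] {v : ℝ → F}
    (hv : MemLp v 2 (volume.restrict (Icc 0 T))) {a b : ℝ} (ha : a ∈ Icc 0 T) (hb : b ∈ Icc 0 T) :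
    IntervalIntegrable v volume a b := by
  have h : IntegrableOn v (Icc 0 T) := hv.integrable one_le_two
  exact (h.mono_set (uIcc_subset_Icc ha hb)).intervalIntegrable

section Curves

variable {d : ℕ} {Λ : AddSubgroup (E d)} {T : ℝ}

instance isClosed_lattice [hΛ : Fact (IsSpaceOrTorus Λ)] : IsClosed (Λ : Set (E d)) := by
  have : DiscreteTopology Λ := (isDiscrete_of_isSpaceOrTorus hΛ.out).to_subtype
  exact AddSubgroup.isClosed_of_discrete

theorem isCoveringMap_mk [hΛ : Fact (IsSpaceOrTorus Λ)] :
    IsCoveringMap (fun x : E d => (x : Dom Λ)) :=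
  (AddSubgroup.isAddQuotientCoveringMap_of_comm Λ
    (isDiscrete_of_isSpaceOrTorus hΛ.out)).isCoveringMap

theorem continuous_mk : Continuous (fun x : E d => (x : Dom Λ)) := QuotientAddGroup.continuous_mk

theorem norm_mk_le (x : E d) : ‖(x : Dom Λ)‖ ≤ ‖x‖ := QuotientAddGroup.norm_mk_le_norm

section

variable [hT : Fact (0 < T)]

/-- A curve, extended to the real line by its end point values. -/
def curveAt (γ : Curve Λ T) (t : ℝ) : Dom Λ := γ (projIcc 0 T hT.out.le t)

theorem pos_eq_curveAt (γ : Curve Λ T) {t : ℝ} (ht : t ∈ Icc 0 T) : pos γ t = curveAt γ t := by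
  rw [pos, dif_pos ht, curveAt, projIcc_of_mem _ ht]

theorem pos_zero (γ : Curve Λ T) : pos γ 0 = curveAt γ 0 :=
  pos_eq_curveAt γ (left_mem_Icc.2 hT.out.le)

theorem pos_end (γ : Curve Λ T) : pos γ T = curveAt γ T :=
  pos_eq_curveAt γ (right_mem_Icc.2 hT.out.le)

theorem continuous_curveAt : Continuous fun p : Curve Λ T × ℝ => curveAt p.1 p.2 := by
  unfold curveAt
  have : Continuous fun p : Curve Λ T × ℝ => projIcc 0 T hT.out.le p.2 :=
    continuous_projIcc.comp continuous_snd
  exact continuous_eval.comp (continuous_fst.prodMk this)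

end

variable [hΛ : Fact (IsSpaceOrTorus Λ)] [hT : Fact (0 < T)]

/-- Homotopy lifting with the whole of Γ as parameter space, applied to γ(Ts) - γ(0) and started at
the origin. Unlike a lift chosen curve by curve, it is jointly continuous in curve and time; this
makes velocities jointly measurable and Fubini available. -/
theorem exists_displacement : ∃ q : Curve Λ T → ℝ → E d,
    Continuous (Function.uncurry q) ∧ (∀ γ, q γ 0 = 0) ∧
      ∀ γ t, curveAt γ t = curveAt γ 0 + (q γ t : Dom Λ) := by
  have hT0 := hT.out
  let H : C(unitInterval × Curve Λ T, Dom Λ) :=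
    ⟨fun p => curveAt p.2 (T * p.1) - curveAt p.2 0, by
      have h1 : Continuous fun p : unitInterval × Curve Λ T => curveAt p.2 (T * p.1) :=
        continuous_curveAt.comp (f := fun p : unitInterval × Curve Λ T => (p.2, T * (p.1 : ℝ)))
          (by fun_prop)
      have h2 : Continuous fun p : unitInterval × Curve Λ T => curveAt p.2 0 :=
        continuous_curveAt.comp (f := fun p : unitInterval × Curve Λ T => (p.2, (0 : ℝ)))
          (by fun_prop)
      exact h1.sub h2⟩
  have H0 : ∀ γ, H (0, γ) = (((0 : C(Curve Λ T, E d)) γ : E d) : Dom Λ) := fun γ => by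
    simp [H]
  let G := isCoveringMap_mk.liftHomotopy H 0 H0
  refine ⟨fun γ t => G (projIcc 0 1 zero_le_one (t / T), γ), ?_, fun γ => ?_, fun γ t => ?_⟩
  · refine G.continuous.comp ?_
    exact (continuous_projIcc.comp (continuous_snd.div_const T)).prodMk continuous_fst
  · have := isCoveringMap_mk.liftHomotopy_zero H 0 H0 γ
    simpa [G] using this
  · have := congrFun (isCoveringMap_mk.liftHomotopy_lifts H 0 H0)
      (projIcc 0 1 zero_le_one (t / T), γ)
    change ((G _ : E d) : Dom Λ) = _ at this
    rw [this]
    change _ = curveAt γ 0 + (curveAt γ _ - curveAt γ 0)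
    rw [add_sub_cancel]
    unfold curveAt
    congr 1
    apply Subtype.ext
    rcases le_total t 0 with h0 | h0
    · rw [projIcc_of_le_left _ h0, projIcc_of_le_left _ (div_nonpos_of_nonpos_of_nonneg h0 hT0.le)]
      simp
    rcases le_total T t with h1 | h1
    · rw [projIcc_of_right_le _ h1, projIcc_of_right_le _ ((one_le_div hT0).2 h1)]
      simp
    · rw [projIcc_of_mem _ (show t / T ∈ Icc (0 : ℝ) 1 from ⟨by positivity, (div_le_one hT0).2 h1⟩)]
      congr 2
      field_simp

/-- The lift to `ℝᵈ`, starting from the origin, of `γ - γ(0)`. -/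
def disp (γ : Curve Λ T) (t : ℝ) : E d := exists_displacement.choose γ t

theorem continuous_disp_uncurry : Continuous (Function.uncurry (disp (Λ := Λ) (T := T))) :=
  exists_displacement.choose_spec.1

theorem continuous_disp (γ : Curve Λ T) : Continuous (disp γ) :=
  continuous_disp_uncurry.comp (Continuous.prodMk_right γ)

@[simp]
theorem disp_zero (γ : Curve Λ T) : disp γ 0 = 0 := exists_displacement.choose_spec.2.1 γ

theorem curveAt_eq (γ : Curve Λ T) (t : ℝ) : curveAt γ t = curveAt γ 0 + (disp γ t : Dom Λ) :=
  exists_displacement.choose_spec.2.2 γ t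

/-- The velocity, as the derivative of the displacement. -/
def vel (γ : Curve Λ T) (t : ℝ) : E d := deriv (disp γ) t

theorem measurable_vel : Measurable fun p : Curve Λ T × ℝ => vel p.1 p.2 :=
  measurable_deriv_with_param continuous_disp_uncurry

theorem measurable_vel_apply (γ : Curve Λ T) : Measurable (vel γ) := measurable_deriv _

theorem isLift_add_disp (γ : Curve Λ T) {x : E d} (hx : (x : Dom Λ) = curveAt γ 0) :
    IsLift γ (fun t => x + disp γ t) :=
  ⟨by have := continuous_disp γ; fun_prop, fun t ht => by
    rw [pos_eq_curveAt γ ht, curveAt_eq γ t, ← hx, QuotientAddGroup.mk_add]⟩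

theorem velocity_eq_vel (γ : Curve Λ T) {t : ℝ} (ht : t ∈ Ioo 0 T) : velocity γ t = vel γ t := by
  obtain ⟨x, hx⟩ := QuotientAddGroup.mk_surjective (curveAt γ 0)
  rw [velocity_eq hΛ.out hT.out γ (isLift_add_disp γ hx) (Ioo_subset_Icc_self ht),
    derivWithin_const_add_fun, derivWithin_of_mem_nhds (Icc_mem_nhds ht.1 ht.2), vel]

theorem ae_velocity_eq_vel (γ : Curve Λ T) :
    ∀ᵐ t ∂(volume.restrict (Icc 0 T)), velocity γ t = vel γ t := by
  rw [ae_restrict_congr_set Ioo_ae_eq_Icc.symm]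
  filter_upwards [ae_restrict_mem measurableSet_Ioo] with t ht using velocity_eq_vel γ ht

/-- Two lifts differ by a constant. -/
theorem IsLift.sub_eq_disp {γ : Curve Λ T} {c : ℝ → E d} (hc : IsLift γ c) {t : ℝ}
    (ht : t ∈ Icc 0 T) : c t - c 0 = disp γ t := by
  have h0 : (0 : ℝ) ∈ Icc 0 T := left_mem_Icc.2 hT.out.le
  have hcont : ContinuousOn (fun t => c t - disp γ t) (Icc 0 T) :=
    hc.1.sub (continuous_disp γ).continuousOn
  have := isPreconnected_Icc.constant_of_mapsTo (T := {x : E d | x - c 0 ∈ Λ}) (f := fun t => c t - disp γ t)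
    ?_ hcont ?_ ht h0
  · simp only [disp_zero, sub_zero] at this
    rw [← this]; abel
  · have hd := isDiscrete_of_isSpaceOrTorus hΛ.out
    have himg : {x : E d | x - c 0 ∈ Λ} = (Homeomorph.subRight (c 0)) ⁻¹' (Λ : Set (E d)) := rfl
    rw [himg]
    exact hd.preimage (Homeomorph.continuous _).continuousOn (Homeomorph.injective _)
  · intro s hs
    have h1 := hc.2 s hs
    have h2 := hc.2 0 h0
    rw [pos_eq_curveAt γ hs, curveAt_eq] at h1
    rw [pos_zero] at h2
    have h3 : ((c s - disp γ s - c 0 : E d) : Dom Λ) = 0 := by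
      rw [QuotientAddGroup.mk_sub, QuotientAddGroup.mk_sub, h1, h2]; abel
    exact (QuotientAddGroup.eq_zero_iff _).1 h3

theorem continuousOn_primitive {F : Type*} [NormedAddCommGroup F] [NormedSpace ℝ F] {v : ℝ → F}
    (hv : IntegrableOn v (Icc 0 T)) :
    ContinuousOn (fun t => ∫ s in (0 : ℝ)..t, v s) (Icc 0 T) := by
  have := intervalIntegral.continuousOn_primitive_interval (μ := volume) (f := v) (a := 0) (b := T)
    (by rwa [uIcc_of_le hT.out.le])
  rwa [uIcc_of_le hT.out.le] at this

theorem vel_ae_eq_of_disp_eq {γ : Curve Λ T} {v : ℝ → E d} (hv : IntegrableOn v (Icc 0 T))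
    (h : ∀ t ∈ Icc 0 T, disp γ t = ∫ s in (0 : ℝ)..t, v s) :
    ∀ᵐ t ∂(volume.restrict (Icc 0 T)), HasDerivAt (disp γ) (v t) t ∧ vel γ t = v t := by
  have hi : IntervalIntegrable v volume 0 T := by
    rw [intervalIntegrable_iff_integrableOn_Icc_of_le hT.out.le]; exact hv
  rw [ae_restrict_congr_set Ioo_ae_eq_Icc.symm]
  filter_upwards [ae_restrict_of_ae hi.ae_hasDerivAt_integral, ae_restrict_mem measurableSet_Ioo]
    with t ht htT
  have h0 : (0 : ℝ) ∈ uIcc 0 T := left_mem_uIcc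
  have hd := ht (by rw [uIcc_of_le hT.out.le]; exact Ioo_subset_Icc_self htT) 0 h0
  have hd' : HasDerivAt (disp γ) (v t) t := by
    refine hd.congr_of_eventuallyEq ?_
    filter_upwards [Icc_mem_nhds htT.1 htT.2] with s hs using h s hs
  exact ⟨hd', hd'.deriv⟩

theorem isH1_of_disp_eq {γ : Curve Λ T} {v : ℝ → E d}
    (hv : MemLp v 2 (volume.restrict (Icc 0 T)))
    (h : ∀ t ∈ Icc 0 T, disp γ t = ∫ s in (0 : ℝ)..t, v s) : IsH1 γ :=
  ⟨v, hv, fun t ht => by rw [pos_eq_curveAt γ ht, pos_zero, curveAt_eq, h t ht]⟩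

theorem IsH1.exists_disp_eq {γ : Curve Λ T} (h : IsH1 γ) : ∃ v : ℝ → E d,
    MemLp v 2 (volume.restrict (Icc 0 T)) ∧ ∀ t ∈ Icc 0 T, disp γ t = ∫ s in (0 : ℝ)..t, v s := by
  obtain ⟨v, hv, hvt⟩ := h
  refine ⟨v, hv, fun t ht => ?_⟩
  obtain ⟨x, hx⟩ := QuotientAddGroup.mk_surjective (curveAt γ 0)
  have hl : IsLift γ (fun t => x + ∫ s in (0 : ℝ)..t, v s) :=
    ⟨continuousOn_const.add (continuousOn_primitive (hv.integrable one_le_two)), fun t ht => by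
      rw [hvt t ht, pos_zero, ← hx]; rfl⟩
  simpa using (hl.sub_eq_disp ht).symm

theorem IsH1.memLp_vel {γ : Curve Λ T} (h : IsH1 γ) :
    MemLp (vel γ) 2 (volume.restrict (Icc 0 T)) := by
  obtain ⟨v, hv, hvt⟩ := h.exists_disp_eq
  exact hv.ae_eq ((vel_ae_eq_of_disp_eq (hv.integrable one_le_two) hvt).mono fun t ht => ht.2.symm)

theorem IsH1.integrableOn_vel {γ : Curve Λ T} (h : IsH1 γ) : IntegrableOn (vel γ) (Icc 0 T) :=
  h.memLp_vel.integrable one_le_two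

theorem IsH1.disp_eq {γ : Curve Λ T} (h : IsH1 γ) {t : ℝ} (ht : t ∈ Icc 0 T) :
    disp γ t = ∫ s in (0 : ℝ)..t, vel γ s := by
  obtain ⟨v, hv, hvt⟩ := h.exists_disp_eq
  rw [hvt t ht, intervalIntegral.integral_of_le ht.1, intervalIntegral.integral_of_le ht.1]
  have hsub : Ioc 0 t ⊆ Icc 0 T := fun s hs => ⟨hs.1.le, hs.2.trans ht.2⟩
  exact integral_congr_ae (ae_restrict_of_ae_restrict_of_subset hsub
    ((vel_ae_eq_of_disp_eq (hv.integrable one_le_two) hvt).mono fun t ht => ht.2.symm))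

theorem IsH1.curveAt_eq {γ : Curve Λ T} (h : IsH1 γ) {t : ℝ} (ht : t ∈ Icc 0 T) :
    curveAt γ t = curveAt γ 0 + ((∫ s in (0 : ℝ)..t, vel γ s : E d) : Dom Λ) := by
  rw [VelocityMFG.curveAt_eq, h.disp_eq ht]

/-- Both sides of the integral identity are continuous in time, so rational times, projected to
[0,T], suffice. This makes membership in H¹ a countable family of measurable conditions. The
indicator keeps the domain of integration fixed. -/
theorem isH1_iff {γ : Curve Λ T} : IsH1 γ ↔ (∫⁻ t in Icc 0 T, ‖vel γ t‖ₑ ^ 2 < ⊤) ∧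
    ∀ r : ℚ, disp γ (projIcc 0 T hT.out.le r)
      = ∫ s in Icc 0 T, (Ioc 0 (projIcc 0 T hT.out.le r : ℝ)).indicator (vel γ) s := by
  have hm : AEStronglyMeasurable (vel γ) (volume.restrict (Icc 0 T)) :=
    (measurable_vel_apply γ).aestronglyMeasurable
  have hind : ∀ t ∈ Icc 0 T, ∫ s in Icc 0 T, (Ioc 0 t).indicator (vel γ) s
      = ∫ s in (0 : ℝ)..t, vel γ s := fun t ht => by
    have hsub : Ioc 0 t ⊆ Icc 0 T := fun s hs => ⟨hs.1.le, hs.2.trans ht.2⟩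
    rw [setIntegral_indicator measurableSet_Ioc, inter_eq_right.2 hsub,
      intervalIntegral.integral_of_le ht.1]
  rw [← memLp_two_iff_lintegral hm]
  constructor
  · intro h
    exact ⟨h.memLp_vel, fun r => by rw [hind _ (Subtype.prop _), h.disp_eq (Subtype.prop _)]⟩
  · rintro ⟨h1, h2⟩
    refine isH1_of_disp_eq h1 fun t ht => ?_
    have hp : Continuous fun r : ℝ => ∫ s in (0 : ℝ)..(projIcc 0 T hT.out.le r), vel γ s :=
      (continuousOn_iff_continuous_domRestrict.1
        (continuousOn_primitive (h1.integrable one_le_two))).comp continuous_projIcc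
    have hq : Continuous fun r : ℝ => disp γ (projIcc 0 T hT.out.le r) :=
      (continuous_disp γ).comp (continuous_subtype_val.comp continuous_projIcc)
    have heq := Rat.isDenseEmbedding_coe_real.dense.equalizer hq hp (funext fun r => by
      simp only [Function.comp]
      rw [h2 r, hind _ (Subtype.prop _)])
    have := congrFun heq t
    simpa [projIcc_of_mem hT.out.le ht] using this

theorem measurableSet_isH1 : MeasurableSet {γ : Curve Λ T | IsH1 γ} := by
  simp_rw [isH1_iff, ofPred_and, ofPred_forall]
  refine (measurableSet_lt ?_ measurable_const).inter (MeasurableSet.iInter fun r => ?_)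
  · exact (measurable_vel.enorm.pow_const 2).lintegral_prod_right'
  · have h1 : Measurable fun γ : Curve Λ T => disp γ (projIcc 0 T hT.out.le r) :=
      (continuous_disp_uncurry.comp (Continuous.prodMk_left _)).measurable
    have h2 : StronglyMeasurable fun γ : Curve Λ T => ∫ s in Icc 0 T,
        (Ioc 0 (projIcc 0 T hT.out.le r : ℝ)).indicator (vel γ) s := by
      have : StronglyMeasurable (Function.uncurry fun (γ : Curve Λ T) (s : ℝ) =>
          (Ioc 0 (projIcc 0 T hT.out.le r : ℝ)).indicator (vel γ) s) := by
        have hh := measurable_vel (Λ := Λ) (T := T).indicator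
          (measurable_snd (measurableSet_Ioc (a := (0 : ℝ)) (b := (projIcc 0 T hT.out.le r : ℝ))))
        refine Measurable.stronglyMeasurable ?_
        convert hh using 1
        ext ⟨γ, s⟩
        rfl
      exact this.integral_prod_right
    exact measurableSet_eq_fun h1 h2.measurable

theorem kinetic_of_isH1 {γ : Curve Λ T} (h : IsH1 γ) :
    kinetic γ = 2⁻¹ * ∫⁻ t in Icc 0 T, ‖vel γ t‖ₑ ^ 2 := by
  rw [kinetic, if_pos h]
  congr 1
  exact lintegral_congr_ae ((ae_velocity_eq_vel γ).mono fun t ht => by simp only [ht])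

theorem measurable_kinetic : Measurable (kinetic (Λ := Λ) (T := T)) := by
  classical
  have : kinetic (Λ := Λ) (T := T)
      = fun γ => if IsH1 γ then 2⁻¹ * ∫⁻ t in Icc 0 T, ‖vel γ t‖ₑ ^ 2 else ⊤ := by
    funext γ
    split_ifs with h
    · exact kinetic_of_isH1 h
    · rw [kinetic, if_neg h]
  rw [this]
  exact Measurable.ite measurableSet_isH1
    ((measurable_vel.enorm.pow_const 2).lintegral_prod_right'.const_mul _) measurable_const

theorem IsH1.sub {γ ω : Curve Λ T} (hγ : IsH1 γ) (hω : IsH1 ω) : IsH1 (γ - ω) ∧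
    ∀ᵐ t ∂(volume.restrict (Icc 0 T)), velocity (γ - ω) t = vel γ t - vel ω t := by
  have hv := hγ.memLp_vel.sub hω.memLp_vel
  have key : ∀ t ∈ Icc 0 T, disp (γ - ω) t = ∫ s in (0 : ℝ)..t, (vel γ - vel ω) s := by
    intro t ht
    obtain ⟨x, hx⟩ := QuotientAddGroup.mk_surjective (curveAt γ 0)
    obtain ⟨y, hy⟩ := QuotientAddGroup.mk_surjective (curveAt ω 0)
    have hl : IsLift (γ - ω) (fun t => (x + disp γ t) - (y + disp ω t)) := by
      refine ⟨(isLift_add_disp γ hx).1.sub (isLift_add_disp ω hy).1, fun t ht => ?_⟩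
      rw [QuotientAddGroup.mk_sub, (isLift_add_disp γ hx).2 t ht, (isLift_add_disp ω hy).2 t ht,
        pos, pos, pos, dif_pos ht, dif_pos ht, dif_pos ht]
      rfl
    have h0 : (0 : ℝ) ∈ Icc 0 T := left_mem_Icc.2 hT.out.le
    have h1 := hl.sub_eq_disp ht
    rw [← h1]
    simp only [disp_zero, Pi.sub_apply]
    rw [intervalIntegral.integral_sub (intervalIntegrable_of_memLp_two hγ.memLp_vel h0 ht)
      (intervalIntegrable_of_memLp_two hω.memLp_vel h0 ht), ← hγ.disp_eq ht, ← hω.disp_eq ht]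
    abel
  refine ⟨isH1_of_disp_eq hv key, ?_⟩
  filter_upwards [vel_ae_eq_of_disp_eq (hv.integrable one_le_two) key, ae_velocity_eq_vel (γ - ω)]
    with t h1 h2
  rw [h2, h1.2]; rfl

/-- The curve that starts from `x` with velocity `v`. -/
theorem exists_curve (x : E d) {v : ℝ → E d} (hv : MemLp v 2 (volume.restrict (Icc 0 T))) :
    ∃ γ : Curve Λ T, curveAt γ 0 = x ∧ IsH1 γ ∧ vel γ =ᵐ[volume.restrict (Icc 0 T)] v := by
  have hi : IntegrableOn v (Icc 0 T) := hv.integrable one_le_two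
  let γ : Curve Λ T := ⟨fun t => ((x + ∫ s in (0 : ℝ)..(t : ℝ), v s : E d) : Dom Λ), by
    have := continuousOn_iff_continuous_domRestrict.1 (continuousOn_primitive hi)
    exact continuous_mk.comp (continuous_const.add this)⟩
  have hγ0 : curveAt γ 0 = x := by
    have h0 : (0 : ℝ) ∈ Icc 0 T := left_mem_Icc.2 hT.out.le
    change ((x + ∫ s in (0 : ℝ)..(projIcc 0 T hT.out.le 0 : ℝ), v s : E d) : Dom Λ) = x
    rw [projIcc_of_mem _ h0]
    simp
  have hl : IsLift γ (fun t => x + ∫ s in (0 : ℝ)..t, v s) := by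
    refine ⟨continuousOn_const.add (continuousOn_primitive hi), fun t ht => ?_⟩
    rw [pos, dif_pos ht]
    rfl
  have hd : ∀ t ∈ Icc 0 T, disp γ t = ∫ s in (0 : ℝ)..t, v s := fun t ht => by
    simpa using (hl.sub_eq_disp ht).symm
  exact ⟨γ, hγ0, isH1_of_disp_eq hv hd,
    (vel_ae_eq_of_disp_eq hi hd).mono fun t ht => ht.2⟩

end Curves

end VelocityMFG

end

/-! ### Reduction to a minimization problem for velocities -/

noncomputable section

namespace VelocityMFG

/-- Lebesgue measure on `[0,T]`. -/
abbrev timeMeasure (T : ℝ) : Measure ℝ := volume.restrict (Icc 0 T)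

variable {d : ℕ} {Λ : AddSubgroup (E d)} {T : ℝ}

/-- The curve in `Ω` that starts from the class of `x` with velocity `v`. -/
def path (Λ : AddSubgroup (E d)) (x : E d) (v : ℝ → E d) (t : ℝ) : Dom Λ :=
  ((x + ∫ s in (0 : ℝ)..t, v s : E d) : Dom Λ)

theorem path_congr (x : E d) {v v' : ℝ → E d} (h : v =ᵐ[timeMeasure T] v') {t : ℝ}
    (ht : t ∈ Icc 0 T) : path Λ x v t = path Λ x v' t := by
  unfold path
  rw [intervalIntegral.integral_of_le ht.1, intervalIntegral.integral_of_le ht.1]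
  have hsub : Ioc 0 t ⊆ Icc 0 T := fun s hs => ⟨hs.1.le, hs.2.trans ht.2⟩
  rw [integral_congr_ae (ae_restrict_of_ae_restrict_of_subset hsub h)]

section Path

variable [hT : Fact (0 < T)]

theorem continuousOn_path (x : E d) {v : ℝ → E d} (hv : IntegrableOn v (Icc 0 T)) :
    ContinuousOn (path Λ x v) (Icc 0 T) :=
  continuous_mk.comp_continuousOn (continuousOn_const.add (continuousOn_primitive hv))

theorem aestronglyMeasurable_path (x : E d) {v : ℝ → E d} (hv : IntegrableOn v (Icc 0 T)) :
    AEStronglyMeasurable (path Λ x v) (timeMeasure T) :=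
  (continuousOn_path x hv).aestronglyMeasurable measurableSet_Icc

end Path

variable [hΛ : Fact (IsSpaceOrTorus Λ)] [hT : Fact (0 < T)]

theorem IsH1.path_eq {γ : Curve Λ T} (h : IsH1 γ) {x : E d} (hx : (x : Dom Λ) = curveAt γ 0)
    {t : ℝ} (ht : t ∈ Icc 0 T) : path Λ x (vel γ) t = curveAt γ t := by
  rw [path, h.curveAt_eq ht, ← hx, QuotientAddGroup.mk_add]

/-- The standing assumptions: `η` is positive, bounded, Lipschitz and satisfies a Harnack
inequality, `Ψ` is Lipschitz, and the mean kinetic energy of `Q` is finite. -/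
structure Admissible (Ψ η : Dom Λ → ℝ) (Q : Measure (Curve Λ T)) (B C : ℝ) (K L : ℝ≥0) :
    Prop where
  prob : IsProbabilityMeasure Q
  eta_pos : ∀ x, 0 < η x
  eta_le : ∀ x, η x ≤ B
  eta_lip : LipschitzWith K η
  eta_exp : ∀ (x : Dom Λ) (h : E d), η (x + (h : Dom Λ)) ≤ Real.exp (C * ‖h‖) * η x
  C_nonneg : 0 ≤ C
  psi_lip : LipschitzWith L Ψ
  isH1 : ∀ᵐ ω ∂Q, IsH1 ω
  energy : Integrable (fun p : ℝ × Curve Λ T => ‖vel p.2 p.1‖ ^ 2) ((timeMeasure T).prod Q)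

/-- The density of the interaction cost of a curve `y` with velocity `v`. -/
def dens (η : Dom Λ → ℝ) (Q : Measure (Curve Λ T)) (y : ℝ → Dom Λ) (v : ℝ → E d) (t : ℝ) : ℝ :=
  ∫ ω, ‖v t - vel ω t‖ ^ 2 * η (y t - curveAt ω t) ∂Q

/-- The cost of the curve that starts from `x` with velocity `v`. -/
def action (δ lam : ℝ) (Ψ η : Dom Λ → ℝ) (Q : Measure (Curve Λ T)) (x : E d) (v : ℝ → E d) : ℝ :=
  δ / 2 * (∫ t in Icc 0 T, ‖v t‖ ^ 2)
    + lam / 2 * (∫ t in Icc 0 T, dens η Q (path Λ x v) v t) + Ψ (path Λ x v T)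

/-- `v` minimizes the cost among the velocities of the curves that start from `x`. -/
def IsMin (δ lam : ℝ) (Ψ η : Dom Λ → ℝ) (Q : Measure (Curve Λ T)) (x : E d) (v : ℝ → E d) :
    Prop :=
  MemLp v 2 (timeMeasure T) ∧ ∀ v', MemLp v' 2 (timeMeasure T) →
    action δ lam Ψ η Q x v ≤ action δ lam Ψ η Q x v'

theorem measurable_vel_swap : Measurable fun p : ℝ × Curve Λ T => vel p.2 p.1 :=
  measurable_vel.comp measurable_swap

variable {Ψ η : Dom Λ → ℝ} {Q : Measure (Curve Λ T)} {B C δ lam : ℝ} {K L : ℝ≥0}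
  {x : E d} {v v' : ℝ → E d} {y : ℝ → Dom Λ}

theorem dens_congr {y' : ℝ → Dom Λ} {t : ℝ} (hv : v t = v' t) (hy : y t = y' t) :
    dens η Q y v t = dens η Q y' v' t := by
  simp only [dens, hv, hy]

theorem action_congr (h : v =ᵐ[timeMeasure T] v') :
    action δ lam Ψ η Q x v = action δ lam Ψ η Q x v' := by
  unfold action
  rw [path_congr x h (right_mem_Icc.2 hT.out.le)]
  congr 2
  · congr 1
    exact integral_congr_ae (h.mono fun t ht => by simp only [ht])
  · congr 1
    refine integral_congr_ae ?_
    filter_upwards [h, ae_restrict_mem measurableSet_Icc] with t ht htT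
    exact dens_congr ht (path_congr x h htT)

namespace Admissible

variable (hA : Admissible Ψ η Q B C K L)

include hA

theorem B_nonneg : 0 ≤ B := (hA.eta_pos 0).le.trans (hA.eta_le 0)

theorem aestronglyMeasurable_kernel (hy : AEStronglyMeasurable y (timeMeasure T)) :
    AEStronglyMeasurable (fun p : ℝ × Curve Λ T => η (y p.1 - curveAt p.2 p.1))
      ((timeMeasure T).prod Q) := by
  have := hA.prob
  have h1 : AEStronglyMeasurable (fun p : ℝ × Curve Λ T => curveAt p.2 p.1)
      ((timeMeasure T).prod Q) :=
    (continuous_curveAt.comp continuous_swap).aestronglyMeasurable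
  exact hA.eta_lip.continuous.comp_aestronglyMeasurable (hy.comp_fst.sub h1)

theorem memLp_vel : MemLp (fun p : ℝ × Curve Λ T => vel p.2 p.1) 2 ((timeMeasure T).prod Q) :=
  (memLp_two_iff_integrable_sq_norm measurable_vel_swap.aestronglyMeasurable).2 hA.energy

theorem memLp_sub (hv : MemLp v 2 (timeMeasure T)) :
    MemLp (fun p : ℝ × Curve Λ T => v p.1 - vel p.2 p.1) 2 ((timeMeasure T).prod Q) := by
  have := hA.prob
  exact (hv.comp_fst Q).sub hA.memLp_vel

theorem integrable_dens_prod (hv : MemLp v 2 (timeMeasure T))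
    (hy : AEStronglyMeasurable y (timeMeasure T)) :
    Integrable (fun p : ℝ × Curve Λ T => ‖v p.1 - vel p.2 p.1‖ ^ 2 * η (y p.1 - curveAt p.2 p.1))
      ((timeMeasure T).prod Q) := by
  refine (hA.memLp_sub hv).integrable_norm_pow (by norm_num) |>.mul_bdd (c := B)
    (hA.aestronglyMeasurable_kernel hy) (ae_of_all _ fun p => ?_)
  rw [Real.norm_eq_abs, abs_of_pos (hA.eta_pos _)]
  exact hA.eta_le _

theorem integrable_dens (hv : MemLp v 2 (timeMeasure T))
    (hy : AEStronglyMeasurable y (timeMeasure T)) : IntegrableOn (dens η Q y v) (Icc 0 T) := by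
  have := hA.prob
  exact (hA.integrable_dens_prod hv hy).integral_prod_left

theorem dens_nonneg (t : ℝ) : 0 ≤ dens η Q y v t :=
  integral_nonneg fun ω => mul_nonneg (by positivity) (hA.eta_pos _).le

theorem lintegral_interaction {γ : Curve Λ T} (hγ : IsH1 γ) :
    ∫⁻ ω, interaction η γ ω ∂Q
      = ENNReal.ofReal (2⁻¹ * ∫ t in Icc 0 T, dens η Q (curveAt γ) (vel γ) t) := by
  have := hA.prob
  have hy : AEStronglyMeasurable (curveAt γ) (timeMeasure T) :=
    (continuous_curveAt.comp (Continuous.prodMk_right γ)).aestronglyMeasurable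
  have hint := hA.integrable_dens_prod hγ.memLp_vel hy
  have h1 : ∀ᵐ ω ∂Q, interaction η γ ω = 2⁻¹ * ∫⁻ t in Icc 0 T, ENNReal.ofReal
      (‖vel γ t - vel ω t‖ ^ 2 * η (curveAt γ t - curveAt ω t)) := by
    filter_upwards [hA.isH1] with ω hω
    obtain ⟨h2, h3⟩ := hγ.sub hω
    rw [interaction, if_pos h2]
    congr 1
    refine lintegral_congr_ae ?_
    filter_upwards [h3, ae_restrict_mem measurableSet_Icc] with t ht htT
    rw [ht, pos_eq_curveAt γ htT, pos_eq_curveAt ω htT, ENNReal.ofReal_mul (by positivity),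
      ENNReal.ofReal_pow (norm_nonneg _), ofReal_norm]
  rw [lintegral_congr_ae h1, lintegral_const_mul' _ _ (by simp),
    ← lintegral_prod_symm _ hint.aestronglyMeasurable.aemeasurable.ennreal_ofReal,
    ← ofReal_integral_eq_lintegral_ofReal hint
      (ae_of_all _ fun p => mul_nonneg (by positivity) (hA.eta_pos _).le),
    integral_prod _ hint, ENNReal.ofReal_mul (by norm_num), ENNReal.ofReal_inv_of_pos two_pos,
    ENNReal.ofReal_ofNat]
  rfl

theorem cost_eq (hδ : 0 ≤ δ) (hlam : 0 ≤ lam) {γ : Curve Λ T} (hγ : IsH1 γ)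
    (hx : (x : Dom Λ) = curveAt γ 0) :
    cost δ lam Ψ η Q γ = (action δ lam Ψ η Q x (vel γ) : ℝ) := by
  have h1 : kinetic γ = ENNReal.ofReal (2⁻¹ * ∫ t in Icc 0 T, ‖vel γ t‖ ^ 2) := by
    rw [kinetic_of_isH1 hγ, ENNReal.ofReal_mul (by norm_num), ENNReal.ofReal_inv_of_pos two_pos,
      ENNReal.ofReal_ofNat, ofReal_integral_eq_lintegral_ofReal
        (hγ.memLp_vel.integrable_norm_pow (by norm_num)) (ae_of_all _ fun t => by positivity)]
    congr 1
    refine lintegral_congr fun t => ?_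
    rw [ENNReal.ofReal_pow (norm_nonneg _), ofReal_norm]
  have hk : 0 ≤ ∫ t in Icc 0 T, ‖vel γ t‖ ^ 2 := integral_nonneg fun t => by positivity
  have hd : 0 ≤ ∫ t in Icc 0 T, dens η Q (curveAt γ) (vel γ) t :=
    integral_nonneg fun t => hA.dens_nonneg t
  have hp : ∫ t in Icc 0 T, dens η Q (path Λ x (vel γ)) (vel γ) t
      = ∫ t in Icc 0 T, dens η Q (curveAt γ) (vel γ) t :=
    setIntegral_congr_fun measurableSet_Icc fun t ht => dens_congr rfl (hγ.path_eq hx ht)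
  rw [cost, kineticCost, hA.lintegral_interaction hγ, h1, action, pos_end, hp,
    hγ.path_eq hx (right_mem_Icc.2 hT.out.le), ← ENNReal.ofReal_mul hδ, ← ENNReal.ofReal_mul hlam,
    EReal.coe_ennreal_ofReal, EReal.coe_ennreal_ofReal, max_eq_left (by positivity),
    max_eq_left (by positivity), ← EReal.coe_add, ← EReal.coe_add]
  congr 1
  ring

/-- Every square-integrable velocity is realized by a curve from the same initial point, so
optimality among curves is minimality among velocities. -/
theorem isMin_of_isOptimal (hδ : 0 < δ) (hlam : 0 ≤ lam) {γ : Curve Λ T}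
    (hγ : IsOptimal δ lam Ψ η Q γ) (hx : (x : Dom Λ) = curveAt γ 0) :
    IsH1 γ ∧ IsMin δ lam Ψ η Q x (vel γ) := by
  have key : ∀ v', MemLp v' 2 (timeMeasure T) →
      cost δ lam Ψ η Q γ ≤ (action δ lam Ψ η Q x v' : ℝ) := by
    intro v' hv'
    obtain ⟨ω, hω0, hω, hωv⟩ := exists_curve (Λ := Λ) x hv'
    rw [← action_congr hωv, ← hA.cost_eq hδ.le hlam hω hω0.symm, hγ]
    exact iInf₂_le ω (by rw [pos_zero, pos_zero, hω0, hx])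
  have hH1 : IsH1 γ := by
    by_contra hn
    -- The constant curve has finite cost, so a minimizer cannot have cost `⊤`.
    have h0 := key 0 MemLp.zero'
    have htop : cost δ lam Ψ η Q γ = ⊤ := by
      rw [cost, kineticCost, kinetic, if_neg hn, ENNReal.mul_top (by simpa using hδ),
        EReal.coe_ennreal_top, EReal.top_add_coe]
      exact EReal.top_add_of_ne_bot (EReal.coe_ennreal_ne_bot _)
    rw [htop] at h0
    exact absurd h0 (not_le.2 (EReal.coe_lt_top _))
  refine ⟨hH1, hH1.memLp_vel, fun v' hv' => ?_⟩
  have := key v' hv'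
  rw [hA.cost_eq hδ.le hlam hH1 hx] at this
  exact_mod_cast this

end Admissible

end VelocityMFG

end

/-! ### Finite mean kinetic energy of an equilibrium -/

noncomputable section

namespace VelocityMFG

variable {d : ℕ} {Λ : AddSubgroup (E d)} {T : ℝ} [hΛ : Fact (IsSpaceOrTorus Λ)]
  [hT : Fact (0 < T)] {Ψ η : Dom Λ → ℝ} {Q : Measure (Curve Λ T)} {B C δ lam : ℝ} {K L : ℝ≥0}

theorem lipschitzWith_mk : LipschitzWith 1 (fun x : E d => (x : Dom Λ)) := by
  refine LipschitzWith.of_dist_le_mul fun x y => ?_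
  rw [dist_eq_norm, ← QuotientAddGroup.mk_sub, NNReal.coe_one, one_mul, dist_eq_norm]
  exact norm_mk_le _

theorem eta_add_le_exp (hη : LipschitzWith K η)
    (hC : ∀ y : E d, DifferentiableAt ℝ (fun x : E d => η (x : Dom Λ)) y →
      ‖fderiv ℝ (fun x : E d => η (x : Dom Λ)) y‖ ≤ C * η (y : Dom Λ)) (x : Dom Λ) (h : E d) :
    η (x + (h : Dom Λ)) ≤ Real.exp (C * ‖h‖) * η x := by
  obtain ⟨y, rfl⟩ := QuotientAddGroup.mk_surjective x
  have := le_exp_mul_of_norm_fderiv_le (hη.comp lipschitzWith_mk) hC (y + h) y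
  rw [add_sub_cancel_left] at this
  simpa using this

theorem mul_norm_integral_le {v : ℝ → E d} (hv : MemLp v 2 (timeMeasure T))
    (hδ : 0 < δ) {L : ℝ} (hL : 0 ≤ L) :
    L * ‖∫ t in (0 : ℝ)..T, v t‖ ≤ δ / 4 * (∫ t in Icc 0 T, ‖v t‖ ^ 2) + L ^ 2 * T / δ := by
  have hT0 := hT.out
  have hi : IntegrableOn v (Icc 0 T) := hv.integrable one_le_two
  have hsq : IntegrableOn (fun t => ‖v t‖ ^ 2) (Icc 0 T) := hv.integrable_norm_pow (by norm_num)
  rw [intervalIntegral.integral_of_le hT0.le, ← integral_Icc_eq_integral_Ioc]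
  calc L * ‖∫ t in Icc 0 T, v t‖ ≤ L * ∫ t in Icc 0 T, ‖v t‖ :=
        mul_le_mul_of_nonneg_left (norm_integral_le_integral_norm _) hL
    _ = ∫ t in Icc 0 T, L * ‖v t‖ := (integral_const_mul _ _).symm
    _ ≤ ∫ t in Icc 0 T, (δ / 4 * ‖v t‖ ^ 2 + L ^ 2 / δ) := by
        refine integral_mono (hi.norm.const_mul L)
          ((hsq.const_mul _).add (integrable_const _)) fun t => ?_
        -- Young's inequality, by completing the square.
        have h1 : δ / 4 * ‖v t‖ ^ 2 + L ^ 2 / δ - L * ‖v t‖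
            = (δ * ‖v t‖ - 2 * L) ^ 2 / (4 * δ) := by field_simp; ring
        have h2 : 0 ≤ (δ * ‖v t‖ - 2 * L) ^ 2 / (4 * δ) := by positivity
        simp only
        linarith
    _ = _ := by
        rw [integral_add (hsq.const_mul _) (integrable_const _), integral_const_mul]
        simp [measureReal_def, hT0.le]
        ring

/-- The change of Ψ along the curve is at most L|∫γ'|, which is absorbed by half of the kinetic
term; the other half is left on the left-hand side. The initial value of Ψ enters through its
negative part only, which `m₀` integrates. -/
theorem kinetic_le (hδ : 0 < δ) (hΨ : LipschitzWith L Ψ) (γ : Curve Λ T) :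
    ENNReal.ofReal (δ / 2) * kinetic γ ≤ (cost δ lam Ψ η Q γ).toENNReal
      + ENNReal.ofReal (-Ψ (curveAt γ 0)) + ENNReal.ofReal (L ^ 2 * T / δ) := by
  have hle : kineticCost δ Ψ γ ≤ cost δ lam Ψ η Q γ :=
    le_add_of_nonneg_right (EReal.coe_ennreal_nonneg _)
  by_cases hγ : IsH1 γ
  · obtain ⟨x, hx⟩ := QuotientAddGroup.mk_surjective (curveAt γ 0)
    set k : ℝ := 2⁻¹ * ∫ t in Icc 0 T, ‖vel γ t‖ ^ 2 with hk
    have hk0 : 0 ≤ k := by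
      have : 0 ≤ ∫ t in Icc 0 T, ‖vel γ t‖ ^ 2 := integral_nonneg fun t => by positivity
      positivity
    have h1 : kinetic γ = ENNReal.ofReal k := by
      rw [kinetic_of_isH1 hγ, hk, ENNReal.ofReal_mul (by norm_num),
        ENNReal.ofReal_inv_of_pos two_pos, ENNReal.ofReal_ofNat,
        ofReal_integral_eq_lintegral_ofReal (hγ.memLp_vel.integrable_norm_pow (by norm_num))
          (ae_of_all _ fun t => by positivity)]
      congr 1
      refine lintegral_congr fun t => ?_
      rw [ENNReal.ofReal_pow (norm_nonneg _), ofReal_norm]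
    have h2 : kineticCost δ Ψ γ = ((δ * k + Ψ (curveAt γ T) : ℝ) : EReal) := by
      rw [kineticCost, h1, ← ENNReal.ofReal_mul hδ.le, EReal.coe_ennreal_ofReal,
        max_eq_left (by positivity), pos_end, EReal.coe_add]
    have h3 : ENNReal.ofReal (δ * k + Ψ (curveAt γ T)) ≤ (cost δ lam Ψ η Q γ).toENNReal := by
      rw [h2] at hle
      have := EReal.toENNReal_le_toENNReal hle
      rwa [EReal.toENNReal_of_ne_top (EReal.coe_ne_top _), EReal.toReal_coe] at this
    have h4 : Ψ (curveAt γ 0) - Ψ (curveAt γ T) ≤ L * ‖∫ t in (0 : ℝ)..T, vel γ t‖ := by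
      refine (le_abs_self _).trans ?_
      rw [← Real.dist_eq, dist_comm]
      refine (hΨ.dist_le_mul _ _).trans (mul_le_mul_of_nonneg_left ?_ L.2)
      rw [hγ.curveAt_eq (right_mem_Icc.2 hT.out.le), dist_eq_norm, add_sub_cancel_left]
      exact norm_mk_le _
    have h5 := mul_norm_integral_le hγ.memLp_vel hδ L.2
    have h6 : δ / 2 * k ≤ (δ * k + Ψ (curveAt γ T)) + (-Ψ (curveAt γ 0)) + L ^ 2 * T / δ := by
      have : δ / 4 * (∫ t in Icc 0 T, ‖vel γ t‖ ^ 2) = δ / 2 * k := by rw [hk]; ring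
      rw [this, NNReal.val_eq_coe] at h5
      linarith
    rw [h1, ← ENNReal.ofReal_mul (by positivity)]
    refine (ENNReal.ofReal_le_ofReal h6).trans (ENNReal.ofReal_add_le.trans ?_)
    gcongr
    refine ENNReal.ofReal_add_le.trans ?_
    gcongr
  · have htop : cost δ lam Ψ η Q γ = ⊤ := by
      rw [cost, kineticCost, kinetic, if_neg hγ, ENNReal.mul_top (by simpa using hδ),
        EReal.coe_ennreal_top, EReal.top_add_coe]
      exact EReal.top_add_of_ne_bot (EReal.coe_ennreal_ne_bot _)
    rw [htop]
    simp

theorem lintegral_kinetic_lt_top (hδ : 0 < δ) (hΨ : LipschitzWith L Ψ) {m₀ : Measure (Dom Λ)}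
    (hm₀ : ∫⁻ x, ENNReal.ofReal (-Ψ x) ∂m₀ < ⊤) (hQ : IsEquilibrium δ lam Ψ η m₀ Q) :
    ∫⁻ γ, kinetic γ ∂Q < ⊤ := by
  have := hQ.isProbabilityMeasure
  have hcont : Continuous fun γ : Curve Λ T => curveAt γ 0 :=
    continuous_curveAt.comp (Continuous.prodMk_left 0)
  have hmΨ : Measurable fun x => ENNReal.ofReal (-Ψ x) := hΨ.continuous.neg.measurable.ennreal_ofReal
  have h1 : ∫⁻ γ, ENNReal.ofReal (-Ψ (curveAt γ 0)) ∂Q < ⊤ := by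
    rw [← hQ.initial] at hm₀
    simp_rw [pos_zero] at hm₀
    rwa [lintegral_map hmΨ hcont.measurable] at hm₀
  have h2 := lintegral_mono (μ := Q) (kinetic_le (η := η) (Q := Q) (lam := lam) hδ hΨ)
  have hm : Measurable fun γ : Curve Λ T => ENNReal.ofReal (-Ψ (curveAt γ 0)) :=
    hmΨ.comp hcont.measurable
  rw [lintegral_add_right _ measurable_const, lintegral_add_right _ hm, lintegral_const_mul _ measurable_kinetic,
    lintegral_const, measure_univ, mul_one] at h2
  have h3 : ENNReal.ofReal (δ / 2) * ∫⁻ γ, kinetic γ ∂Q < ⊤ :=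
    h2.trans_lt (ENNReal.add_lt_top.2 ⟨ENNReal.add_lt_top.2 ⟨hQ.cost_lt_top, h1⟩,
      ENNReal.ofReal_lt_top⟩)
  exact ENNReal.lt_top_of_mul_ne_top_right h3.ne (by simpa using hδ)

/-- Finite mean cost forces finite mean energy, so almost every curve is in H¹. Passing to `max C 0`
supplies the sign of the Harnack constant used later. -/
theorem IsEquilibrium.admissible (hδ : 0 < δ) (hη_pos : ∀ x, 0 < η x) (hη_le : ∀ x, η x ≤ B)
    (hη : LipschitzWith K η)
    (hC : ∀ y : E d, DifferentiableAt ℝ (fun x : E d => η (x : Dom Λ)) y →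
      ‖fderiv ℝ (fun x : E d => η (x : Dom Λ)) y‖ ≤ C * η (y : Dom Λ))
    (hΨ : LipschitzWith L Ψ) {m₀ : Measure (Dom Λ)}
    (hm₀ : ∫⁻ x, ENNReal.ofReal (-Ψ x) ∂m₀ < ⊤) (hQ : IsEquilibrium δ lam Ψ η m₀ Q) :
    Admissible Ψ η Q B (max C 0) K L := by
  have := hQ.isProbabilityMeasure
  have hk := lintegral_kinetic_lt_top hδ hΨ hm₀ hQ
  have hH1 : ∀ᵐ ω ∂Q, IsH1 ω := by
    filter_upwards [ae_lt_top measurable_kinetic hk.ne] with ω hω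
    by_contra hn
    rw [kinetic, if_neg hn] at hω
    exact lt_irrefl _ hω
  refine ⟨this, hη_pos, hη_le, hη, eta_add_le_exp hη fun y hy => (hC y hy).trans ?_,
    le_max_right _ _, hΨ, hH1, ?_⟩
  · exact mul_le_mul_of_nonneg_right (le_max_left _ _) (hη_pos _).le
  · refine (memLp_two_iff_integrable_sq_norm measurable_vel_swap.aestronglyMeasurable).1 ?_
    rw [memLp_two_iff_lintegral measurable_vel_swap.aestronglyMeasurable,
      lintegral_prod_symm _ (measurable_vel_swap.enorm.pow_const 2).aemeasurable]
    have h2 : ∀ᵐ ω ∂Q, ∫⁻ t in Icc 0 T, ‖vel ω t‖ₑ ^ 2 = 2 * kinetic ω := by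
      filter_upwards [hH1] with ω hω
      rw [kinetic_of_isH1 hω, ← mul_assoc, ENNReal.mul_inv_cancel two_ne_zero (by simp), one_mul]
    rw [lintegral_congr_ae h2, lintegral_const_mul _ measurable_kinetic]
    exact ENNReal.mul_lt_top (by simp) hk

end VelocityMFG

end

/-! ### First variation of the cost -/

noncomputable section

namespace VelocityMFG

/-- The expansion of a perturbed quadratic term with a perturbed weight. -/
theorem norm_add_smul_sq_mul_le {F : Type*} [NormedAddCommGroup F] [InnerProductSpace ℝ F]
    (u k : F) {ε σ σ₀ M n n' : ℝ} (hε : 0 ≤ ε) (hε1 : ε ≤ 1) (hσ : 0 ≤ σ) (hσ₀ : σ ≤ σ₀)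
    (hεσ : ε * σ₀ ≤ 1) (hk : ‖k‖ ≤ M) (hn : 0 ≤ n) (hn' : n' ≤ Real.exp (ε * σ) * n) :
    ‖u + ε • k‖ ^ 2 * n' ≤ ‖u‖ ^ 2 * n + ε * (2 * inner ℝ (n • u) k + σ * (‖u‖ ^ 2 * n))
      + ε ^ 2 * ((M ^ 2 + 2 * M ^ 2 * (σ₀ + σ₀ ^ 2)) * n
        + (σ₀ + 2 * σ₀ ^ 2) * (‖u‖ ^ 2 * n)) := by
  set s := ε * σ with hs
  have hs0 : 0 ≤ s := mul_nonneg hε hσ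
  have hs1 : s ≤ 1 := (mul_le_mul_of_nonneg_left hσ₀ hε).trans hεσ
  have hsε : s ≤ ε * σ₀ := mul_le_mul_of_nonneg_left hσ₀ hε
  have hexp : Real.exp s ≤ 1 + s + s ^ 2 := by
    have := Real.abs_exp_sub_one_sub_id_le (x := s) (by rwa [abs_of_nonneg hs0])
    linarith [(abs_le.1 this).2]
  have hn2 : n' ≤ (1 + s + s ^ 2) * n := hn'.trans (mul_le_mul_of_nonneg_right hexp hn)
  have hM : 0 ≤ M := (norm_nonneg k).trans hk
  have hσ₀0 : 0 ≤ σ₀ := hσ.trans hσ₀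
  have hsq : ‖u + ε • k‖ ^ 2 = ‖u‖ ^ 2 + 2 * ε * inner ℝ u k + ε ^ 2 * ‖k‖ ^ 2 := by
    rw [norm_add_sq_real, inner_smul_right, norm_smul, mul_pow, Real.norm_eq_abs, sq_abs]
    ring
  rw [inner_smul_left]
  simp only [conj_trivial]
  have hin : inner ℝ u k ≤ ‖u‖ * M :=
    (real_inner_le_norm u k).trans (mul_le_mul_of_nonneg_left hk (norm_nonneg _))
  set i : ℝ := inner ℝ u k
  set a := ‖u‖
  have ha : 0 ≤ a := norm_nonneg u
  have hkk : ‖k‖ ^ 2 ≤ M ^ 2 := by gcongr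
  -- The increments of the square and of the weight are each of order ε, so their product belongs to
  -- the remainder. It is bounded through |u|² and M² alone, which are integrable against the
  -- weight.
  have h2 : 2 * ε * i + ε ^ 2 * ‖k‖ ^ 2 ≤ ε * (a ^ 2 + 2 * M ^ 2) := by
    have h3 : 2 * i ≤ a ^ 2 + M ^ 2 := by nlinarith [sq_nonneg (a - M)]
    have h4 : ε ^ 2 * ‖k‖ ^ 2 ≤ ε * M ^ 2 := by
      have : ε ^ 2 ≤ ε := by nlinarith
      exact mul_le_mul this hkk (by positivity) hε
    nlinarith
  have h5 : (2 * ε * i + ε ^ 2 * ‖k‖ ^ 2) * (s + s ^ 2)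
      ≤ ε * (a ^ 2 + 2 * M ^ 2) * (ε * (σ₀ + σ₀ ^ 2)) := by
    have h6 : s + s ^ 2 ≤ ε * (σ₀ + σ₀ ^ 2) := by
      have : s ^ 2 ≤ (ε * σ₀) ^ 2 := by gcongr
      have h7 : (ε * σ₀) ^ 2 ≤ ε * σ₀ ^ 2 := by
        have : ε ^ 2 ≤ ε := by nlinarith
        rw [mul_pow]; gcongr
      linarith
    calc _ ≤ ε * (a ^ 2 + 2 * M ^ 2) * (s + s ^ 2) :=
          mul_le_mul_of_nonneg_right h2 (by positivity)
      _ ≤ _ := mul_le_mul_of_nonneg_left h6 (by positivity)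
  have h8 : s ^ 2 * a ^ 2 ≤ ε ^ 2 * σ₀ ^ 2 * a ^ 2 := by
    rw [← mul_pow ε]
    exact mul_le_mul_of_nonneg_right (pow_le_pow_left₀ hs0 hsε 2) (sq_nonneg a)
  have h9 : ε ^ 2 * ‖k‖ ^ 2 ≤ ε ^ 2 * M ^ 2 := by gcongr
  rw [hsq]
  have h10 : 0 ≤ a ^ 2 + 2 * ε * i + ε ^ 2 * ‖k‖ ^ 2 := by rw [← hsq]; positivity
  calc (a ^ 2 + 2 * ε * i + ε ^ 2 * ‖k‖ ^ 2) * n'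
      ≤ (a ^ 2 + 2 * ε * i + ε ^ 2 * ‖k‖ ^ 2) * ((1 + s + s ^ 2) * n) :=
        mul_le_mul_of_nonneg_left hn2 h10
    _ = (a ^ 2 + 2 * ε * i + s * a ^ 2 + ε ^ 2 * ‖k‖ ^ 2
        + (2 * ε * i + ε ^ 2 * ‖k‖ ^ 2) * (s + s ^ 2) + s ^ 2 * a ^ 2) * n := by ring
    _ ≤ (a ^ 2 + 2 * ε * i + s * a ^ 2 + ε ^ 2 * M ^ 2
        + ε * (a ^ 2 + 2 * M ^ 2) * (ε * (σ₀ + σ₀ ^ 2)) + ε ^ 2 * σ₀ ^ 2 * a ^ 2) * n := by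
        gcongr
    _ = _ := by rw [hs]; ring

/-- The expansion in ε keeps its shape under integration; it is integrated over Q in
`dens_perturb_le` and over time in `first_variation`. -/
theorem integral_expansion {α : Type*} [MeasurableSpace α] {μ : Measure α} [IsFiniteMeasure μ]
    {f p q : α → ℝ} (hf : Integrable f μ) (hp : Integrable p μ) (hq : Integrable q μ)
    (ε c r : ℝ) :
    Integrable (fun a => f a + ε * (2 * p a + q a) + ε ^ 2 * (c + r * f a)) μ ∧
      ∫ a, f a + ε * (2 * p a + q a) + ε ^ 2 * (c + r * f a) ∂μ
        = ∫ a, f a ∂μ + ε * (2 * ∫ a, p a ∂μ + ∫ a, q a ∂μ)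
          + ε ^ 2 * (c * μ.real univ + r * ∫ a, f a ∂μ) := by
  have h1 : Integrable (fun a => 2 * p a) μ := hp.const_mul 2
  have h2 : Integrable (fun a => ε * (2 * p a + q a)) μ := (h1.add hq).const_mul ε
  have h3 : Integrable (fun a => r * f a) μ := hf.const_mul r
  have h4 : Integrable (fun a => ε ^ 2 * (c + r * f a)) μ :=
    ((integrable_const c).add h3).const_mul _
  have h5 : Integrable (fun a => f a + ε * (2 * p a + q a)) μ := hf.add h2
  refine ⟨h5.add h4, ?_⟩
  rw [integral_add h5 h4, integral_add hf h2, integral_const_mul ε, integral_add h1 hq,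
    integral_const_mul 2, integral_const_mul (ε ^ 2), integral_add (integrable_const c) h3,
    integral_const_mul r, integral_const, smul_eq_mul, mul_comm c]

variable {d : ℕ} {Λ : AddSubgroup (E d)} {T : ℝ} [hΛ : Fact (IsSpaceOrTorus Λ)]
  [hT : Fact (0 < T)] {Ψ η : Dom Λ → ℝ} {Q : Measure (Curve Λ T)} {B C δ lam : ℝ} {K L : ℝ≥0}
  {x : E d} {v k : ℝ → E d} {y y' : ℝ → Dom Λ}

/-- The averaged relative velocity `a (v - u)` along a curve. -/
def relMom (η : Dom Λ → ℝ) (Q : Measure (Curve Λ T)) (y : ℝ → Dom Λ) (v : ℝ → E d) (t : ℝ) :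
    E d :=
  ∫ ω, η (y t - curveAt ω t) • (v t - vel ω t) ∂Q

/-- The momentum `z` along a curve. -/
def mom (δ lam : ℝ) (η : Dom Λ → ℝ) (Q : Measure (Curve Λ T)) (y : ℝ → Dom Λ) (v : ℝ → E d)
    (t : ℝ) : E d :=
  δ • v t + lam • relMom η Q y v t

namespace Admissible

variable (hA : Admissible Ψ η Q B C K L)

include hA

theorem integrable_relMom_prod (hv : MemLp v 2 (timeMeasure T))
    (hy : AEStronglyMeasurable y (timeMeasure T)) :
    Integrable (fun p : ℝ × Curve Λ T => η (y p.1 - curveAt p.2 p.1) • (v p.1 - vel p.2 p.1))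
      ((timeMeasure T).prod Q) := by
  have := hA.prob
  refine ((hA.memLp_sub hv).integrable one_le_two).bdd_smul B
    (hA.aestronglyMeasurable_kernel hy) (ae_of_all _ fun p => ?_)
  rw [Real.norm_eq_abs, abs_of_pos (hA.eta_pos _)]
  exact hA.eta_le _

theorem integrable_relMom (hv : MemLp v 2 (timeMeasure T))
    (hy : AEStronglyMeasurable y (timeMeasure T)) : IntegrableOn (relMom η Q y v) (Icc 0 T) := by
  have := hA.prob
  exact (hA.integrable_relMom_prod hv hy).integral_prod_left

theorem integrable_mom (hv : MemLp v 2 (timeMeasure T))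
    (hy : AEStronglyMeasurable y (timeMeasure T)) :
    IntegrableOn (mom δ lam η Q y v) (Icc 0 T) :=
  ((hv.integrable one_le_two).smul δ).add ((hA.integrable_relMom hv hy).smul lam)

/-- The Harnack inequality bounds the displaced weight by exp(εC|h|) times the old one. Its
first-order effect is thus at most C|h| times the density itself, which is why the density reappears
on the right-hand side. -/
theorem dens_perturb_le (hv : MemLp v 2 (timeMeasure T))
    (hy : AEStronglyMeasurable y (timeMeasure T)) {h : ℝ → E d} {ε M σ₀ : ℝ} (hε : 0 ≤ ε)
    (hε1 : ε ≤ 1) (hεσ : ε * σ₀ ≤ 1) (hk : ∀ t, ‖k t‖ ≤ M)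
    (hvk : MemLp (v + ε • k) 2 (timeMeasure T)) (hy' : AEStronglyMeasurable y' (timeMeasure T))
    (hh : ∀ t ∈ Icc 0 T, C * ‖h t‖ ≤ σ₀)
    (hyy' : ∀ t ∈ Icc 0 T, y' t = y t + ((ε • h t : E d) : Dom Λ)) :
    ∀ᵐ t ∂(timeMeasure T), dens η Q y' (v + ε • k) t ≤ dens η Q y v t
      + ε * (2 * inner ℝ (relMom η Q y v t) (k t) + C * ‖h t‖ * dens η Q y v t)
      + ε ^ 2 * ((M ^ 2 + 2 * M ^ 2 * (σ₀ + σ₀ ^ 2)) * B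
        + (σ₀ + 2 * σ₀ ^ 2) * dens η Q y v t) := by
  have := hA.prob
  filter_upwards [(hA.integrable_dens_prod hv hy).prod_right_ae,
    (hA.integrable_dens_prod hvk hy').prod_right_ae,
    (hA.integrable_relMom_prod hv hy).prod_right_ae, ae_restrict_mem measurableSet_Icc]
    with t h1 h2 h3 ht
  have hσ₀0 : 0 ≤ σ₀ := (mul_nonneg hA.C_nonneg (norm_nonneg _)).trans (hh t ht)
  obtain ⟨h4, h6⟩ := integral_expansion h1 (h3.const_inner (k t)) (h1.const_mul (C * ‖h t‖)) ε
    ((M ^ 2 + 2 * M ^ 2 * (σ₀ + σ₀ ^ 2)) * B) (σ₀ + 2 * σ₀ ^ 2)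
  have h5 := integral_mono h2 h4 fun ω => by
    have hω := norm_add_smul_sq_mul_le (v t - vel ω t) (k t) (n := η (y t - curveAt ω t))
      (n' := η (y' t - curveAt ω t)) hε hε1 (mul_nonneg hA.C_nonneg (norm_nonneg (h t))) (hh t ht)
      hεσ (hk t) (hA.eta_pos _).le ?_
    · have hB : (M ^ 2 + 2 * M ^ 2 * (σ₀ + σ₀ ^ 2)) * η (y t - curveAt ω t)
          ≤ (M ^ 2 + 2 * M ^ 2 * (σ₀ + σ₀ ^ 2)) * B :=
        mul_le_mul_of_nonneg_left (hA.eta_le _) (by positivity)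
      have hB2 := mul_le_mul_of_nonneg_left hB (sq_nonneg ε)
      simp only [Pi.add_apply, Pi.smul_apply]
      rw [real_inner_comm, add_sub_right_comm]
      linarith
    · rw [hyy' t ht, add_sub_right_comm]
      refine (hA.eta_exp _ _).trans (le_of_eq ?_)
      rw [norm_smul, Real.norm_eq_abs, abs_of_nonneg hε]
      congr 2
      ring
  refine h5.trans (le_of_eq ?_)
  rw [h6, integral_inner h3, integral_const_mul, real_inner_comm]
  simp [dens, relMom]

end Admissible

omit hT in
theorem memLp_of_bounded (hk : Measurable k) {M : ℝ} (hkM : ∀ t, ‖k t‖ ≤ M) :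
    MemLp k 2 (timeMeasure T) :=
  MemLp.of_bound hk.aestronglyMeasurable M (ae_of_all _ hkM)

omit hΛ in
theorem path_add_smul (hv : MemLp v 2 (timeMeasure T)) (hk : MemLp k 2 (timeMeasure T)) (ε : ℝ)
    {t : ℝ} (ht : t ∈ Icc 0 T) : path Λ x (v + ε • k) t
      = path Λ x v t + ((ε • ∫ s in (0 : ℝ)..t, k s : E d) : Dom Λ) := by
  have h0 : (0 : ℝ) ∈ Icc 0 T := left_mem_Icc.2 hT.out.le
  have hv1 := intervalIntegrable_of_memLp_two hv h0 ht
  have hk1 : IntervalIntegrable (fun s => ε • k s) volume 0 t :=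
    (intervalIntegrable_of_memLp_two hk h0 ht).smul ε
  unfold path
  simp only [Pi.add_apply, Pi.smul_apply]
  rw [intervalIntegral.integral_add hv1 hk1, intervalIntegral.integral_smul,
    ← QuotientAddGroup.mk_add, add_assoc]

omit hT in
theorem norm_primitive_le {M : ℝ} (hkM : ∀ t, ‖k t‖ ≤ M) {t : ℝ} (ht : t ∈ Icc 0 T) :
    ‖∫ s in (0 : ℝ)..t, k s‖ ≤ M * T := by
  have h := intervalIntegral.norm_integral_le_of_norm_le_const (a := 0) (b := t) (f := k)
    fun s _ => hkM s
  rw [sub_zero, abs_of_nonneg ht.1] at h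
  exact h.trans (mul_le_mul_of_nonneg_left ht.2 ((norm_nonneg _).trans (hkM 0)))

theorem Admissible.integrable_norm_primitive_mul_dens (hA : Admissible Ψ η Q B C K L)
    (hv : MemLp v 2 (timeMeasure T)) (hy : AEStronglyMeasurable y (timeMeasure T))
    (hk : Measurable k) {M : ℝ} (hkM : ∀ t, ‖k t‖ ≤ M) :
    IntegrableOn (fun t => ‖∫ s in (0 : ℝ)..t, k s‖ * dens η Q y v t) (Icc 0 T) := by
  have hki : IntegrableOn k (Icc 0 T) := (memLp_of_bounded hk hkM).integrable one_le_two
  refine (hA.integrable_dens hv hy).bdd_mul (c := M * T)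
    ((continuousOn_primitive hki).norm.aestronglyMeasurable measurableSet_Icc) ?_
  filter_upwards [ae_restrict_mem measurableSet_Icc] with t ht
  rw [norm_norm]
  exact norm_primitive_le hkM ht

/-- The first variation of the cost at a minimizer. -/
theorem Admissible.first_variation (hA : Admissible Ψ η Q B C K L) (hlam : 0 ≤ lam)
    (hv : IsMin δ lam Ψ η Q x v) (hk : Measurable k) {M : ℝ} (hkM : ∀ t, ‖k t‖ ≤ M) :
    ∃ R : ℝ, ∀ ε : ℝ, 0 ≤ ε → ε ≤ 1 → ε * (C * (M * T)) ≤ 1 →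
      0 ≤ ε * ((∫ t in Icc 0 T, inner ℝ (mom δ lam η Q (path Λ x v) v t) (k t))
          + ∫ t in Icc 0 T, ‖∫ s in (0 : ℝ)..t, k s‖ * (lam * C / 2 * dens η Q (path Λ x v) v t))
        + ε ^ 2 * R
        + (Ψ (path Λ x v T + ((ε • ∫ s in (0 : ℝ)..T, k s : E d) : Dom Λ)) - Ψ (path Λ x v T)) := by
  have hT0 := hT.out
  have hTm : T ∈ Icc 0 T := right_mem_Icc.2 hT0.le
  have hv2 := hv.1
  have hk2 : MemLp k 2 (timeMeasure T) := memLp_of_bounded hk hkM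
  have hy : AEStronglyMeasurable (path Λ x v) (timeMeasure T) :=
    aestronglyMeasurable_path x (hv2.integrable one_le_two)
  set y := path Λ x v with hydef
  set W := dens η Q y v with hW
  set h : ℝ → E d := fun t => ∫ s in (0 : ℝ)..t, k s with hh
  set σ₀ := C * (M * T)
  have hWi : IntegrableOn W (Icc 0 T) := hA.integrable_dens hv2 hy
  have hhW : IntegrableOn (fun t => ‖h t‖ * W t) (Icc 0 T) :=
    hA.integrable_norm_primitive_mul_dens hv2 hy hk hkM
  have hbk : ∀ {f : ℝ → E d}, IntegrableOn f (Icc 0 T) →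
      IntegrableOn (fun t => (inner ℝ (f t) (k t) : ℝ)) (Icc 0 T) := fun {f} hf => by
    refine (hf.norm.mul_const M).mono' (hf.aestronglyMeasurable.inner hk.aestronglyMeasurable)
      (ae_of_all _ fun t => (norm_inner_le_norm _ _).trans ?_)
    exact mul_le_mul_of_nonneg_left (hkM t) (norm_nonneg _)
  have hrel := hbk (hA.integrable_relMom hv2 hy)
  have hvk := hbk (hv2.integrable one_le_two)
  have hmom : ∫ t in Icc 0 T, (inner ℝ (mom δ lam η Q y v t) (k t) : ℝ)
      = δ * (∫ t in Icc 0 T, inner ℝ (v t) (k t))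
        + lam * ∫ t in Icc 0 T, inner ℝ (relMom η Q y v t) (k t) := by
    rw [← integral_const_mul, ← integral_const_mul, ← integral_add (hvk.const_mul _)
      (hrel.const_mul _)]
    refine integral_congr_ae (ae_of_all _ fun t => ?_)
    simp [mom, inner_add_left, inner_smul_left]
  have hGW : ∫ t in Icc 0 T, ‖h t‖ * (lam * C / 2 * W t)
      = lam * C / 2 * ∫ t in Icc 0 T, ‖h t‖ * W t := by
    rw [← integral_const_mul]
    exact integral_congr_ae (ae_of_all _ fun t => by simp only; ring)
  -- All second-order terms of the kinetic and interaction costs, bounded independently of ε; Ψ is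
  -- left unexpanded so that both terminal conditions can be derived.
  refine ⟨δ / 2 * (∫ t in Icc 0 T, ‖k t‖ ^ 2)
    + lam / 2 * (((M ^ 2 + 2 * M ^ 2 * (σ₀ + σ₀ ^ 2)) * B) * T
      + (σ₀ + 2 * σ₀ ^ 2) * ∫ t in Icc 0 T, W t), fun ε hε hε1 hεσ => ?_⟩
  have hvε : MemLp (v + ε • k) 2 (timeMeasure T) := hv2.add (hk2.const_smul ε)
  have hmin := hv.2 _ hvε
  have hy' : AEStronglyMeasurable (path Λ x (v + ε • k)) (timeMeasure T) :=
    aestronglyMeasurable_path x (hvε.integrable one_le_two)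
  have hD := hA.dens_perturb_le hv2 hy (h := h) (σ₀ := σ₀) hε hε1 hεσ hkM hvε hy'
    (fun t ht => mul_le_mul_of_nonneg_left (norm_primitive_le hkM ht) hA.C_nonneg)
    (fun t ht => path_add_smul hv2 hk2 ε ht)
  have hI1 : ∫ t in Icc 0 T, ‖(v + ε • k) t‖ ^ 2 = (∫ t in Icc 0 T, ‖v t‖ ^ 2)
      + 2 * ε * (∫ t in Icc 0 T, inner ℝ (v t) (k t)) + ε ^ 2 * ∫ t in Icc 0 T, ‖k t‖ ^ 2 := by
    have i1 : IntegrableOn (fun t => ‖v t‖ ^ 2) (Icc 0 T) :=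
      hv2.integrable_norm_pow (by norm_num)
    have i2 : IntegrableOn (fun t => 2 * ε * inner ℝ (v t) (k t)) (Icc 0 T) := hvk.const_mul _
    have i3 : IntegrableOn (fun t => ε ^ 2 * ‖k t‖ ^ 2) (Icc 0 T) :=
      (hk2.integrable_norm_pow (by norm_num)).const_mul _
    have i4 : IntegrableOn (fun t => ‖v t‖ ^ 2 + 2 * ε * inner ℝ (v t) (k t)) (Icc 0 T) :=
      i1.add i2
    rw [← integral_const_mul, ← integral_const_mul, ← integral_add i1 i2, ← integral_add i4 i3]
    refine integral_congr_ae (ae_of_all _ fun t => ?_)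
    simp only [Pi.add_apply, Pi.smul_apply]
    rw [norm_add_sq_real, inner_smul_right, norm_smul, mul_pow, Real.norm_eq_abs, sq_abs]
    ring
  have hI2 : ∫ t in Icc 0 T, dens η Q (path Λ x (v + ε • k)) (v + ε • k) t
      ≤ (∫ t in Icc 0 T, W t) + ε * (2 * (∫ t in Icc 0 T, inner ℝ (relMom η Q y v t) (k t))
          + C * ∫ t in Icc 0 T, ‖h t‖ * W t)
        + ε ^ 2 * (((M ^ 2 + 2 * M ^ 2 * (σ₀ + σ₀ ^ 2)) * B) * T
          + (σ₀ + 2 * σ₀ ^ 2) * ∫ t in Icc 0 T, W t) := by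
    have hi1 : IntegrableOn (fun t => C * ‖h t‖ * W t) (Icc 0 T) := by
      simp_rw [mul_assoc]; exact hhW.const_mul C
    obtain ⟨hi2, hi3⟩ := integral_expansion hWi hrel hi1 ε
      ((M ^ 2 + 2 * M ^ 2 * (σ₀ + σ₀ ^ 2)) * B) (σ₀ + 2 * σ₀ ^ 2)
    have e1 : ∫ t in Icc 0 T, C * ‖h t‖ * W t = C * ∫ t in Icc 0 T, ‖h t‖ * W t := by
      simp_rw [mul_assoc]; exact integral_const_mul _ _
    have e2 : (timeMeasure T).real univ = T := by simp [measureReal_def, hT0.le]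
    rw [e1, e2] at hi3
    exact (integral_mono_ae (hA.integrable_dens hvε hy') hi2 hD).trans_eq hi3
  have hΨT : path Λ x (v + ε • k) T = y T + ((ε • h T : E d) : Dom Λ) :=
    path_add_smul hv2 hk2 ε hTm
  unfold action at hmin
  rw [hI1, hΨT] at hmin
  rw [hmom, hGW]
  have hI3 := mul_le_mul_of_nonneg_left hI2 (show 0 ≤ lam / 2 by positivity)
  have hyT : path Λ x v T = y T := rfl
  simp only [← hydef, ← hW] at hmin
  linarith

/-- The momentum of a minimizer has, in a weak sense, a derivative controlled by the interaction
density and a final value controlled by the Lipschitz constant of `Ψ`. -/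
theorem Admissible.weak_bound (hA : Admissible Ψ η Q B C K L) (hlam : 0 ≤ lam)
    (hv : IsMin δ lam Ψ η Q x v) (hk : Measurable k) (hkM : ∃ M, ∀ t, ‖k t‖ ≤ M) :
    0 ≤ (∫ t in Icc 0 T, inner ℝ (mom δ lam η Q (path Λ x v) v t) (k t))
      + (∫ t in Icc 0 T, ‖∫ s in (0 : ℝ)..t, k s‖ * (lam * C / 2 * dens η Q (path Λ x v) v t))
      + L * ‖∫ s in (0 : ℝ)..T, k s‖ := by
  obtain ⟨M, hM⟩ := hkM
  obtain ⟨R, hR⟩ := hA.first_variation hlam hv hk hM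
  set A := (∫ t in Icc 0 T, inner ℝ (mom δ lam η Q (path Λ x v) v t) (k t))
      + ∫ t in Icc 0 T, ‖∫ s in (0 : ℝ)..t, k s‖ * (lam * C / 2 * dens η Q (path Λ x v) v t)
  set h := ∫ s in (0 : ℝ)..T, k s
  -- After division by ε > 0 only the first-order terms survive; Ψ contributes at most L|h|.
  have hlim : Tendsto (fun ε : ℝ => A + L * ‖h‖ + ε * R) (𝓝[>] 0) (𝓝 (A + L * ‖h‖ + 0 * R)) := by
    have : Continuous fun ε : ℝ => A + L * ‖h‖ + ε * R := by fun_prop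
    exact (this.tendsto 0).mono_left nhdsWithin_le_nhds
  rw [zero_mul, add_zero] at hlim
  refine ge_of_tendsto hlim ?_
  have hsmall : ∀ᶠ ε : ℝ in 𝓝[>] 0, ε * (C * (M * T)) < 1 := by
    have : Continuous fun ε : ℝ => ε * (C * (M * T)) := by fun_prop
    exact nhdsWithin_le_nhds (this.tendsto 0 (Iio_mem_nhds (by simp)))
  filter_upwards [hsmall, Ioo_mem_nhdsGT (zero_lt_one (α := ℝ))] with ε h1 h2
  have h3 := hR ε h2.1.le h2.2.le h1.le
  have h4 : Ψ (path Λ x v T + ((ε • h : E d) : Dom Λ)) - Ψ (path Λ x v T) ≤ ε * (L * ‖h‖) := by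
    refine (le_abs_self _).trans ?_
    rw [← Real.dist_eq]
    refine (hA.psi_lip.dist_le_mul _ _).trans ?_
    rw [dist_eq_norm, add_sub_cancel_left, mul_left_comm]
    refine mul_le_mul_of_nonneg_left ?_ L.2
    refine (norm_mk_le _).trans (le_of_eq ?_)
    rw [norm_smul, Real.norm_eq_abs, abs_of_pos h2.1]
  have h5 : 0 ≤ ε * (A + L * ‖h‖ + ε * R) := by linarith
  exact nonneg_of_mul_nonneg_right h5 h2.1

/-- The transversality condition at the final time, in a weak form. -/
theorem Admissible.weak_bound_of_differentiableAt (hA : Admissible Ψ η Q B C K L) (hlam : 0 ≤ lam)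
    (hv : IsMin δ lam Ψ η Q x v) (hk : Measurable k) (hkM : ∃ M, ∀ t, ‖k t‖ ≤ M) {x₁ : E d}
    (hx₁ : (x₁ : Dom Λ) = path Λ x v T)
    (hΨ : DifferentiableAt ℝ (fun x : E d => Ψ (x : Dom Λ)) x₁) :
    0 ≤ (∫ t in Icc 0 T, inner ℝ (mom δ lam η Q (path Λ x v) v t) (k t))
      + (∫ t in Icc 0 T, ‖∫ s in (0 : ℝ)..t, k s‖ * (lam * C / 2 * dens η Q (path Λ x v) v t))
      + fderiv ℝ (fun x : E d => Ψ (x : Dom Λ)) x₁ (∫ s in (0 : ℝ)..T, k s) := by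
  obtain ⟨M, hM⟩ := hkM
  obtain ⟨R, hR⟩ := hA.first_variation hlam hv hk hM
  set A := (∫ t in Icc 0 T, inner ℝ (mom δ lam η Q (path Λ x v) v t) (k t))
      + ∫ t in Icc 0 T, ‖∫ s in (0 : ℝ)..t, k s‖ * (lam * C / 2 * dens η Q (path Λ x v) v t)
  set h := ∫ s in (0 : ℝ)..T, k s
  set Φ : E d → ℝ := fun x => Ψ (x : Dom Λ) with hΦ
  -- The terminal term needs only the derivative of the lifted Ψ along the line in direction h.
  have hline : HasDerivAt (fun ε : ℝ => Φ (x₁ + ε • h)) (fderiv ℝ Φ x₁ h) 0 := by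
    have h1 : HasDerivAt (fun ε : ℝ => x₁ + ε • h) h 0 := by
      simpa using ((hasDerivAt_id (0 : ℝ)).smul_const h).const_add x₁
    have h2 : HasFDerivAt Φ (fderiv ℝ Φ x₁) (x₁ + (0 : ℝ) • h) := by
      simpa using hΨ.hasFDerivAt
    exact h2.comp_hasDerivAt 0 h1
  have hslope := (hasDerivAt_iff_tendsto_slope_zero.1 hline).mono_left (nhdsGT_le_nhdsNE (0 : ℝ))
  have hlim : Tendsto (fun ε : ℝ => A + ε * R
      + ε⁻¹ • (Φ (x₁ + (0 + ε) • h) - Φ (x₁ + (0 : ℝ) • h))) (𝓝[>] 0)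
      (𝓝 (A + 0 * R + fderiv ℝ Φ x₁ h)) := by
    have : Continuous fun ε : ℝ => A + ε * R := by fun_prop
    exact ((this.tendsto 0).mono_left nhdsWithin_le_nhds).add hslope
  rw [zero_mul, add_zero] at hlim
  refine ge_of_tendsto hlim ?_
  have hsmall : ∀ᶠ ε : ℝ in 𝓝[>] 0, ε * (C * (M * T)) < 1 := by
    have : Continuous fun ε : ℝ => ε * (C * (M * T)) := by fun_prop
    exact nhdsWithin_le_nhds (this.tendsto 0 (Iio_mem_nhds (by simp)))
  filter_upwards [hsmall, Ioo_mem_nhdsGT (zero_lt_one (α := ℝ))] with ε h1 h2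
  have h3 := hR ε h2.1.le h2.2.le h1.le
  rw [← hx₁, ← QuotientAddGroup.mk_add] at h3
  change 0 ≤ _ + (Φ (x₁ + ε • h) - Φ x₁) at h3
  simp only [zero_add, zero_smul, add_zero, smul_eq_mul]
  have h5 : 0 ≤ ε * (A + ε * R + ε⁻¹ * (Φ (x₁ + ε • h) - Φ x₁)) := by
    have : ε * (ε⁻¹ * (Φ (x₁ + ε • h) - Φ x₁)) = Φ (x₁ + ε • h) - Φ x₁ := by
      rw [← mul_assoc, mul_inv_cancel₀ h2.1.ne', one_mul]
    rw [mul_add, this]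
    linarith
  exact nonneg_of_mul_nonneg_right h5 h2.1

end VelocityMFG

end

/-! ### Uniform bounds on momenta and speeds -/

noncomputable section

namespace VelocityMFG

/-- A set of full measure is dense in the open interval, and a closed set also catches the end
points. -/
theorem Icc_subset_of_ae_mem {a b : ℝ} (hab : a < b) {F : Set ℝ} (hF : IsClosed F)
    (h : ∀ᵐ t ∂(volume.restrict (Icc a b)), t ∈ F) : Icc a b ⊆ F := by
  rw [ae_restrict_iff' measurableSet_Icc] at h
  rw [← closure_Ioo hab.ne]
  refine closure_minimal ?_ hF
  refine ((Measure.dense_of_ae h).open_subset_closure_inter isOpen_Ioo).trans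
    (closure_minimal ?_ hF)
  exact fun t ht => ht.2 (Ioo_subset_Icc_self ht.1)

variable {d : ℕ} {Λ : AddSubgroup (E d)} {T : ℝ} [hΛ : Fact (IsSpaceOrTorus Λ)]
  [hT : Fact (0 < T)] {Ψ η : Dom Λ → ℝ} {Q : Measure (Curve Λ T)} {B C δ lam : ℝ} {K L : ℝ≥0}
  {x : E d} {v v' : ℝ → E d} {y y' : ℝ → Dom Λ}

omit hΛ in
theorem path_sub_path {v : ℝ → E d} (hv : IntegrableOn v (Icc 0 T)) {s t : ℝ} (hs : s ∈ Icc 0 T)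
    (ht : t ∈ Icc 0 T) : path Λ x v t = path Λ x v s + ((∫ τ in s..t, v τ : E d) : Dom Λ) := by
  have h0 : (0 : ℝ) ∈ Icc 0 T := left_mem_Icc.2 hT.out.le
  have hi : ∀ {a b : ℝ}, a ∈ Icc 0 T → b ∈ Icc 0 T → IntervalIntegrable v volume a b :=
    fun ha hb => (hv.mono_set (uIcc_subset_Icc ha hb)).intervalIntegrable
  unfold path
  rw [← QuotientAddGroup.mk_add, add_assoc,
    intervalIntegral.integral_add_adjacent_intervals (hi h0 hs) (hi hs ht)]

omit hΛ in
theorem dist_path_le {v : ℝ → E d} (hv : IntegrableOn v (Icc 0 T)) {V : ℝ}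
    (hV : ∀ᵐ t ∂(timeMeasure T), ‖v t‖ ≤ V) {s t : ℝ} (hs : s ∈ Icc 0 T) (ht : t ∈ Icc 0 T) :
    dist (path Λ x v t) (path Λ x v s) ≤ V * |t - s| := by
  rw [path_sub_path hv hs ht, dist_eq_norm, add_sub_cancel_left]
  refine (norm_mk_le _).trans ?_
  refine intervalIntegral.norm_integral_le_of_norm_le_const_ae ?_
  filter_upwards [(ae_restrict_iff' measurableSet_Icc).1 hV] with τ hτ hτ'
  exact hτ ((uIoc_subset_uIcc.trans (uIcc_subset_Icc hs ht)) hτ')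

namespace Admissible

variable (hA : Admissible Ψ η Q B C K L)

include hA

theorem ae_integrable_vel : ∀ᵐ t ∂(timeMeasure T), Integrable (fun ω => vel ω t) Q := by
  have := hA.prob
  exact (hA.memLp_vel.integrable one_le_two).prod_right_ae

theorem aestronglyMeasurable_eta (a : Dom Λ) (t : ℝ) :
    AEStronglyMeasurable (fun ω => η (a - curveAt ω t)) Q := by
  have h : Continuous fun ω : Curve Λ T => curveAt ω t :=
    continuous_curveAt.comp (Continuous.prodMk_left t)
  exact (hA.eta_lip.continuous.comp (continuous_const.sub h)).aestronglyMeasurable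

theorem norm_eta_le (a : Dom Λ) : ‖η a‖ ≤ B := by
  rw [Real.norm_eq_abs, abs_of_pos (hA.eta_pos _)]
  exact hA.eta_le _

theorem integrable_eta (a : Dom Λ) (t : ℝ) : Integrable (fun ω => η (a - curveAt ω t)) Q := by
  have := hA.prob
  exact Integrable.of_bound (hA.aestronglyMeasurable_eta a t) B
    (ae_of_all _ fun _ => hA.norm_eta_le _)

theorem integrable_eta_smul (a : Dom Λ) (t : ℝ) {f : Curve Λ T → E d} (hf : Integrable f Q) :
    Integrable (fun ω => η (a - curveAt ω t) • f ω) Q :=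
  hf.bdd_smul B (hA.aestronglyMeasurable_eta a t) (ae_of_all _ fun _ => hA.norm_eta_le _)

/-- The averaged weight `a(t, y(t))`. -/
theorem weight_mem_Icc (a : Dom Λ) (t : ℝ) : (∫ ω, η (a - curveAt ω t) ∂Q) ∈ Icc 0 B := by
  have := hA.prob
  refine ⟨integral_nonneg fun _ => (hA.eta_pos _).le, ?_⟩
  have := integral_mono (hA.integrable_eta a t) (integrable_const B) fun _ => hA.eta_le _
  simpa using this

theorem relMom_eq {t : ℝ} (ht : Integrable (fun ω => vel ω t) Q) :
    relMom η Q y v t = (∫ ω, η (y t - curveAt ω t) ∂Q) • v t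
      - ∫ ω, η (y t - curveAt ω t) • vel ω t ∂Q := by
  have := hA.prob
  simp only [relMom, smul_sub]
  rw [integral_sub (hA.integrable_eta_smul _ t (integrable_const _))
    (hA.integrable_eta_smul _ t ht), integral_smul_const]

theorem norm_integral_eta_smul_le (a : Dom Λ) (t : ℝ) {f : Curve Λ T → E d} {M : ℝ}
    (hM : ∀ᵐ ω ∂Q, ‖f ω‖ ≤ M) :
    ‖∫ ω, η (a - curveAt ω t) • f ω ∂Q‖ ≤ (∫ ω, η (a - curveAt ω t) ∂Q) * M := by
  rw [← integral_mul_const]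
  refine norm_integral_le_of_norm_le ((hA.integrable_eta a t).mul_const M) ?_
  filter_upwards [hM] with ω hω
  rw [norm_smul, Real.norm_eq_abs, abs_of_pos (hA.eta_pos _)]
  exact mul_le_mul_of_nonneg_left hω (hA.eta_pos _).le

theorem integrable_of_ae_norm_le {t V : ℝ} (ht : ∀ᵐ ω ∂Q, ‖vel ω t‖ ≤ V) :
    Integrable (fun ω => vel ω t) Q := by
  have := hA.prob
  exact Integrable.of_bound
    (measurable_vel.comp measurable_prodMk_right).aestronglyMeasurable V ht

/-- The term λa v in the momentum is moved to the left. The same weight a then appears on both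
sides, which is the form the maximum principle takes as input. -/
theorem mul_norm_le {t M : ℝ} (hδ : 0 ≤ δ) (hlam : 0 ≤ lam) (ht : ∀ᵐ ω ∂Q, ‖vel ω t‖ ≤ M) :
    (δ + lam * ∫ ω, η (y t - curveAt ω t) ∂Q) * ‖v t‖
      ≤ ‖mom δ lam η Q y v t‖ + (lam * ∫ ω, η (y t - curveAt ω t) ∂Q) * M := by
  have hint := hA.integrable_of_ae_norm_le ht
  have ha := (hA.weight_mem_Icc (y t) t).1
  have h1 := hA.norm_integral_eta_smul_le (y t) t ht
  set a := ∫ ω, η (y t - curveAt ω t) ∂Q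
  have h2 : (δ + lam * a) • v t
      = mom δ lam η Q y v t + lam • ∫ ω, η (y t - curveAt ω t) • vel ω t ∂Q := by
    rw [mom, hA.relMom_eq hint, smul_sub, add_smul, mul_smul]
    abel
  have h3 : ‖(δ + lam * a) • v t‖ = (δ + lam * a) * ‖v t‖ := by
    rw [norm_smul, Real.norm_eq_abs, abs_of_nonneg (by positivity)]
  rw [← h3, h2]
  refine (norm_add_le _ _).trans ?_
  rw [norm_smul, Real.norm_eq_abs, abs_of_nonneg hlam, mul_assoc]
  gcongr

/-- Z/δ is the fixed point of the averaging inequality: (δ + λa)(Z/δ) = Z + λa(Z/δ). The curve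
itself may be atypical; only the other speeds at time t matter. -/
theorem norm_le_of_norm_mom_le {t Z : ℝ} (hδ : 0 < δ) (hlam : 0 ≤ lam)
    (ht : ∀ᵐ ω ∂Q, ‖vel ω t‖ ≤ Z / δ) (hZ : ‖mom δ lam η Q y v t‖ ≤ Z) : ‖v t‖ ≤ Z / δ := by
  have h := hA.mul_norm_le (y := y) (v := v) hδ.le hlam ht
  have ha := (hA.weight_mem_Icc (y t) t).1
  set a := ∫ ω, η (y t - curveAt ω t) ∂Q
  have hpos : 0 < δ + lam * a := by positivity
  rw [← mul_le_mul_iff_right₀ hpos]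
  refine h.trans ?_
  have : (δ + lam * a) * (Z / δ) = Z + lam * a * (Z / δ) := by field_simp
  linarith

/-- Needed to exchange "for almost every curve, for almost every time" into the order in which the
maximum principle is applied, at a fixed time. -/
theorem measurable_mom_curve :
    Measurable fun p : ℝ × Curve Λ T => mom δ lam η Q (curveAt p.2) (vel p.2) p.1 := by
  have := hA.prob
  have h1 : Continuous fun p : (ℝ × Curve Λ T) × Curve Λ T =>
      η (curveAt p.1.2 p.1.1 - curveAt p.2 p.1.1) :=
    hA.eta_lip.continuous.comp ((continuous_curveAt.comp
      (f := fun p : (ℝ × Curve Λ T) × Curve Λ T => (p.1.2, p.1.1)) (by fun_prop)).sub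
      (continuous_curveAt.comp
        (f := fun p : (ℝ × Curve Λ T) × Curve Λ T => (p.2, p.1.1)) (by fun_prop)))
  have h2 : Measurable fun p : (ℝ × Curve Λ T) × Curve Λ T =>
      vel p.1.2 p.1.1 - vel p.2 p.1.1 :=
    (measurable_vel.comp (f := fun p : (ℝ × Curve Λ T) × Curve Λ T => (p.1.2, p.1.1))
      (by fun_prop)).sub (measurable_vel.comp
        (f := fun p : (ℝ × Curve Λ T) × Curve Λ T => (p.2, p.1.1)) (by fun_prop))
  have h3 := ((h1.measurable.smul h2).stronglyMeasurable.integral_prod_right' (ν := Q)).measurable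
  exact (measurable_vel_swap.const_smul δ).add (h3.const_smul lam)

/-- Almost every curve has speed at most `Z / δ` if the momenta are bounded by `Z`. -/
theorem ae_ae_norm_vel_le (hδ : 0 < δ) (hlam : 0 ≤ lam) {Z : ℝ}
    (hZ : ∀ᵐ ω ∂Q, ∀ᵐ t ∂(timeMeasure T), ‖mom δ lam η Q (curveAt ω) (vel ω) t‖ ≤ Z) :
    ∀ᵐ t ∂(timeMeasure T), ∀ᵐ ω ∂Q, ‖vel ω t‖ ≤ Z / δ := by
  have := hA.prob
  have hm : MeasurableSet {p : ℝ × Curve Λ T |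
      ‖mom δ lam η Q (curveAt p.2) (vel p.2) p.1‖ ≤ Z} :=
    measurableSet_le hA.measurable_mom_curve.norm measurable_const
  have hZ' : ∀ᵐ t ∂(timeMeasure T), ∀ᵐ ω ∂Q, ‖mom δ lam η Q (curveAt ω) (vel ω) t‖ ≤ Z :=
    (Measure.ae_ae_comm hm).2 hZ
  filter_upwards [hZ', hA.ae_integrable_vel] with t ht hint
  have hB := hA.B_nonneg
  -- At almost every time the speeds are Q-integrable, so au is bounded by B times the mean speed.
  -- This gives the crude bound `M₀` that starts the iteration.
  refine ae_le_of_forall_ae_le (A := lam * B) (M₀ := (Z + lam * (B * ∫ ω, ‖vel ω t‖ ∂Q)) / δ) hδ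
    (by positivity) ?_ ?_
  · filter_upwards [ht] with ω hω
    have ha := (hA.weight_mem_Icc (curveAt ω t) t).1
    set a := ∫ ω', η (curveAt ω t - curveAt ω' t) ∂Q with hadef
    have h2 : (δ + lam * a) • vel ω t = mom δ lam η Q (curveAt ω) (vel ω) t
        + lam • ∫ ω', η (curveAt ω t - curveAt ω' t) • vel ω' t ∂Q := by
      rw [mom, hA.relMom_eq hint, smul_sub, add_smul, mul_smul]
      abel
    have h3 : ‖(δ + lam * a) • vel ω t‖ = (δ + lam * a) * ‖vel ω t‖ := by
      rw [norm_smul, Real.norm_eq_abs, abs_of_nonneg (by positivity)]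
    have h4 : ‖∫ ω', η (curveAt ω t - curveAt ω' t) • vel ω' t ∂Q‖ ≤ B * ∫ ω, ‖vel ω t‖ ∂Q := by
      rw [← integral_const_mul]
      refine norm_integral_le_of_norm_le (hint.norm.const_mul B) (ae_of_all _ fun ω' => ?_)
      rw [norm_smul]
      exact mul_le_mul_of_nonneg_right (hA.norm_eta_le _) (norm_nonneg _)
    rw [le_div_iff₀ hδ]
    have h5 : ‖(δ + lam * a) • vel ω t‖ ≤ Z + lam * (B * ∫ ω, ‖vel ω t‖ ∂Q) := by
      rw [h2]
      refine (norm_add_le _ _).trans (add_le_add hω ?_)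
      rw [norm_smul, Real.norm_eq_abs, abs_of_nonneg hlam]
      exact mul_le_mul_of_nonneg_left h4 hlam
    rw [h3] at h5
    have : 0 ≤ lam * a * ‖vel ω t‖ := by positivity
    linarith
  · intro M _ hM
    filter_upwards [ht] with ω hω
    have ha := hA.weight_mem_Icc (curveAt ω t) t
    refine ⟨_, ⟨mul_nonneg hlam ha.1, mul_le_mul_of_nonneg_left ha.2 hlam⟩,
      (hA.mul_norm_le (y := curveAt ω) (v := vel ω) hδ.le hlam hM).trans ?_⟩
    gcongr

/-- The momenta of all the minimizers are uniformly bounded. -/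
theorem exists_forall_norm_mom_le (hδ : 0 < δ) (hlam : 0 ≤ lam) :
    ∃ M : ℝ, 0 ≤ M ∧ ∀ (x : E d) (v : ℝ → E d), IsMin δ lam Ψ η Q x v →
      ∀ᵐ t ∂(timeMeasure T), ‖mom δ lam η Q (path Λ x v) v t‖ ≤ M := by
  have := hA.prob
  have hT0 := hT.out
  have hB := hA.B_nonneg
  have hC := hA.C_nonneg
  set E₀ := ∫ p, ‖vel p.2 p.1‖ ^ 2 ∂((timeMeasure T).prod Q) with hE₀
  have hE₀0 : 0 ≤ E₀ := integral_nonneg fun p => by positivity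
  -- A deliberately loose bound for L + ∫G. Comparison with the constant curve bounds the
  -- interaction cost by λB E₀/2 plus the variation of Ψ, and Young's inequality absorbs the latter
  -- into the kinetic energy. Neither x nor v enters.
  refine ⟨L + C * (lam * B * E₀ + 2 * (L ^ 2 * T / δ)), by positivity, fun x v hv => ?_⟩
  have hy : AEStronglyMeasurable (path Λ x v) (timeMeasure T) :=
    aestronglyMeasurable_path x (hv.1.integrable one_le_two)
  have hdi := hA.integrable_dens hv.1 hy
  have hG := ae_norm_le_of_weak_bound hT0.le (hA.integrable_mom (δ := δ) (lam := lam) hv.1 hy)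
    (hdi.const_mul (lam * C / 2))
    (fun t => mul_nonneg (by positivity) (hA.dens_nonneg t)) L.2
    (fun k hk hkM => hA.weak_bound hlam hv hk hkM)
  have h0 := hv.2 0 MemLp.zero'
  have hp0 : path Λ x (0 : ℝ → E d) T = (x : Dom Λ) := by simp [path]
  have hpT : path Λ x v T = (x : Dom Λ) + ((∫ t in (0 : ℝ)..T, v t : E d) : Dom Λ) := by
    rw [path, QuotientAddGroup.mk_add]
  have hd0 : ∫ t in Icc 0 T, dens η Q (path Λ x (0 : ℝ → E d)) 0 t ≤ B * E₀ := by
    have hi := hA.integrable_dens_prod (v := 0) (y := path Λ x (0 : ℝ → E d)) MemLp.zero'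
      (aestronglyMeasurable_path x (integrable_zero _ _ _))
    have h1 := integral_prod _ hi
    change _ = ∫ t in Icc 0 T, dens η Q (path Λ x (0 : ℝ → E d)) 0 t at h1
    rw [← h1, hE₀, ← integral_const_mul]
    refine integral_mono hi (hA.energy.const_mul B) fun p => ?_
    simp only [Pi.zero_apply, zero_sub, norm_neg]
    rw [mul_comm]
    exact mul_le_mul_of_nonneg_right (hA.eta_le _) (by positivity)
  unfold action at h0
  rw [hp0, hpT] at h0
  have hz : ∫ t in Icc 0 T, ‖(0 : ℝ → E d) t‖ ^ 2 = 0 := by simp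
  rw [hz] at h0
  have h2 : Ψ (x : Dom Λ) - Ψ ((x : Dom Λ) + ((∫ t in (0 : ℝ)..T, v t : E d) : Dom Λ))
      ≤ L * ‖∫ t in (0 : ℝ)..T, v t‖ := by
    refine (le_abs_self _).trans ?_
    rw [← Real.dist_eq, dist_comm]
    refine (hA.psi_lip.dist_le_mul _ _).trans (mul_le_mul_of_nonneg_left ?_ L.2)
    rw [dist_eq_norm, add_sub_cancel_left]
    exact norm_mk_le _
  have h3 := mul_norm_integral_le hv.1 hδ L.2
  rw [NNReal.val_eq_coe] at h3
  have h4 := mul_le_mul_of_nonneg_left hd0 (show 0 ≤ lam / 2 by positivity)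
  have h5 : 0 ≤ ∫ t in Icc 0 T, dens η Q (path Λ x v) v t :=
    integral_nonneg fun t => hA.dens_nonneg t
  have h6 : 0 ≤ ∫ t in Icc 0 T, ‖v t‖ ^ 2 := integral_nonneg fun t => by positivity
  have h7 : lam / 2 * (∫ t in Icc 0 T, dens η Q (path Λ x v) v t)
      ≤ lam * B * E₀ + 2 * (L ^ 2 * T / δ) := by
    have h8 : 0 ≤ lam / 2 * (∫ t in Icc 0 T, dens η Q (path Λ x v) v t) := by positivity
    have h9 : 0 ≤ δ * (∫ t in Icc 0 T, ‖v t‖ ^ 2) := by positivity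
    have h10 : 0 ≤ lam * B * E₀ := by positivity
    have h11 : 0 ≤ (L : ℝ) ^ 2 * T / δ := by positivity
    linarith
  filter_upwards [hG] with t ht
  refine ht.trans ?_
  rw [integral_const_mul, NNReal.val_eq_coe]
  have := mul_le_mul_of_nonneg_left h7 hC
  linarith

/-- The interaction density is bounded when the speeds are. -/
theorem dens_le {V t : ℝ} (hv : ‖v t‖ ≤ V) (ht : ∀ᵐ ω ∂Q, ‖vel ω t‖ ≤ V) :
    dens η Q y v t ≤ (2 * V) ^ 2 * B := by
  have := hA.prob
  have h := integral_mono_of_nonneg (μ := Q)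
    (f := fun ω => ‖v t - vel ω t‖ ^ 2 * η (y t - curveAt ω t)) (g := fun _ => (2 * V) ^ 2 * B)
    (ae_of_all _ fun ω => mul_nonneg (by positivity) (hA.eta_pos _).le) (integrable_const _) ?_
  · simpa [dens] using h
  · filter_upwards [ht] with ω hω
    have h1 : ‖v t - vel ω t‖ ≤ 2 * V := (norm_sub_le _ _).trans (by linarith)
    exact mul_le_mul (pow_le_pow_left₀ (norm_nonneg _) h1 2) (hA.eta_le _) (hA.eta_pos _).le
      (by positivity)

/-- Once speeds are bounded, the density is bounded pointwise in time rather than merely in L¹, so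
the weak inequality |z'| ≤ G becomes a Lipschitz estimate. -/
theorem exists_mom_lipschitz (hlam : 0 ≤ lam) (hv : IsMin δ lam Ψ η Q x v) {V : ℝ}
    (hvV : ∀ᵐ t ∂(timeMeasure T), ‖v t‖ ≤ V)
    (hV : ∀ᵐ t ∂(timeMeasure T), ∀ᵐ ω ∂Q, ‖vel ω t‖ ≤ V) :
    ∃ D : Set ℝ, (∀ᵐ t ∂(timeMeasure T), t ∈ D) ∧ ∀ t ∈ D, ∀ s ∈ D,
      ‖mom δ lam η Q (path Λ x v) v t - mom δ lam η Q (path Λ x v) v s‖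
        ≤ lam * C / 2 * ((2 * V) ^ 2 * B) * |t - s| := by
  have hC := hA.C_nonneg
  have hB := hA.B_nonneg
  have hy : AEStronglyMeasurable (path Λ x v) (timeMeasure T) :=
    aestronglyMeasurable_path x (hv.1.integrable one_le_two)
  refine ae_norm_sub_le_of_weak_bound hT.out.le (hA.integrable_mom hv.1 hy)
    (G := fun t => lam * C / 2 * dens η Q (path Λ x v) v t) (L := L)
    (fun t => mul_nonneg (by positivity) (hA.dens_nonneg t)) (by positivity) ?_
    (fun k hk hkM => hA.weak_bound hlam hv hk hkM)
  filter_upwards [hvV, hV] with t h1 h2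
  exact mul_le_mul_of_nonneg_left (hA.dens_le h1 h2) (by positivity)

/-- The main estimate on the difference of two averaged relative velocities. -/
theorem norm_relMom_sub_le {t s M V κ : ℝ} (hκ : 0 ≤ κ)
    (hM : ∀ᵐ ω ∂Q, ‖vel ω t - vel ω s‖ ≤ M) (hVt : ∀ᵐ ω ∂Q, ‖vel ω t‖ ≤ V)
    (hVs : ∀ᵐ ω ∂Q, ‖vel ω s‖ ≤ V) (hv : ‖v' s‖ ≤ V)
    (hη : ∀ᵐ ω ∂Q, |η (y t - curveAt ω t) - η (y' s - curveAt ω s)| ≤ κ) :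
    ‖relMom η Q y v t - relMom η Q y' v' s
        - (∫ ω, η (y t - curveAt ω t) ∂Q) • (v t - v' s)‖
      ≤ (∫ ω, η (y t - curveAt ω t) ∂Q) * M + κ * (2 * V) := by
  have := hA.prob
  have it := hA.integrable_of_ae_norm_le hVt
  have is := hA.integrable_of_ae_norm_le hVs
  have i1 := hA.integrable_eta_smul (y t) t ((integrable_const (v t)).sub it)
  have i2 := hA.integrable_eta_smul (y' s) s ((integrable_const (v' s)).sub is)
  have i3 := hA.integrable_eta_smul (y t) t (integrable_const (v t - v' s))
  have i4 := hA.integrable_eta_smul (y t) t (it.sub is)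
  have i5 := (hA.integrable_eta_smul (y t) t ((integrable_const (v' s)).sub is)).sub i2
  -- After removal of a(v(t) - v'(s)) two errors remain: the change of weight against relative
  -- velocities at s (size κ · 2V), and the change of the other velocities against the weight at t
  -- (size aM).
  have heq : relMom η Q y v t - relMom η Q y' v' s
      - (∫ ω, η (y t - curveAt ω t) ∂Q) • (v t - v' s)
      = (∫ ω, (η (y t - curveAt ω t) • (v' s - vel ω s)
          - η (y' s - curveAt ω s) • (v' s - vel ω s)) ∂Q)
        - ∫ ω, η (y t - curveAt ω t) • (vel ω t - vel ω s) ∂Q := by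
    rw [relMom, relMom, ← integral_smul_const]
    refine ((congrArg₂ (· - ·) (integral_sub i1 i2).symm rfl).trans
      (integral_sub (i1.sub i2) i3).symm).trans
      (Eq.trans ?_ (integral_sub i5 i4))
    refine integral_congr_ae (ae_of_all _ fun ω => ?_)
    simp only [Pi.sub_apply, smul_sub]
    abel
  rw [heq]
  refine (norm_sub_le _ _).trans ?_
  rw [add_comm]
  refine add_le_add (hA.norm_integral_eta_smul_le (y t) t hM) ?_
  have h := norm_integral_le_of_norm_le (μ := Q) (g := fun _ => κ * (2 * V))
    (f := fun ω => η (y t - curveAt ω t) • (v' s - vel ω s)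
      - η (y' s - curveAt ω s) • (v' s - vel ω s)) (integrable_const _) ?_
  · simpa using h
  · filter_upwards [hVs, hη] with ω h1 h2
    rw [← sub_smul, norm_smul, Real.norm_eq_abs]
    exact mul_le_mul h2 ((norm_sub_le _ _).trans (by linarith)) (norm_nonneg _) hκ

end Admissible

end VelocityMFG

end

/-! ### Lipschitz regularity of minimizing velocities -/

noncomputable section

namespace VelocityMFG

variable {d : ℕ} {Λ : AddSubgroup (E d)} {T : ℝ} [hΛ : Fact (IsSpaceOrTorus Λ)]
  [hT : Fact (0 < T)] {Ψ η : Dom Λ → ℝ} {Q : Measure (Curve Λ T)} {B C δ lam : ℝ} {K L : ℝ≥0}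
  {x : E d} {v v' : ℝ → E d} {y y' : ℝ → Dom Λ}

theorem mom_congr {t : ℝ} (hy : y t = y' t) :
    mom δ lam η Q y v t = mom δ lam η Q y' v t := by
  simp only [mom, relMom, hy]

namespace Admissible

variable (hA : Admissible Ψ η Q B C K L)

include hA

/-- The analogue of `mul_norm_le` for increments: M bounds the increments of the other velocities
and carries the same factor λa, so the maximum principle applies again. -/
theorem mul_norm_sub_le {t s M V κ : ℝ} (hδ : 0 ≤ δ) (hlam : 0 ≤ lam) (hκ : 0 ≤ κ)
    (hM : ∀ᵐ ω ∂Q, ‖vel ω t - vel ω s‖ ≤ M) (hVt : ∀ᵐ ω ∂Q, ‖vel ω t‖ ≤ V)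
    (hVs : ∀ᵐ ω ∂Q, ‖vel ω s‖ ≤ V) (hv : ‖v' s‖ ≤ V)
    (hη : ∀ᵐ ω ∂Q, |η (y t - curveAt ω t) - η (y' s - curveAt ω s)| ≤ κ) :
    (δ + lam * ∫ ω, η (y t - curveAt ω t) ∂Q) * ‖v t - v' s‖
      ≤ ‖mom δ lam η Q y v t - mom δ lam η Q y' v' s‖ + lam * (κ * (2 * V))
        + (lam * ∫ ω, η (y t - curveAt ω t) ∂Q) * M := by
  have h1 := hA.norm_relMom_sub_le (v := v) hκ hM hVt hVs hv hη
  have ha := (hA.weight_mem_Icc (y t) t).1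
  set a := ∫ ω, η (y t - curveAt ω t) ∂Q
  have h2 : (δ + lam * a) • (v t - v' s)
      = (mom δ lam η Q y v t - mom δ lam η Q y' v' s)
        - lam • (relMom η Q y v t - relMom η Q y' v' s - a • (v t - v' s)) := by
    simp only [mom, smul_sub, add_smul, mul_smul]
    abel
  have h3 : ‖(δ + lam * a) • (v t - v' s)‖ = (δ + lam * a) * ‖v t - v' s‖ := by
    rw [norm_smul, Real.norm_eq_abs, abs_of_nonneg (by positivity)]
  rw [← h3, h2]
  refine (norm_sub_le _ _).trans ?_
  rw [norm_smul, Real.norm_eq_abs, abs_of_nonneg hlam]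
  have := mul_le_mul_of_nonneg_left h1 hlam
  linarith

theorem abs_eta_sub_le {y₁ y₂ y₃ y₄ : Dom Λ} {r₁ r₂ : ℝ} (h₁ : dist y₁ y₂ ≤ r₁)
    (h₂ : dist y₃ y₄ ≤ r₂) : |η (y₁ - y₃) - η (y₂ - y₄)| ≤ K * (r₁ + r₂) := by
  rw [← Real.dist_eq]
  refine (hA.eta_lip.dist_le_mul _ _).trans (mul_le_mul_of_nonneg_left ?_ K.2)
  exact (dist_sub_sub_le _ _ _ _).trans (add_le_add h₁ h₂)

/-- A minimizing velocity with momentum bounded by `Z` is almost everywhere equal to a Lipschitz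
function bounded by `Z / δ`, if the same bound holds for the momenta of almost every curve. -/
theorem exists_lipschitz_velocity (hδ : 0 < δ) (hlam : 0 ≤ lam) {Z : ℝ} (hZ0 : 0 ≤ Z)
    (hmin : ∀ᵐ ω ∂Q, ∃ x : E d, (x : Dom Λ) = curveAt ω 0 ∧ IsMin δ lam Ψ η Q x (vel ω))
    (hZ : ∀ᵐ ω ∂Q, ∀ᵐ t ∂(timeMeasure T), ‖mom δ lam η Q (curveAt ω) (vel ω) t‖ ≤ Z)
    (hv : IsMin δ lam Ψ η Q x v)
    (hvZ : ∀ᵐ t ∂(timeMeasure T), ‖mom δ lam η Q (path Λ x v) v t‖ ≤ Z) :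
    ∃ (ℓ : ℝ≥0) (g : ℝ → E d), LipschitzWith ℓ g ∧ v =ᵐ[timeMeasure T] g ∧
      ∀ t ∈ Icc 0 T, ‖g t‖ ≤ Z / δ := by
  have := hA.prob
  have hB := hA.B_nonneg
  have hC := hA.C_nonneg
  set V := Z / δ with hVdef
  have hV0 : 0 ≤ V := by positivity
  have hV : ∀ᵐ t ∂(timeMeasure T), ∀ᵐ ω ∂Q, ‖vel ω t‖ ≤ V := hA.ae_ae_norm_vel_le hδ hlam hZ
  have hV' : ∀ᵐ ω ∂Q, ∀ᵐ t ∂(timeMeasure T), ‖vel ω t‖ ≤ V :=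
    (Measure.ae_ae_comm (p := fun t (ω : Curve Λ T) => ‖vel ω t‖ ≤ V)
      (measurableSet_le measurable_vel_swap.norm measurable_const)).1 hV
  have hvV : ∀ᵐ t ∂(timeMeasure T), ‖v t‖ ≤ V := by
    filter_upwards [hV, hvZ] with t h1 h2 using hA.norm_le_of_norm_mom_le hδ hlam h1 h2
  set g₀ := lam * C / 2 * ((2 * V) ^ 2 * B)
  have hg₀ : 0 ≤ g₀ := by positivity
  have hfst : ∀ {p : ℝ → Prop}, (∀ᵐ t ∂(timeMeasure T), p t) →
      ∀ᵐ q ∂((timeMeasure T).prod (timeMeasure T)), p q.1 := fun h =>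
    Measure.quasiMeasurePreserving_fst.ae h
  have hsnd : ∀ {p : ℝ → Prop}, (∀ᵐ t ∂(timeMeasure T), p t) →
      ∀ᵐ q ∂((timeMeasure T).prod (timeMeasure T)), p q.2 := fun h =>
    Measure.quasiMeasurePreserving_snd.ae h
  -- The exceptional times depend on the curve, so the estimate is recorded for almost every pair of
  -- times; Fubini can then exchange pairs and curves.
  have hlip : ∀ {x' : E d} {w : ℝ → E d}, IsMin δ lam Ψ η Q x' w →
      (∀ᵐ t ∂(timeMeasure T), ‖w t‖ ≤ V) → ∀ᵐ q ∂((timeMeasure T).prod (timeMeasure T)),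
        ‖mom δ lam η Q (path Λ x' w) w q.1 - mom δ lam η Q (path Λ x' w) w q.2‖
          ≤ g₀ * |q.1 - q.2| := by
    intro x' w hw hwV
    obtain ⟨D, hD, hDl⟩ := hA.exists_mom_lipschitz hlam hw hwV hV
    filter_upwards [hfst hD, hsnd hD] with q h1 h2 using hDl _ h1 _ h2
  have hmem : ∀ᵐ t ∂(timeMeasure T), t ∈ Icc 0 T := ae_restrict_mem measurableSet_Icc
  have hmomω : ∀ᵐ ω ∂Q, ∀ᵐ q ∂((timeMeasure T).prod (timeMeasure T)),
      ‖mom δ lam η Q (curveAt ω) (vel ω) q.1 - mom δ lam η Q (curveAt ω) (vel ω) q.2‖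
        ≤ g₀ * |q.1 - q.2| := by
    filter_upwards [hA.isH1, hmin, hV'] with ω h1 ⟨x', hx', h2⟩ h3
    filter_upwards [hlip h2 h3, hfst hmem, hsnd hmem] with q hq hq1 hq2
    rwa [mom_congr (h1.path_eq hx' hq1), mom_congr (h1.path_eq hx' hq2)] at hq
  have hmomq : ∀ᵐ q ∂((timeMeasure T).prod (timeMeasure T)), ∀ᵐ ω ∂Q,
      ‖mom δ lam η Q (curveAt ω) (vel ω) q.1 - mom δ lam η Q (curveAt ω) (vel ω) q.2‖
        ≤ g₀ * |q.1 - q.2| := by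
    refine (Measure.ae_ae_comm ?_).2 hmomω
    have h1 : Measurable fun p : (ℝ × ℝ) × Curve Λ T =>
        mom δ lam η Q (curveAt p.2) (vel p.2) p.1.1 :=
      hA.measurable_mom_curve.comp (f := fun p : (ℝ × ℝ) × Curve Λ T => (p.1.1, p.2))
        (by fun_prop)
    have h2 : Measurable fun p : (ℝ × ℝ) × Curve Λ T =>
        mom δ lam η Q (curveAt p.2) (vel p.2) p.1.2 :=
      hA.measurable_mom_curve.comp (f := fun p : (ℝ × ℝ) × Curve Λ T => (p.1.2, p.2))
        (by fun_prop)
    have h3 : Measurable fun p : (ℝ × ℝ) × Curve Λ T => g₀ * |p.1.1 - p.1.2| := by fun_prop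
    exact measurableSet_le (h1.sub h2).norm h3
  have hdist : ∀ᵐ ω ∂Q, ∀ t ∈ Icc 0 T, ∀ s ∈ Icc 0 T,
      dist (curveAt ω t) (curveAt ω s) ≤ V * |t - s| := by
    filter_upwards [hA.isH1, hV'] with ω h1 h2 t ht s hs
    obtain ⟨x', hx'⟩ := QuotientAddGroup.mk_surjective (curveAt ω 0)
    rw [← h1.path_eq hx' ht, ← h1.path_eq hx' hs]
    exact dist_path_le h1.integrableOn_vel h2 hs ht
  have key : ∀ᵐ q ∂((timeMeasure T).prod (timeMeasure T)),
      ‖v q.1 - v q.2‖ ≤ (g₀ + lam * (K * (V + V) * (2 * V))) / δ * |q.1 - q.2| := by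
    filter_upwards [hmomq, hfst hV, hsnd hV, hsnd hvV, hlip hv hvV, hfst hmem, hsnd hmem]
      with ⟨t, s⟩ h1 h2 h3 h5 h6 ht hs
    simp only at h1 h2 h3 h5 h6 ht hs ⊢
    set r := |t - s|
    have hr : 0 ≤ r := abs_nonneg _
    -- Stated for an arbitrary curve because it serves twice: for Q-almost every curve within the
    -- maximum principle, then for the given minimizer.
    have hstep : ∀ (y : ℝ → Dom Λ) (w : ℝ → E d), dist (y t) (y s) ≤ V * r → ‖w s‖ ≤ V →
        ‖mom δ lam η Q y w t - mom δ lam η Q y w s‖ ≤ g₀ * r → ∀ M,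
        (∀ᵐ ω ∂Q, ‖vel ω t - vel ω s‖ ≤ M) →
        (δ + lam * ∫ ω, η (y t - curveAt ω t) ∂Q) * ‖w t - w s‖
          ≤ (g₀ + lam * (K * (V + V) * (2 * V))) * r
            + (lam * ∫ ω, η (y t - curveAt ω t) ∂Q) * M := by
      intro y w hy hw hm M hM
      have h := hA.mul_norm_sub_le (δ := δ) (lam := lam) (y := y) (y' := y) (v := w) (v' := w)
        (κ := K * (V * r + V * r)) hδ.le hlam (by positivity) hM h2 h3 hw ?_
      · linarith
      · filter_upwards [hdist] with ω hω
        exact hA.abs_eta_sub_le hy (hω t ht s hs)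
    set k := (g₀ + lam * (K * (V + V) * (2 * V))) * r with hk
    have hW : ∀ᵐ ω ∂Q, ‖vel ω t - vel ω s‖ ≤ k / δ := by
      refine ae_le_of_forall_ae_le (A := lam * B) (M₀ := 2 * V) hδ (by positivity) ?_ ?_
      · filter_upwards [h2, h3] with ω h7 h8
        exact (norm_sub_le _ _).trans (by linarith)
      · intro M _ hM
        filter_upwards [h1, h3, hdist] with ω h7 h8 h9
        have ha := hA.weight_mem_Icc (curveAt ω t) t
        exact ⟨_, ⟨mul_nonneg hlam ha.1, mul_le_mul_of_nonneg_left ha.2 hlam⟩,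
          hstep (curveAt ω) (vel ω) (h9 t ht s hs) h8 h7 M hM⟩
    -- The increments over Q are now bounded by k/δ, and one more application of the inequality
    -- gives the same bound for v.
    have h7 := hstep (path Λ x v) v
      (dist_path_le (hv.1.integrable one_le_two) hvV hs ht) h5 h6 _ hW
    have ha := (hA.weight_mem_Icc (path Λ x v t) t).1
    set a := ∫ ω, η (path Λ x v t - curveAt ω t) ∂Q
    have hpos : 0 < δ + lam * a := by positivity
    rw [div_mul_eq_mul_div, ← hk, ← mul_le_mul_iff_right₀ hpos]
    refine h7.trans (le_of_eq ?_)
    field_simp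
  have hKc : 0 ≤ (g₀ + lam * (K * (V + V) * (2 * V))) / δ := by positivity
  obtain ⟨ℓ, g, hg, hvg⟩ := exists_lipschitz_ae_eq
    (K := ⟨(g₀ + lam * (K * (V + V) * (2 * V))) / δ, hKc⟩) (Measure.ae_ae_of_ae_prod key)
  refine ⟨ℓ, g, hg, hvg, ?_⟩
  refine Icc_subset_of_ae_mem hT.out (isClosed_le hg.continuous.norm continuous_const) ?_
  filter_upwards [hvV, hvg] with t h1 h2
  change ‖g t‖ ≤ V
  rwa [← h2]

end Admissible

/-- The velocity of a curve of class `H¹` whose derivative has a continuous representative. -/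
theorem IsH1.velocity_eq {γ : Curve Λ T} (h : IsH1 γ) {g : ℝ → E d} (hg : Continuous g)
    (hv : vel γ =ᵐ[timeMeasure T] g) : DifferentiableOn ℝ (lift γ) (Icc 0 T) ∧
      ∀ t ∈ Icc 0 T, velocity γ t = g t := by
  have hl := isLift_lift hΛ.out hT.out γ
  have heq : ∀ t ∈ Icc 0 T, lift γ t = lift γ 0 + ∫ s in (0 : ℝ)..t, g s := by
    intro t ht
    have hsub : Ioc 0 t ⊆ Icc 0 T := fun s hs => ⟨hs.1.le, hs.2.trans ht.2⟩
    rw [← sub_eq_iff_eq_add', hl.sub_eq_disp ht, h.disp_eq ht,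
      intervalIntegral.integral_of_le ht.1, intervalIntegral.integral_of_le ht.1]
    exact integral_congr_ae (ae_restrict_of_ae_restrict_of_subset hsub hv)
  have hd : ∀ t ∈ Icc 0 T, HasDerivWithinAt (lift γ) (g t) (Icc 0 T) t := fun t ht => by
    have h1 : HasDerivAt (fun t => lift γ 0 + ∫ s in (0 : ℝ)..t, g s) (g t) t :=
      (hg.integral_hasStrictDerivAt 0 t).hasDerivAt.const_add _
    exact h1.hasDerivWithinAt.congr heq (heq t ht)
  exact ⟨fun t ht => (hd t ht).differentiableWithinAt, fun t ht =>
    (hd t ht).derivWithin (uniqueDiffOn_Icc hT.out t ht)⟩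

/-! ### Gluing minimizers at an interior meeting time -/

section Concat

variable {t₀ : ℝ} {x₁ x₂ : E d} {v₁ v₂ : ℝ → E d}

/-- The velocity `v₁` until the time `t₀`, followed by `v₂`. -/
def concat (t₀ : ℝ) (v₁ v₂ : ℝ → E d) (t : ℝ) : E d := if t ≤ t₀ then v₁ t else v₂ t

omit hΛ hT in
theorem memLp_concat (h₁ : MemLp v₁ 2 (timeMeasure T)) (h₂ : MemLp v₂ 2 (timeMeasure T)) :
    MemLp (concat t₀ v₁ v₂) 2 (timeMeasure T) := by
  have : concat t₀ v₁ v₂ = (Iic t₀).indicator v₁ + (Ioi t₀).indicator v₂ := by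
    funext t
    by_cases h : t ≤ t₀
    · simp [concat, h]
    · simp [concat, h, not_le.1 h]
  rw [this]
  exact (h₁.indicator measurableSet_Iic).add (h₂.indicator measurableSet_Ioi)

omit hΛ hT in
theorem path_concat_of_le {t : ℝ} (h0 : 0 ≤ t) (ht : t ≤ t₀) :
    path Λ x₁ (concat t₀ v₁ v₂) t = path Λ x₁ v₁ t := by
  unfold path
  congr 2
  refine intervalIntegral.integral_congr fun s hs => ?_
  rw [uIcc_of_le h0] at hs
  exact if_pos (hs.2.trans ht)

omit hΛ in
theorem path_concat_of_ge {t : ℝ} (ht₀ : t₀ ∈ Icc 0 T) (h₁ : MemLp v₁ 2 (timeMeasure T))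
    (h₂ : MemLp v₂ 2 (timeMeasure T)) (heq : path Λ x₁ v₁ t₀ = path Λ x₂ v₂ t₀)
    (ht : t₀ ≤ t) (htT : t ≤ T) : path Λ x₁ (concat t₀ v₁ v₂) t = path Λ x₂ v₂ t := by
  have htm : t ∈ Icc 0 T := ⟨ht₀.1.trans ht, htT⟩
  rw [path_sub_path ((memLp_concat h₁ h₂).integrable one_le_two) ht₀ htm,
    path_sub_path (h₂.integrable one_le_two) ht₀ htm, path_concat_of_le ht₀.1 le_rfl, heq]
  congr 2
  rw [intervalIntegral.integral_of_le ht, intervalIntegral.integral_of_le ht]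
  refine setIntegral_congr_fun measurableSet_Ioc fun s hs => ?_
  exact if_neg (not_le.2 hs.1)

theorem Admissible.action_eq (hA : Admissible Ψ η Q B C K L) (ht₀ : t₀ ∈ Icc 0 T)
    (hv : MemLp v 2 (timeMeasure T)) : action δ lam Ψ η Q x v
      = (∫ t in Icc 0 t₀, δ / 2 * ‖v t‖ ^ 2 + lam / 2 * dens η Q (path Λ x v) v t)
        + (∫ t in Ioc t₀ T, δ / 2 * ‖v t‖ ^ 2 + lam / 2 * dens η Q (path Λ x v) v t)
        + Ψ (path Λ x v T) := by
  have hy : AEStronglyMeasurable (path Λ x v) (timeMeasure T) :=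
    aestronglyMeasurable_path x (hv.integrable one_le_two)
  have i1 : IntegrableOn (fun t => δ / 2 * ‖v t‖ ^ 2) (Icc 0 T) :=
    (hv.integrable_norm_pow (by norm_num)).const_mul _
  have i2 : IntegrableOn (fun t => lam / 2 * dens η Q (path Λ x v) v t) (Icc 0 T) :=
    (hA.integrable_dens hv hy).const_mul _
  have i3 : IntegrableOn (fun t => δ / 2 * ‖v t‖ ^ 2 + lam / 2 * dens η Q (path Λ x v) v t)
    (Icc 0 T) := i1.add i2
  have hu : Icc 0 t₀ ∪ Ioc t₀ T = Icc 0 T := Icc_union_Ioc_eq_Icc ht₀.1 ht₀.2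
  rw [action, ← integral_const_mul, ← integral_const_mul, ← integral_add i1 i2, ← hu,
    setIntegral_union (disjoint_left.2 fun t h1 h2 => absurd h1.2 (not_le.2 h2.1))
      measurableSet_Ioc (i3.mono_set (hu ▸ subset_union_left))
      (i3.mono_set (hu ▸ subset_union_right))]

theorem Admissible.action_concat (hA : Admissible Ψ η Q B C K L) (ht₀ : t₀ ∈ Icc 0 T)
    (h₁ : MemLp v₁ 2 (timeMeasure T)) (h₂ : MemLp v₂ 2 (timeMeasure T))
    (heq : path Λ x₁ v₁ t₀ = path Λ x₂ v₂ t₀) :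
    action δ lam Ψ η Q x₁ (concat t₀ v₁ v₂)
      = (∫ t in Icc 0 t₀, δ / 2 * ‖v₁ t‖ ^ 2 + lam / 2 * dens η Q (path Λ x₁ v₁) v₁ t)
        + (∫ t in Ioc t₀ T, δ / 2 * ‖v₂ t‖ ^ 2 + lam / 2 * dens η Q (path Λ x₂ v₂) v₂ t)
        + Ψ (path Λ x₂ v₂ T) := by
  rw [hA.action_eq ht₀ (memLp_concat h₁ h₂), path_concat_of_ge ht₀ h₁ h₂ heq ht₀.2 le_rfl]
  congr 2
  · refine setIntegral_congr_fun measurableSet_Icc fun t ht => ?_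
    have hc : concat t₀ v₁ v₂ t = v₁ t := if_pos ht.2
    simp only [dens_congr hc (path_concat_of_le ht.1 ht.2), hc]
  · refine setIntegral_congr_fun measurableSet_Ioc fun t ht => ?_
    have hc : concat t₀ v₁ v₂ t = v₂ t := if_neg (not_le.2 ht.1)
    simp only [dens_congr hc (path_concat_of_ge ht₀ h₁ h₂ heq ht.1.le ht.2), hc]

/-- Two minimizers that meet can be glued. -/
theorem Admissible.isMin_concat (hA : Admissible Ψ η Q B C K L) (ht₀ : t₀ ∈ Icc 0 T)
    (h₁ : IsMin δ lam Ψ η Q x₁ v₁) (h₂ : IsMin δ lam Ψ η Q x₂ v₂)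
    (heq : path Λ x₁ v₁ t₀ = path Λ x₂ v₂ t₀) :
    IsMin δ lam Ψ η Q x₁ (concat t₀ v₁ v₂) := by
  refine ⟨memLp_concat h₁.1 h₂.1, fun v' hv' => le_trans ?_ (h₁.2 v' hv')⟩
  -- The competitor follows `v₂` up to t₀ and `v₁` afterwards, so minimality of `v₂` says that its
  -- remaining cost from the meeting point is no larger than that of `v₁`.
  have h := h₂.2 _ (memLp_concat (t₀ := t₀) h₂.1 h₁.1)
  rw [hA.action_concat ht₀ h₂.1 h₁.1 heq.symm, hA.action_eq ht₀ h₂.1] at h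
  rw [hA.action_concat ht₀ h₁.1 h₂.1 heq, hA.action_eq ht₀ h₁.1]
  linarith

-- A continuous representative of the glued velocity agrees with `g₁` on [0,t₀] and with `g₂` on
-- [t₀,T], hence with both at t₀. An interior t₀ makes both intervals nondegenerate.
omit hT in
theorem eq_of_concat_ae_eq {g g₁ g₂ : ℝ → E d} (ht₀ : t₀ ∈ Ioo 0 T) (hg : Continuous g)
    (hg₁ : Continuous g₁) (hg₂ : Continuous g₂) (h : concat t₀ v₁ v₂ =ᵐ[timeMeasure T] g)
    (h₁ : v₁ =ᵐ[timeMeasure T] g₁) (h₂ : v₂ =ᵐ[timeMeasure T] g₂) : g₁ t₀ = g₂ t₀ := by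
  have e1 : Icc 0 t₀ ⊆ {t | g t = g₁ t} := by
    refine Icc_subset_of_ae_mem ht₀.1 (isClosed_eq hg hg₁) ?_
    have hsub : Icc 0 t₀ ⊆ Icc 0 T := Icc_subset_Icc_right ht₀.2.le
    filter_upwards [ae_restrict_of_ae_restrict_of_subset hsub h,
      ae_restrict_of_ae_restrict_of_subset hsub h₁, ae_restrict_mem measurableSet_Icc]
      with t a1 a2 ht
    exact a1.symm.trans ((if_pos ht.2).trans a2)
  have e2 : Icc t₀ T ⊆ {t | g t = g₂ t} := by
    refine Icc_subset_of_ae_mem ht₀.2 (isClosed_eq hg hg₂) ?_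
    have hsub : Icc t₀ T ⊆ Icc 0 T := Icc_subset_Icc_left ht₀.1.le
    -- The point t₀ is discarded because there the glued velocity takes the value of `v₁`.
    rw [ae_restrict_congr_set Ioc_ae_eq_Icc.symm]
    have hsub' : Ioc t₀ T ⊆ Icc 0 T := Ioc_subset_Icc_self.trans hsub
    filter_upwards [ae_restrict_of_ae_restrict_of_subset hsub' h,
      ae_restrict_of_ae_restrict_of_subset hsub' h₂, ae_restrict_mem measurableSet_Ioc]
      with t a1 a2 ht
    exact a1.symm.trans ((if_neg (not_le.2 ht.1)).trans a2)
  exact (e1 (right_mem_Icc.2 ht₀.1.le)).symm.trans (e2 (left_mem_Icc.2 ht₀.2.le))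

end Concat

end VelocityMFG

end

/-! ### Transversality and equality of velocities at the final time -/

noncomputable section

namespace VelocityMFG

variable {d : ℕ} {Λ : AddSubgroup (E d)} {T : ℝ} [hΛ : Fact (IsSpaceOrTorus Λ)]
  [hT : Fact (0 < T)] {Ψ η : Dom Λ → ℝ} {Q : Measure (Curve Λ T)} {B C δ lam : ℝ} {K L : ℝ≥0}
  {x x₁ x₂ x' : E d} {v v₁ v₂ : ℝ → E d}

namespace Admissible

variable (hA : Admissible Ψ η Q B C K L)

include hA

/-- The momentum at the final time is almost opposite to the gradient of `Ψ`. -/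
theorem inner_average_mom_nonneg (hlam : 0 ≤ lam) (hv : IsMin δ lam Ψ η Q x v) {G₀ : ℝ}
    (hG₀ : 0 ≤ G₀)
    (hG : ∀ᵐ t ∂(timeMeasure T), lam * C / 2 * dens η Q (path Λ x v) v t ≤ G₀)
    (hx' : (x' : Dom Λ) = path Λ x v T)
    (hΨ : DifferentiableAt ℝ (fun x : E d => Ψ (x : Dom Λ)) x') (e : E d) {ρ : ℝ}
    (hρ : ρ ∈ Ioo 0 T) :
    0 ≤ inner ℝ (ρ⁻¹ • ∫ t in (T - ρ)..T, mom δ lam η Q (path Λ x v) v t) e + ‖e‖ * G₀ * ρ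
      + fderiv ℝ (fun x : E d => Ψ (x : Dom Λ)) x' e := by
  have hC := hA.C_nonneg
  have hy : AEStronglyMeasurable (path Λ x v) (timeMeasure T) :=
    aestronglyMeasurable_path x (hv.1.integrable one_le_two)
  have hs0 : 0 ≤ T - ρ := by linarith [hρ.2]
  -- The window ends exactly at T: its primitive equals e there and vanishes before T - ρ, so the
  -- density contributes only O(ρ).
  have h1 := hA.weak_bound_of_differentiableAt hlam hv
    ((measurable_window (T - ρ) ρ).smul_const e) (exists_norm_window_smul_le hρ.1 e) hx' hΨ
  rw [integral_inner_window_smul hρ.1 hs0 (by linarith) (hA.integrable_mom hv.1 hy)] at h1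
  simp only [intervalIntegral.integral_smul_const, sub_add_cancel] at h1
  rw [integral_window_eq_one hρ.1 hs0 (by linarith), one_smul] at h1
  have h2 : ∫ t in Icc 0 T, ‖(∫ τ in (0 : ℝ)..t, window (T - ρ) ρ τ) • e‖
        * (lam * C / 2 * dens η Q (path Λ x v) v t)
      ≤ ∫ t in Icc 0 T, (Ioc (T - ρ) T).indicator (fun _ => ‖e‖ * G₀) t := by
    have hdn : ∀ t, 0 ≤ lam * C / 2 * dens η Q (path Λ x v) v t := fun t =>
      mul_nonneg (by positivity) (hA.dens_nonneg t)
    refine integral_mono_of_nonneg (ae_of_all _ fun t => mul_nonneg (norm_nonneg _) (hdn t))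
      ((integrableOn_const (by simp)).indicator measurableSet_Ioc) ?_
    filter_upwards [ae_restrict_mem measurableSet_Icc, hG] with t ht hGt
    by_cases hts : t ≤ T - ρ
    · rw [integral_window_eq_zero hs0 hts, zero_smul, norm_zero, zero_mul]
      exact indicator_nonneg (fun _ _ => by positivity) t
    · rw [indicator_of_mem (show t ∈ Ioc (T - ρ) T from ⟨not_le.1 hts, ht.2⟩)]
      rw [← intervalIntegral.integral_smul_const]
      exact mul_le_mul (norm_integral_window_smul_le hρ.1 ht.1 e) hGt (hdn t) (norm_nonneg _)
  have hsub : Ioc (T - ρ) T ⊆ Icc 0 T := fun t ht => ⟨hs0.trans ht.1.le, ht.2⟩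
  rw [setIntegral_indicator measurableSet_Ioc, inter_eq_right.2 hsub, setIntegral_const,
    measureReal_def, Real.volume_Ioc, sub_sub_cancel, ENNReal.toReal_ofReal hρ.1.le,
    smul_eq_mul, mul_comm ρ] at h2
  linarith

/-- At a common position the difference of the momenta is (δ + λa) times that of the velocities. The
two curves meet only at T; at time t the bounded speeds and Lipschitz velocities leave an error of
order T - t, collected in k. The nonnegative term λa|e|² is discarded. -/
theorem inner_mom_sub_ge (hδ : 0 ≤ δ) (hlam : 0 ≤ lam) (h₁ : MemLp v₁ 2 (timeMeasure T))
    (h₂ : MemLp v₂ 2 (timeMeasure T)) {V : ℝ} (hV0 : 0 ≤ V)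
    (hV : ∀ᵐ t ∂(timeMeasure T), ∀ᵐ ω ∂Q, ‖vel ω t‖ ≤ V)
    (hv₁ : ∀ᵐ t ∂(timeMeasure T), ‖v₁ t‖ ≤ V) (hv₂ : ∀ᵐ t ∂(timeMeasure T), ‖v₂ t‖ ≤ V)
    {g₁ g₂ : ℝ → E d} {ℓ₁ ℓ₂ : ℝ≥0} (hg₁ : LipschitzWith ℓ₁ g₁) (hg₂ : LipschitzWith ℓ₂ g₂)
    (hvg₁ : v₁ =ᵐ[timeMeasure T] g₁) (hvg₂ : v₂ =ᵐ[timeMeasure T] g₂)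
    (heq : path Λ x₁ v₁ T = path Λ x₂ v₂ T) :
    ∃ k : ℝ, 0 ≤ k ∧ ∀ᵐ t ∂(timeMeasure T), δ * ‖g₁ T - g₂ T‖ ^ 2 - k * (T - t)
      ≤ inner ℝ (mom δ lam η Q (path Λ x₁ v₁) v₁ t - mom δ lam η Q (path Λ x₂ v₂) v₂ t)
        (g₁ T - g₂ T) := by
  have hB := hA.B_nonneg
  set e := g₁ T - g₂ T with he
  refine ⟨(δ + lam * B) * ((ℓ₁ + ℓ₂) * ‖e‖) + lam * (K * (2 * V) * (2 * V)) * ‖e‖,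
    by positivity, ?_⟩
  filter_upwards [hV, hv₂, hvg₁, hvg₂, ae_restrict_mem measurableSet_Icc] with t a1 a3 a4 a5 ht
  have htT : 0 ≤ T - t := sub_nonneg.2 ht.2
  have hTm : T ∈ Icc 0 T := right_mem_Icc.2 hT.out.le
  have hd : dist (path Λ x₁ v₁ t) (path Λ x₂ v₂ t) ≤ 2 * V * (T - t) := by
    have d1 := dist_path_le (Λ := Λ) (x := x₁) (h₁.integrable one_le_two) hv₁ hTm ht
    have d2 := dist_path_le (Λ := Λ) (x := x₂) (h₂.integrable one_le_two) hv₂ ht hTm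
    rw [abs_sub_comm, abs_of_nonneg htT] at d1
    rw [abs_of_nonneg htT, ← heq] at d2
    have := dist_triangle (path Λ x₁ v₁ t) (path Λ x₁ v₁ T) (path Λ x₂ v₂ t)
    linarith
  have hR := hA.norm_relMom_sub_le (y := path Λ x₁ v₁) (y' := path Λ x₂ v₂) (v := v₁) (v' := v₂)
    (M := 0) (κ := K * (2 * V * (T - t) + 0)) (by positivity) (ae_of_all _ fun ω => by simp) a1 a1
    a3 (ae_of_all _ fun ω => hA.abs_eta_sub_le hd (by simp))
  have ha := hA.weight_mem_Icc (path Λ x₁ v₁ t) t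
  set a := ∫ ω, η (path Λ x₁ v₁ t - curveAt ω t) ∂Q
  set R := relMom η Q (path Λ x₁ v₁) v₁ t - relMom η Q (path Λ x₂ v₂) v₂ t - a • (v₁ t - v₂ t)
    with hRdef
  have hm : mom δ lam η Q (path Λ x₁ v₁) v₁ t - mom δ lam η Q (path Λ x₂ v₂) v₂ t
      = (δ + lam * a) • (g₁ t - g₂ t) + lam • R := by
    rw [← a4, ← a5, hRdef]
    simp only [mom, smul_sub, add_smul, mul_smul]
    abel
  have hΔ : ‖e - (g₁ t - g₂ t)‖ ≤ (ℓ₁ + ℓ₂) * (T - t) := by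
    have b1 := hg₁.dist_le_mul T t
    have b2 := hg₂.dist_le_mul T t
    rw [Real.dist_eq, abs_of_nonneg htT, dist_eq_norm] at b1 b2
    have : e - (g₁ t - g₂ t) = (g₁ T - g₁ t) - (g₂ T - g₂ t) := by rw [he]; abel
    rw [this]
    refine (norm_sub_le _ _).trans ?_
    linarith
  have i1 : ‖e‖ ^ 2 - (ℓ₁ + ℓ₂) * (T - t) * ‖e‖ ≤ inner ℝ (g₁ t - g₂ t) e := by
    have h3 : (inner ℝ (e - (g₁ t - g₂ t)) e : ℝ) ≤ (ℓ₁ + ℓ₂) * (T - t) * ‖e‖ :=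
      (real_inner_le_norm _ _).trans (mul_le_mul_of_nonneg_right hΔ (norm_nonneg _))
    rw [inner_sub_left, real_inner_self_eq_norm_sq] at h3
    linarith
  have i2 : -(K * (2 * V * (T - t)) * (2 * V) * ‖e‖) ≤ inner ℝ R e := by
    have h4 := (abs_le.1 (abs_real_inner_le_norm R e)).1
    rw [mul_zero, zero_add, add_zero] at hR
    have := mul_le_mul_of_nonneg_right hR (norm_nonneg e)
    linarith
  rw [hm, inner_add_left, inner_smul_left, inner_smul_left]
  simp only [conj_trivial]
  have hpos : 0 ≤ δ + lam * a := add_nonneg hδ (mul_nonneg hlam ha.1)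
  have i3 := mul_le_mul_of_nonneg_left i1 hpos
  have i4 := mul_le_mul_of_nonneg_left i2 hlam
  have i5 : lam * a ≤ lam * B := mul_le_mul_of_nonneg_left ha.2 hlam
  have i6 : (lam * a) * ((ℓ₁ + ℓ₂) * (T - t) * ‖e‖) ≤ (lam * B) * ((ℓ₁ + ℓ₂) * (T - t) * ‖e‖) :=
    mul_le_mul_of_nonneg_right i5 (by positivity)
  have i7 : 0 ≤ lam * a * ‖e‖ ^ 2 := mul_nonneg (mul_nonneg hlam ha.1) (sq_nonneg _)
  linarith

/-- Two minimizers that end at the same point, where `Ψ` is differentiable, end with the same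
velocity. -/
theorem eq_of_path_end_eq (hδ : 0 < δ) (hlam : 0 ≤ lam) (h₁ : IsMin δ lam Ψ η Q x₁ v₁)
    (h₂ : IsMin δ lam Ψ η Q x₂ v₂) {V : ℝ} (hV0 : 0 ≤ V)
    (hV : ∀ᵐ t ∂(timeMeasure T), ∀ᵐ ω ∂Q, ‖vel ω t‖ ≤ V)
    (hv₁ : ∀ᵐ t ∂(timeMeasure T), ‖v₁ t‖ ≤ V) (hv₂ : ∀ᵐ t ∂(timeMeasure T), ‖v₂ t‖ ≤ V)
    {g₁ g₂ : ℝ → E d} {ℓ₁ ℓ₂ : ℝ≥0} (hg₁ : LipschitzWith ℓ₁ g₁) (hg₂ : LipschitzWith ℓ₂ g₂)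
    (hvg₁ : v₁ =ᵐ[timeMeasure T] g₁) (hvg₂ : v₂ =ᵐ[timeMeasure T] g₂)
    (hx₁ : (x' : Dom Λ) = path Λ x₁ v₁ T) (hx₂ : (x' : Dom Λ) = path Λ x₂ v₂ T)
    (hΨ : DifferentiableAt ℝ (fun x : E d => Ψ (x : Dom Λ)) x') : g₁ T = g₂ T := by
  have hB := hA.B_nonneg
  have hC := hA.C_nonneg
  have hT0 := hT.out
  obtain ⟨k, hk0, hk⟩ := hA.inner_mom_sub_ge hδ.le hlam h₁.1 h₂.1 hV0 hV hv₁ hv₂ hg₁ hg₂ hvg₁ hvg₂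
    (hx₁.symm.trans hx₂)
  set e := g₁ T - g₂ T with he
  set G₀ := lam * C / 2 * ((2 * V) ^ 2 * B)
  have hG₀ : 0 ≤ G₀ := by positivity
  have hG : ∀ {x : E d} {v : ℝ → E d}, (∀ᵐ t ∂(timeMeasure T), ‖v t‖ ≤ V) →
      ∀ᵐ t ∂(timeMeasure T), lam * C / 2 * dens η Q (path Λ x v) v t ≤ G₀ := fun hv => by
    filter_upwards [hv, hV] with t a1 a2
    exact mul_le_mul_of_nonneg_left (hA.dens_le a1 a2) (by positivity)
  set m₁ := mom δ lam η Q (path Λ x₁ v₁) v₁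
  set m₂ := mom δ lam η Q (path Λ x₂ v₂) v₂
  have im₁ : IntegrableOn m₁ (Icc 0 T) :=
    hA.integrable_mom h₁.1 (aestronglyMeasurable_path x₁ (h₁.1.integrable one_le_two))
  have im₂ : IntegrableOn m₂ (Icc 0 T) :=
    hA.integrable_mom h₂.1 (aestronglyMeasurable_path x₂ (h₂.1.integrable one_le_two))
  -- Transversality is used with direction -e for the first curve and e for the second, so the
  -- gradients of Ψ cancel. The remaining inequality contradicts strict monotonicity of z unless e =
  -- 0.
  have key : ∀ ρ ∈ Ioo 0 T, δ * ‖e‖ ^ 2 ≤ (k + 2 * (‖e‖ * G₀)) * ρ := by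
    intro ρ hρ
    have a1 := hA.inner_average_mom_nonneg hlam h₁ hG₀ (hG hv₁) hx₁ hΨ (-e) hρ
    have a2 := hA.inner_average_mom_nonneg hlam h₂ hG₀ (hG hv₂) hx₂ hΨ e hρ
    rw [inner_neg_right, map_neg, norm_neg] at a1
    have hsub : Ioc (T - ρ) T ⊆ Icc 0 T := fun t ht => ⟨by linarith [hρ.2, ht.1], ht.2⟩
    have i12 : IntegrableOn (fun t => inner ℝ (m₁ t - m₂ t) e) (Ioc (T - ρ) T) :=
      ((im₁.sub im₂).mono_set hsub).inner_const e
    have a3 : ∫ _ in Ioc (T - ρ) T, (δ * ‖e‖ ^ 2 - k * ρ)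
        ≤ ∫ t in Ioc (T - ρ) T, inner ℝ (m₁ t - m₂ t) e := by
      refine integral_mono_ae (integrable_const _) i12 ?_
      filter_upwards [ae_restrict_of_ae_restrict_of_subset hsub hk,
        ae_restrict_mem measurableSet_Ioc] with t b1 b2
      refine le_trans ?_ b1
      have := mul_le_mul_of_nonneg_left (show T - t ≤ ρ by linarith [b2.1]) hk0
      linarith
    have a4 : ∫ t in Ioc (T - ρ) T, inner ℝ (m₁ t - m₂ t) e
        = inner ℝ (∫ t in (T - ρ)..T, m₁ t) e - inner ℝ (∫ t in (T - ρ)..T, m₂ t) e := by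
      rw [← inner_sub_left, intervalIntegral.integral_of_le (by linarith [hρ.1]),
        intervalIntegral.integral_of_le (by linarith [hρ.1]),
        ← integral_sub (im₁.mono_set hsub) (im₂.mono_set hsub), real_inner_comm,
        ← integral_inner (f := fun t => m₁ t - m₂ t)
          ((im₁.mono_set hsub).sub (im₂.mono_set hsub)) e]
      exact integral_congr_ae (ae_of_all _ fun t => real_inner_comm _ _)
    rw [a4, setIntegral_const, measureReal_def, Real.volume_Ioc, sub_sub_cancel,
      ENNReal.toReal_ofReal hρ.1.le, smul_eq_mul] at a3
    rw [real_inner_smul_left] at a1 a2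
    have a5 : δ * ‖e‖ ^ 2 - k * ρ ≤ ρ⁻¹ * (inner ℝ (∫ t in (T - ρ)..T, m₁ t) e
        - inner ℝ (∫ t in (T - ρ)..T, m₂ t) e) := by
      rw [← div_eq_inv_mul, le_div_iff₀ hρ.1]
      linarith
    linarith
  have hlim : Tendsto (fun ρ : ℝ => (k + 2 * (‖e‖ * G₀)) * ρ) (𝓝[>] 0)
      (𝓝 ((k + 2 * (‖e‖ * G₀)) * 0)) :=
    ((continuous_const.mul continuous_id).tendsto 0).mono_left nhdsWithin_le_nhds
  have hfin : δ * ‖e‖ ^ 2 ≤ (k + 2 * (‖e‖ * G₀)) * 0 := by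
    refine ge_of_tendsto hlim ?_
    filter_upwards [Ioo_mem_nhdsGT hT0] with ρ hρ using key ρ hρ
  rw [mul_zero] at hfin
  have h0 : ‖e‖ ^ 2 ≤ 0 := by
    by_contra hn
    exact absurd hfin (not_le.2 (mul_pos hδ (not_le.1 hn)))
  have : ‖e‖ = 0 := by nlinarith [norm_nonneg e]
  exact sub_eq_zero.1 (norm_eq_zero.1 this)

end Admissible

/-- The field `z` of the statement is the momentum. -/
theorem Admissible.ae_zField_eq (hA : Admissible Ψ η Q B C K L) (γ : Curve Λ T) :
    ∀ᵐ t ∂(timeMeasure T),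
      zField δ lam η Q γ t = mom δ lam η Q (curveAt γ) (vel γ) t := by
  have := hA.prob
  have hIoo : ∀ᵐ t ∂(timeMeasure T), t ∈ Ioo 0 T := by
    rw [ae_restrict_congr_set Ioo_ae_eq_Icc.symm]
    exact ae_restrict_mem measurableSet_Ioo
  filter_upwards [hA.ae_integrable_vel, hIoo] with t ht htT
  have htc := Ioo_subset_Icc_self htT
  have hpos : ∀ γ : Curve Λ T, pos γ t = curveAt γ t := fun γ => pos_eq_curveAt γ htc
  have hvel : ∀ γ : Curve Λ T, velocity γ t = vel γ t := fun γ => velocity_eq_vel γ htT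
  have ha : 0 < ∫ ω, η (curveAt γ t - curveAt ω t) ∂Q := by
    rw [integral_pos_iff_support_of_nonneg (fun _ => (hA.eta_pos _).le)
      (hA.integrable_eta (curveAt γ t) t)]
    have : Function.support (fun ω : Curve Λ T => η (curveAt γ t - curveAt ω t)) = univ :=
      eq_univ_of_forall fun ω => (hA.eta_pos _).ne'
    rw [this]
    simp
  simp only [zField, aField, uField, hpos, hvel]
  rw [mom, hA.relMom_eq ht]
  congr 1
  rw [mul_smul, smul_sub, smul_smul, mul_inv_cancel₀ ha.ne', one_smul]

end VelocityMFG

end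

/-! ### Assembly of the three conclusions -/

theorem mainTheorem5 (d : ℕ) (Λ : AddSubgroup (VelocityMFG.E d))
    (hΛ : VelocityMFG.IsSpaceOrTorus Λ)
    (T δ lam : ℝ) (hT : 0 < T) (hδ : 0 < δ) (hlam : 0 < lam)
    (Ψ η : VelocityMFG.Dom Λ → ℝ)
    (hΨ : ∃ L : ℝ≥0, LipschitzWith L Ψ)
    (hη_pos : ∀ x, 0 < η x) (hη_bdd : ∃ B : ℝ, ∀ x, η x ≤ B)
    (hη_lip : ∃ L : ℝ≥0, LipschitzWith L η)
    (hη_grad : ∃ C : ℝ, ∀ y : VelocityMFG.E d,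
      DifferentiableAt ℝ (fun x : VelocityMFG.E d => η (x : VelocityMFG.Dom Λ)) y →
        ‖fderiv ℝ (fun x : VelocityMFG.E d => η (x : VelocityMFG.Dom Λ)) y‖ ≤
          C * η (y : VelocityMFG.Dom Λ))
    (m₀ : Measure (VelocityMFG.Dom Λ)) [IsProbabilityMeasure m₀]
    (hm₀ : ∫⁻ x, ENNReal.ofReal (-Ψ x) ∂m₀ < ⊤)
    (Q : Measure (VelocityMFG.Curve Λ T))
    (hQ : VelocityMFG.IsEquilibrium δ lam Ψ η m₀ Q) :
    VelocityMFG.zSup δ lam Ψ η Q < ⊤ ∧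
    (∀ γ : VelocityMFG.Curve Λ T, VelocityMFG.IsOptimal δ lam Ψ η Q γ →
      VelocityMFG.IsC11 γ ∧
      ∀ t ∈ Icc 0 T, ‖VelocityMFG.velocity γ t‖ ≤ (VelocityMFG.zSup δ lam Ψ η Q).toReal / δ) ∧
    (∀ γ₁ ∈ Q.support, ∀ γ₂ ∈ Q.support, ∀ t ∈ Ioc 0 T,
      VelocityMFG.pos γ₁ t = VelocityMFG.pos γ₂ t →
      (t = T → ∃ x : VelocityMFG.E d, (x : VelocityMFG.Dom Λ) = VelocityMFG.pos γ₁ T ∧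
        DifferentiableAt ℝ (fun y : VelocityMFG.E d => Ψ (y : VelocityMFG.Dom Λ)) x) →
      VelocityMFG.velocity γ₁ t = VelocityMFG.velocity γ₂ t) := by
  obtain ⟨L, hΨ⟩ := hΨ
  obtain ⟨B, hη_le⟩ := hη_bdd
  obtain ⟨K, hη_lip⟩ := hη_lip
  obtain ⟨C, hC⟩ := hη_grad
  have : Fact (VelocityMFG.IsSpaceOrTorus Λ) := ⟨hΛ⟩
  have : Fact (0 < T) := ⟨hT⟩
  have hA := hQ.admissible hδ hη_pos hη_le hη_lip hC hΨ hm₀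
  have := hA.prob
  set Z := VelocityMFG.zSup δ lam Ψ η Q with hZdef
  have hlift : ∀ γ : VelocityMFG.Curve Λ T, ∃ x : VelocityMFG.E d,
      (x : VelocityMFG.Dom Λ) = VelocityMFG.curveAt γ 0 := fun γ =>
    QuotientAddGroup.mk_surjective _
  have hmomeq : ∀ {γ : VelocityMFG.Curve Λ T} {x : VelocityMFG.E d}, VelocityMFG.IsH1 γ →
      (x : VelocityMFG.Dom Λ) = VelocityMFG.curveAt γ 0 →
      ∀ᵐ t ∂(VelocityMFG.timeMeasure T), VelocityMFG.mom δ lam η Q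
        (VelocityMFG.path Λ x (VelocityMFG.vel γ)) (VelocityMFG.vel γ) t
        = VelocityMFG.mom δ lam η Q (VelocityMFG.curveAt γ) (VelocityMFG.vel γ) t := by
    intro γ x hγ hx
    filter_upwards [ae_restrict_mem measurableSet_Icc] with t ht
    exact VelocityMFG.mom_congr (hγ.path_eq hx ht)
  obtain ⟨M, hM0, hM⟩ := hA.exists_forall_norm_mom_le (δ := δ) (lam := lam) hδ hlam.le
  have hZM : Z ≤ ENNReal.ofReal M := by
    refine iSup₂_le fun γ hγ => ?_
    obtain ⟨x, hx⟩ := hlift γ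
    obtain ⟨hγ1, hγm⟩ := hA.isMin_of_isOptimal hδ hlam.le hγ hx
    rw [eLpNorm_exponent_top]
    refine eLpNormEssSup_le_of_ae_bound ?_
    filter_upwards [hM x _ hγm, hmomeq hγ1 hx, hA.ae_zField_eq (δ := δ) (lam := lam) γ]
      with t h1 h2 h3
    rwa [h3, ← h2]
  have hZtop : Z < ⊤ := hZM.trans_lt ENNReal.ofReal_lt_top
  have hopt : ∀ γ, VelocityMFG.IsOptimal δ lam Ψ η Q γ →
      ∀ᵐ t ∂(VelocityMFG.timeMeasure T), ‖VelocityMFG.mom δ lam η Q (VelocityMFG.curveAt γ)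
        (VelocityMFG.vel γ) t‖ ≤ Z.toReal := by
    intro γ hγ
    have h1 : eLpNorm (VelocityMFG.zField δ lam η Q γ) ⊤ (VelocityMFG.timeMeasure T) ≤ Z :=
      le_iSup₂ (f := fun (γ : VelocityMFG.Curve Λ T)
        (_ : VelocityMFG.IsOptimal δ lam Ψ η Q γ) =>
        eLpNorm (VelocityMFG.zField δ lam η Q γ) ⊤ (VelocityMFG.timeMeasure T)) γ hγ
    rw [eLpNorm_exponent_top] at h1
    filter_upwards [enorm_ae_le_eLpNormEssSup (VelocityMFG.zField δ lam η Q γ)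
      (VelocityMFG.timeMeasure T), hA.ae_zField_eq (δ := δ) (lam := lam) γ] with t h2 h3
    rw [← h3, ← toReal_enorm]
    exact ENNReal.toReal_mono hZtop.ne (h2.trans h1)
  have hsupp : ∀ᵐ ω ∂Q, ω ∈ Q.support := Measure.support_mem_ae
  have hmin : ∀ᵐ ω ∂Q, ∃ x : VelocityMFG.E d, (x : VelocityMFG.Dom Λ) = VelocityMFG.curveAt ω 0 ∧
      VelocityMFG.IsMin δ lam Ψ η Q x (VelocityMFG.vel ω) := by
    filter_upwards [hsupp] with ω hω
    obtain ⟨x, hx⟩ := hlift ω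
    exact ⟨x, hx, (hA.isMin_of_isOptimal hδ hlam.le (hQ.optimal ω hω) hx).2⟩
  have hZae : ∀ᵐ ω ∂Q, ∀ᵐ t ∂(VelocityMFG.timeMeasure T), ‖VelocityMFG.mom δ lam η Q
      (VelocityMFG.curveAt ω) (VelocityMFG.vel ω) t‖ ≤ Z.toReal := by
    filter_upwards [hsupp] with ω hω using hopt ω (hQ.optimal ω hω)
  -- The weaker constant `M` is kept for the glued velocity below, which is known as a minimizer in
  -- the sense of `IsMin` and so has its momentum bounded by `M`.
  have hMae : ∀ᵐ ω ∂Q, ∀ᵐ t ∂(VelocityMFG.timeMeasure T), ‖VelocityMFG.mom δ lam η Q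
      (VelocityMFG.curveAt ω) (VelocityMFG.vel ω) t‖ ≤ M := by
    filter_upwards [hZae] with ω hω
    filter_upwards [hω] with t ht
    exact ht.trans (ENNReal.toReal_le_of_le_ofReal hM0 hZM)
  have hreg : ∀ γ, VelocityMFG.IsOptimal δ lam Ψ η Q γ → ∃ (ℓ : ℝ≥0) (g : ℝ → VelocityMFG.E d),
      LipschitzWith ℓ g ∧ VelocityMFG.vel γ =ᵐ[VelocityMFG.timeMeasure T] g ∧
      (∀ t ∈ Icc 0 T, ‖g t‖ ≤ Z.toReal / δ) ∧ DifferentiableOn ℝ (VelocityMFG.lift γ) (Icc 0 T) ∧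
      ∀ t ∈ Icc 0 T, VelocityMFG.velocity γ t = g t := by
    intro γ hγ
    obtain ⟨x, hx⟩ := hlift γ
    obtain ⟨hγ1, hγm⟩ := hA.isMin_of_isOptimal hδ hlam.le hγ hx
    obtain ⟨ℓ, g, hg, hvg, hgZ⟩ := hA.exists_lipschitz_velocity hδ hlam.le
      ENNReal.toReal_nonneg hmin hZae hγm (by
        filter_upwards [hopt γ hγ, hmomeq hγ1 hx] with t h1 h2
        rwa [h2])
    exact ⟨ℓ, g, hg, hvg, hgZ, hγ1.velocity_eq hg.continuous hvg⟩
  refine ⟨hZtop, fun γ hγ => ?_, fun γ₁ hγ₁ γ₂ hγ₂ t ht heq hdiff => ?_⟩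
  · obtain ⟨ℓ, g, hg, hvg, hgZ, hd, hvel⟩ := hreg γ hγ
    refine ⟨⟨hd, ℓ, ?_⟩, fun t ht => (hvel t ht).symm ▸ hgZ t ht⟩
    refine LipschitzOnWith.of_dist_le_mul fun s hs t ht => ?_
    rw [hvel s hs, hvel t ht]
    exact hg.dist_le_mul s t
  · have htc : t ∈ Icc 0 T := Ioc_subset_Icc_self ht
    have ho₁ := hQ.optimal γ₁ hγ₁
    have ho₂ := hQ.optimal γ₂ hγ₂
    obtain ⟨x₁, hx₁⟩ := hlift γ₁
    obtain ⟨x₂, hx₂⟩ := hlift γ₂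
    obtain ⟨hγ₁1, hm₁⟩ := hA.isMin_of_isOptimal hδ hlam.le ho₁ hx₁
    obtain ⟨hγ₂1, hm₂⟩ := hA.isMin_of_isOptimal hδ hlam.le ho₂ hx₂
    obtain ⟨ℓ₁, g₁, hg₁, hvg₁, hgZ₁, -, hvel₁⟩ := hreg γ₁ ho₁
    obtain ⟨ℓ₂, g₂, hg₂, hvg₂, hgZ₂, -, hvel₂⟩ := hreg γ₂ ho₂
    rw [hvel₁ t htc, hvel₂ t htc]
    have hpath : VelocityMFG.path Λ x₁ (VelocityMFG.vel γ₁) t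
        = VelocityMFG.path Λ x₂ (VelocityMFG.vel γ₂) t := by
      rw [hγ₁1.path_eq hx₁ htc, hγ₂1.path_eq hx₂ htc, ← VelocityMFG.pos_eq_curveAt γ₁ htc,
        ← VelocityMFG.pos_eq_curveAt γ₂ htc, heq]
    rcases ht.2.lt_or_eq with htT | rfl
    · obtain ⟨ℓ, g, hg, hvg, -⟩ := hA.exists_lipschitz_velocity hδ hlam.le hM0 hmin hMae
        (hA.isMin_concat htc hm₁ hm₂ hpath) (hM _ _ (hA.isMin_concat htc hm₁ hm₂ hpath))
      exact VelocityMFG.eq_of_concat_ae_eq ⟨ht.1, htT⟩ hg.continuous hg₁.continuous hg₂.continuous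
        hvg hvg₁ hvg₂
    -- From here on the final time T is named `t`.
    · obtain ⟨x, hx, hΨx⟩ := hdiff rfl
      rw [VelocityMFG.pos_eq_curveAt γ₁ htc, ← hγ₁1.path_eq hx₁ htc] at hx
      have hbd : ∀ {v g : ℝ → VelocityMFG.E d}, v =ᵐ[VelocityMFG.timeMeasure t] g →
          (∀ s ∈ Icc 0 t, ‖g s‖ ≤ Z.toReal / δ) →
          ∀ᵐ s ∂(VelocityMFG.timeMeasure t), ‖v s‖ ≤ Z.toReal / δ := fun h1 h2 => by
        filter_upwards [h1, ae_restrict_mem measurableSet_Icc] with s h3 h4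
        rw [h3]
        exact h2 s h4
      exact hA.eq_of_path_end_eq hδ hlam.le hm₁ hm₂ (by positivity)
        (hA.ae_ae_norm_vel_le hδ hlam.le hZae) (hbd hvg₁ hgZ₁) (hbd hvg₂ hgZ₂) hg₁ hg₂ hvg₁ hvg₂ hx
        (hx.trans hpath) hΨx
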